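/- Let $\mathcal{L}_{\mathrm{Set}}=\{\in\}$. For a language $\mathcal{L}\supseteq\mathcal{L}_{\mathrm{Set}}$, $\mathrm{ZF}(\mathcal{L})$ is $\mathrm{ZF}$ with the separation and collection schemes extended to all $\mathcal{L}$-formulae (with parameters). $\mathrm{ZFI}$ is the theory in $\mathcal{L}_{\mathrm{Set}}(I)$, $I$ a unary predicate, with the axioms: $\mathrm{ZF}(\mathcal{L}_{\mathrm{Set}}(I))$; "$I$ is a cofinal subclass of $\mathrm{Ord}$"; and, for every $\mathcal{L}_{\mathrm{Set}}$-formula $\varphi(v_1,\dots,v_n)$, the sentence saying that $\varphi(x_1,\dots,x_n)\leftrightarrow\varphi(y_1,\dots,y_n)$ whenever $x_1\in\dots\in x_n$ and $y_1\in\dots\in y_n$ are elements of $I$. $\mathrm{ZFI}_<$ is the theory in $\mathcal{L}_{\mathrm{Set}}(<,I)$ with the axioms: $\mathrm{ZF}(\mathcal{L}_{\mathrm{Set}}(<,I))$; "$<$ is a linear order and every nonempty set has a $<$-least element"; "$I$ is a cofinal subclass of $\mathrm{Ord}$"; and the same indiscernibility scheme for all $\mathcal{L}_{\mathrm{Set}}(<)$-formulae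 $\varphi$. Let $\mathcal{L}$ be $\mathcal{L}_{\mathrm{Set}}$ or $\mathcal{L}_{\mathrm{Set}}(<)$ and let $\mathcal{M}\models\mathrm{ZF}(\mathcal{L})$ have universe $M$. Inside $\mathcal{M}$, let $\mathcal{L}^+$ be $\mathcal{L}$ with a constant $c_a$ for each set $a$; formulae are built with $\neg,\vee,\exists$. The $\Sigma_n$- and $\Pi_n$-formulae ($n\in\omega^{\mathcal{M}}$) are those of the Levy hierarchy in $\mathcal{M}$: $\Sigma_0=\Pi_0$ is the closure of the atomic formulae under Boolean operations and bounded quantification; $\neg$ interchanges $\Sigma_n$ and $\Pi_n$; both classes contain $\Sigma_0$ and are closed under $\vee$; $\Sigma_{n+1}$ contains $\Pi_n$ and is closed under $\exists$; $\Pi_{n+1}$ contains $\Sigma_n$; and these are the least classes with these closure properties (so every formula lies in some $\Sigma_n$). For $k\in\omega^{\mathcal{M}}$, a set $S\subseteq M$ is a $\Sigma_k$-satisfaction class for $\mathcal{M}$ if in $(\mathcal{M},S)$: an atomic sentence $c_x=c_y$, $c_x\in c_y$ (and $c_x<c_y$, if $<$ is in $\mathcal{L}$) is in $S$ iff $x=y$,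 $x\in y$ (and $x<y$), respectively; and for every $\Sigma_k$-sentence $\varphi$ of $\mathcal{L}^+$: if $\varphi=\neg\psi$, then $\varphi\in S$ iff $\psi\notin S$; if $\varphi=\psi_1\vee\psi_2$, then $\varphi\in S$ iff $\psi_1\in S$ or $\psi_2\in S$; if $\varphi=\exists v\,\psi(v)$, then $\varphi\in S$ iff $\psi(c_x)\in S$ for some $x$. $S$ is a $\Sigma_\omega$-satisfaction class if this holds for every metatheoretic natural number $k$, and a full satisfaction class if it holds for every $k\in\omega^{\mathcal{M}}$. $S$ is amenable over $\mathcal{M}$ if $(\mathcal{M},S)\models\mathrm{ZF}(\mathcal{L}(S))$. $\mathcal{M}$ is $\omega$-standard if $(\omega,\in)^{\mathcal{M}}\cong(\omega,\in)$. **Theorem.** There is a formula $\sigma(x)$ of $\mathcal{L}_{\mathrm{Set}}(I)$ such that for every model $(\mathcal{M},I)\models\mathrm{ZFI}$ the set $\sigma^{(\mathcal{M},I)}\subseteq M$ defined by $\sigma$ in $(\mathcal{M},I)$ is an amenable $\Sigma_\omega$-satisfaction class for $\mathcal{M}$; and if moreover $\mathcal{M}$ is $\omega$-standard, then it is an amenable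 full satisfaction class for $\mathcal{M}$. Similarly, there is a formula $\sigma_<(x)$ of $\mathcal{L}_{\mathrm{Set}}(<,I)$ such that for every model $(\mathcal{M},<_M,I)\models\mathrm{ZFI}_<$ the set defined by $\sigma_<$ in $(\mathcal{M},<_M,I)$ is an amenable $\Sigma_\omega$-satisfaction class for $(\mathcal{M},<_M)$; and if moreover $\mathcal{M}$ is $\omega$-standard, then it is an amenable full satisfaction class for $(\mathcal{M},<_M)$. -/

import Mathlib

universe u

namespace ZFIndisc


/-! ### Languages and structures -/

/-- Relation symbols: membership, optionally (if `w`) a binary symbol `<`, and optionally (if `p`)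
one unary predicate symbol. -/
inductive SetRel (w p : Bool) : ℕ → Type
  | mem : SetRel w p 2
  | lt : w = true → SetRel w p 2
  | pred : p = true → SetRel w p 1

/-- `LSet false false` is `L_Set`, `LSet false true` is `L_Set(X)`, `LSet true false` is
`L_Set(<)`, and `LSet true true` is `L_Set(<, X)`; here `X` is a unary predicate symbol, which
also serves as the symbol `I`. Equality is a logical symbol. -/
def LSet (w p : Bool) : FirstOrder.Language.{0, 0} := ⟨fun _ => Empty, SetRel w p⟩

/-- `L_Set`-structures (`w = false`) and `L_Set(<)`-structures (`w = true`) with universe `M`. -/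
structure SetStr (w : Bool) (M : Type u) where
  mem : M → M → Prop
  lt : w = true → M → M → Prop

variable {w : Bool} {M : Type u}

/-- `A` as a first-order structure. -/
@[reducible] def SetStr.base (A : SetStr w M) : (LSet w false).Structure M where
  funMap := fun f => nomatch f
  RelMap := fun r => match r with
    | .mem => fun v => A.mem (v 0) (v 1)
    | .lt h => fun v => A.lt h (v 0) (v 1)

/-- The expansion `(A, X)` of `A` by a subset `X` of its universe. -/
@[reducible] def SetStr.expand (A : SetStr w M) (X : M → Prop) : (LSet w true).Structure M where
  funMap := fun f => nomatch f
  RelMap := fun r => match r with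
    | .mem => fun v => A.mem (v 0) (v 1)
    | .lt h => fun v => A.lt h (v 0) (v 1)
    | .pred _ => fun v => X (v 0)

/-- `A ⊨ φ(v)`. -/
def SetStr.Sat (A : SetStr w M) {n : ℕ} (φ : (LSet w false).Formula (Fin n)) (v : Fin n → M) :
    Prop :=
  letI := A.base
  φ.Realize v

/-- `(A, X) ⊨ φ(v)`. -/
def SetStr.SatX (A : SetStr w M) (X : M → Prop) {n : ℕ} (φ : (LSet w true).Formula (Fin n))
    (v : Fin n → M) : Prop :=
  letI := A.expand X
  φ.Realize v

/-- The subset of the universe defined in `(A, I)` by the formula `σ(x)`. -/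
def SetStr.definedSet (A : SetStr w M) (I : M → Prop) (σ : (LSet w true).Formula (Fin 1)) :
    M → Prop :=
  fun x => A.SatX I σ ![x]

/-! ### Set-theoretic notions of a model

In this section `E` is the membership relation of the model. All quantifiers over elements range
over the universe `M` of the model, so each notion is the interpretation in the model of the
usual first-order formula (with `IsNum E k`, for a metatheoretic `k`, the usual formula saying that
a set is the numeral `k`). -/

section Internal

variable (E : M → M → Prop)

/-- `x = ∅` -/
def IsZero (x : M) : Prop := ∀ z, ¬ E z x

/-- `y = x ∪ {x}` -/
def IsSucc (y x : M) : Prop := ∀ z, E z y ↔ E z x ∨ z = x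

/-- `x` is the `k`-th numeral of the model, for a metatheoretic natural number `k`. -/
def IsNum : ℕ → M → Prop
  | 0, x => IsZero E x
  | k + 1, x => ∃ y, IsNum k y ∧ IsSucc E x y

/-- `∅ ∈ x`, and `x` is closed under `y ↦ y ∪ {y}`. -/
def IsInductive (x : M) : Prop :=
  (∃ z, IsZero E z ∧ E z x) ∧ ∀ y, E y x → ∃ z, IsSucc E z y ∧ E z x

/-- `n ∈ ω` in the sense of the model. -/
def IsNat (n : M) : Prop := ∀ x, IsInductive E x → E n x

/-- `x` is transitive and is (strictly) well-ordered by membership. -/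
def IsOrd (x : M) : Prop :=
  (∀ y, E y x → ∀ z, E z y → E z x) ∧
  (∀ y, E y x → ¬ E y y) ∧
  (∀ a b c, E a x → E b x → E c x → E a b → E b c → E a c) ∧
  (∀ a b, E a x → E b x → E a b ∨ a = b ∨ E b a) ∧
  ∀ s, (∀ y, E y s → E y x) → (∃ y, E y s) → ∃ m, E m s ∧ ∀ y, E y s → m = y ∨ E m y

/-- `z = {a, b}` -/
def IsUPair (z a b : M) : Prop := ∀ y, E y z ↔ y = a ∨ y = b

/-- `p = ⟨a, b⟩ = {{a}, {a, b}}` -/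
def IsOPair (p a b : M) : Prop := ∀ z, E z p ↔ IsUPair E z a a ∨ IsUPair E z a b

/-- `⟨a, b⟩ ∈ W` -/
def PairIn (W a b : M) : Prop := ∃ p, IsOPair E p a b ∧ E p W

/-- `r = s ∪ {n}` -/
def IsInsert (r s n : M) : Prop := ∀ z, E z r ↔ E z s ∨ z = n

/-! ### Arithmetized syntax in a model

Formulae are built from `¬`, `∨`, `∃`, the variables `v_n` for `n ∈ ω` and the constants `c_a` for
all sets `a`, and are coded as follows: `v_n = ⟨0, n⟩`, `c_a = ⟨1, a⟩`, `(t = s) = ⟨0, ⟨t, s⟩⟩`,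
`(t ∈ s) = ⟨1, ⟨t, s⟩⟩`, `(t < s) = ⟨2, ⟨t, s⟩⟩` (only if `w = true`), `¬ψ = ⟨3, ψ⟩`,
`ψ₁ ∨ ψ₂ = ⟨4, ⟨ψ₁, ψ₂⟩⟩`, `∃ v_n ψ = ⟨5, ⟨n, ψ⟩⟩`.

Recursive notions are expressed through a set witnessing a derivation: each element of the witness
must be obtained by one of the clauses of the recursion from elements of the witness. As the
components of a formula have smaller rank than the formula, the axiom of foundation makes this
equivalent to the definition by recursion. -/

/-- `t` is the variable `v_n`. -/
def IsVar (t n : M) : Prop := IsNat E n ∧ ∃ c, IsNum E 0 c ∧ IsOPair E t c n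

/-- `t` is the constant `c_a`. -/
def IsConst (t a : M) : Prop := ∃ c, IsNum E 1 c ∧ IsOPair E t c a

/-- `φ = ⟨k, ⟨a, b⟩⟩` -/
def IsCode (k : ℕ) (φ a b : M) : Prop :=
  ∃ c q, IsNum E k c ∧ IsOPair E q a b ∧ IsOPair E φ c q

def IsEqF (φ t s : M) : Prop := IsCode E 0 φ t s
def IsMemF (φ t s : M) : Prop := IsCode E 1 φ t s
def IsLtF (φ t s : M) : Prop := IsCode E 2 φ t s
def IsNeg (φ ψ : M) : Prop := ∃ c, IsNum E 3 c ∧ IsOPair E φ c ψ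
def IsOr (φ ψ₁ ψ₂ : M) : Prop := IsCode E 4 φ ψ₁ ψ₂
def IsEx (φ n ψ : M) : Prop := IsNat E n ∧ IsCode E 5 φ n ψ

/-- The tags of the binary relation symbols: `=`, `∈` and, if `w = true`, `<`. -/
def IsRelTag (w : Bool) (k : ℕ) : Prop := k = 0 ∨ k = 1 ∨ (k = 2 ∧ w = true)

/-- `t` is a constant, or a variable whose index is in `s`. -/
def IsTermIn (t s : M) : Prop := (∃ n, IsVar E t n ∧ E n s) ∨ ∃ a, IsConst E t a

/-- Every element of `W` is a pair `⟨φ, s⟩` that is obtained from other elements of `W` by a clause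
of the recursive definition of "`φ` is a formula with all its free variables among the `v_n`,
`n ∈ s`". -/
def FormWitness (w : Bool) (W : M) : Prop :=
  ∀ p, E p W → ∃ φ s, IsOPair E p φ s ∧
    ((∃ k t₁ t₂, IsRelTag w k ∧ IsCode E k φ t₁ t₂ ∧ IsTermIn E t₁ s ∧ IsTermIn E t₂ s) ∨
     (∃ ψ, IsNeg E φ ψ ∧ PairIn E W ψ s) ∨
     (∃ ψ₁ ψ₂, IsOr E φ ψ₁ ψ₂ ∧ PairIn E W ψ₁ s ∧ PairIn E W ψ₂ s) ∨
     (∃ n ψ r, IsEx E φ n ψ ∧ IsInsert E r s n ∧ PairIn E W ψ r))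

/-- `φ` is a sentence of the language `L⁺`, i.e. `L` with the constants `c_a`, where `L` is
`L_Set` or `L_Set(<)`, according to `w`. -/
def IsSent (w : Bool) (φ : M) : Prop :=
  ∃ W e, FormWitness E w W ∧ IsZero E e ∧ PairIn E W φ e

def IsTerm (t : M) : Prop := (∃ n, IsVar E t n) ∨ ∃ a, IsConst E t a

/-- `φ` is `∃ v_n ¬(¬ (v_n ∈ t) ∨ θ)` for some term `t` other than `v_n`. In terms of `¬, ∨, ∃`,
this is `¬ ∀ v_n ∈ t θ`, and in the case `θ = ¬ψ` it is `∃ v_n ∈ t ψ`. -/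
def IsBddEx (φ θ : M) : Prop :=
  ∃ n t v a b d e, IsVar E v n ∧ IsTerm E t ∧ ¬ IsVar E t n ∧
    IsMemF E a v t ∧ IsNeg E b a ∧ IsOr E d b θ ∧ IsNeg E e d ∧ IsEx E φ n e

/-- `φ` is a `Σ₀`-formula: it is in the least class that contains the atomic formulae and is closed
under `¬`, `∨` and bounded quantification. -/
def IsDelta0 (w : Bool) (φ : M) : Prop :=
  ∃ W, E φ W ∧ ∀ χ, E χ W →
    ((∃ k t₁ t₂, IsRelTag w k ∧ IsCode E k χ t₁ t₂ ∧ IsTerm E t₁ ∧ IsTerm E t₂) ∨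
     (∃ ψ, IsNeg E χ ψ ∧ E ψ W) ∨
     (∃ ψ₁ ψ₂, IsOr E χ ψ₁ ψ₂ ∧ E ψ₁ W ∧ E ψ₂ W) ∨
     (∃ θ, IsBddEx E χ θ ∧ E θ W))

/-- Simultaneous derivations for the Levy hierarchy of formulae: `⟨n, φ⟩ ∈ P` stands for
"`φ` is `Σ_n`", and `⟨n, φ⟩ ∈ Q` for "`φ` is `Π_n`". The clauses are:
`Σ₀`-formulae are `Σ_n` and `Π_n`;
`¬` interchanges `Σ_n` and `Π_n`; both classes are closed under `∨` (hence also under `∧`);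
`Σ_{m+1}` is closed under `∃` and contains `Π_m`; `Π_{m+1}` contains `Σ_m`.
So each formula belongs to one of the classes, and prenex formulae with at most `n` alternating
blocks of quantifiers in front of a `Σ₀`-formula have their usual place. -/
def LevyWitness (w : Bool) (P Q : M) : Prop :=
  (∀ p, E p P → ∃ n φ, IsNat E n ∧ IsOPair E p n φ ∧
    (IsDelta0 E w φ ∨
     (∃ ψ, IsNeg E φ ψ ∧ PairIn E Q n ψ) ∨
     (∃ ψ₁ ψ₂, IsOr E φ ψ₁ ψ₂ ∧ PairIn E P n ψ₁ ∧ PairIn E P n ψ₂) ∨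
     (∃ m v ψ, IsSucc E n m ∧ IsEx E φ v ψ ∧ PairIn E P n ψ) ∨
     (∃ m, IsSucc E n m ∧ PairIn E Q m φ))) ∧
  (∀ p, E p Q → ∃ n φ, IsNat E n ∧ IsOPair E p n φ ∧
    (IsDelta0 E w φ ∨
     (∃ ψ, IsNeg E φ ψ ∧ PairIn E P n ψ) ∨
     (∃ ψ₁ ψ₂, IsOr E φ ψ₁ ψ₂ ∧ PairIn E Q n ψ₁ ∧ PairIn E Q n ψ₂) ∨
     (∃ m, IsSucc E n m ∧ PairIn E P m φ)))

/-- `k ∈ ω` and `φ` is a `Σ_k`-sentence of `L⁺`, in the sense of the model. -/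
def IsSigmaSent (w : Bool) (k φ : M) : Prop :=
  IsNat E k ∧ IsSent E w φ ∧ ∃ P Q, LevyWitness E w P Q ∧ PairIn E P k φ

/-- The term `r` is `c_x` if `t` is `v_n`, and it is `t` otherwise. -/
def IsTermSubst (n x t r : M) : Prop :=
  (IsVar E t n ∧ IsConst E r x) ∨ (¬ IsVar E t n ∧ r = t)

/-- Every element of `R` is a pair `⟨φ, χ⟩` obtained from other elements of `R` by a clause of the
recursive definition of "`χ` results from `φ` by replacing the free occurrences of `v_n` by
`c_x`". -/
def SubstWitness (w : Bool) (n x R : M) : Prop :=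
  ∀ p, E p R → ∃ φ χ, IsOPair E p φ χ ∧
    ((∃ k t₁ t₂ r₁ r₂, IsRelTag w k ∧ IsCode E k φ t₁ t₂ ∧ IsCode E k χ r₁ r₂ ∧
        IsTermSubst E n x t₁ r₁ ∧ IsTermSubst E n x t₂ r₂) ∨
     (∃ φ₁ χ₁, IsNeg E φ φ₁ ∧ IsNeg E χ χ₁ ∧ PairIn E R φ₁ χ₁) ∨
     (∃ φ₁ φ₂ χ₁ χ₂, IsOr E φ φ₁ φ₂ ∧ IsOr E χ χ₁ χ₂ ∧
        PairIn E R φ₁ χ₁ ∧ PairIn E R φ₂ χ₂) ∨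
     (∃ φ₁, IsEx E φ n φ₁ ∧ χ = φ) ∨
     (∃ m φ₁ χ₁, m ≠ n ∧ IsEx E φ m φ₁ ∧ IsEx E χ m χ₁ ∧ PairIn E R φ₁ χ₁))

/-- `χ = ψ(c_x)`, the result of replacing the free occurrences of `v_n` in `ψ` by `c_x`. -/
def IsSubst (w : Bool) (ψ n x χ : M) : Prop :=
  ∃ R, SubstWitness E w n x R ∧ PairIn E R ψ χ

end Internal

/-! ### Satisfaction classes -/

/-- `S` is a `Σ_k`-satisfaction class for `A`, where `k ∈ ω` in the sense of `A`. -/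
structure IsSigmaSatClass (A : SetStr w M) (k : M) (S : M → Prop) : Prop where
  eq : ∀ x y c d φ, IsConst A.mem c x → IsConst A.mem d y → IsEqF A.mem φ c d →
    (S φ ↔ x = y)
  mem : ∀ x y c d φ, IsConst A.mem c x → IsConst A.mem d y → IsMemF A.mem φ c d →
    (S φ ↔ A.mem x y)
  lt : ∀ h : w = true, ∀ x y c d φ, IsConst A.mem c x → IsConst A.mem d y →
    IsLtF A.mem φ c d → (S φ ↔ A.lt h x y)
  neg : ∀ φ ψ, IsSigmaSent A.mem w k φ → IsNeg A.mem φ ψ → (S φ ↔ ¬ S ψ)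
  or : ∀ φ ψ₁ ψ₂, IsSigmaSent A.mem w k φ → IsOr A.mem φ ψ₁ ψ₂ → (S φ ↔ S ψ₁ ∨ S ψ₂)
  ex : ∀ φ n ψ, IsSigmaSent A.mem w k φ → IsEx A.mem φ n ψ →
    (S φ ↔ ∃ x χ, IsSubst A.mem w ψ n x χ ∧ S χ)

/-- `S` is a `Σ_ω`-satisfaction class for `A`: a `Σ_k`-satisfaction class for each metatheoretic
natural number `k`. -/
def IsSigmaOmegaSatClass (A : SetStr w M) (S : M → Prop) : Prop :=
  ∀ (k : ℕ) (x : M), IsNum A.mem k x → IsSigmaSatClass A x S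

/-- `S` is a full satisfaction class for `A`: a `Σ_k`-satisfaction class for each natural number
`k` of the model. -/
def IsFullSatClass (A : SetStr w M) (S : M → Prop) : Prop :=
  ∀ k : M, IsNat A.mem k → IsSigmaSatClass A k S

/-- The natural numbers of `A`, with the membership relation of `A`, are isomorphic to `ℕ`. -/
def IsOmegaStandard (A : SetStr w M) : Prop :=
  Nonempty ((fun m n : ℕ => m < n) ≃r (fun m n : {x : M // IsNat A.mem x} => A.mem m.1 n.1))

/-! ### The theories -/

/-- `(A, X) ⊨ ZF(L(X))`, where `L` is the language of `A`: the axioms of `ZF`, with the schemes of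
separation and collection for all formulae of `L(X)`, with parameters. -/
structure ModelsZF (A : SetStr w M) (X : M → Prop) : Prop where
  extensionality : ∀ x y, (∀ z, A.mem z x ↔ A.mem z y) → x = y
  foundation : ∀ x, (∃ y, A.mem y x) → ∃ y, A.mem y x ∧ ∀ z, A.mem z y → ¬ A.mem z x
  pairing : ∀ x y, ∃ z, A.mem x z ∧ A.mem y z
  union : ∀ x, ∃ u, ∀ y z, A.mem y x → A.mem z y → A.mem z u
  powerset : ∀ x, ∃ p, ∀ y, (∀ z, A.mem z y → A.mem z x) → A.mem y p
  infinity : ∃ x, IsInductive A.mem x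
  separation : ∀ (n : ℕ) (φ : (LSet w true).Formula (Fin (n + 1))) (a : Fin n → M) (v : M),
    ∃ u, ∀ x, A.mem x u ↔ A.mem x v ∧ A.SatX X φ (Fin.cons x a)
  collection : ∀ (n : ℕ) (φ : (LSet w true).Formula (Fin (n + 2))) (a : Fin n → M) (v : M),
    (∀ x, A.mem x v → ∃ y, A.SatX X φ (Fin.cons x (Fin.cons y a))) →
    ∃ u, ∀ x, A.mem x v → ∃ y, A.mem y u ∧ A.SatX X φ (Fin.cons x (Fin.cons y a))

/-- `S` is amenable over the model `A`. -/
def IsAmenable (A : SetStr w M) (S : M → Prop) : Prop := ModelsZF A S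

/-- The common form of the axioms of `ZFI` and `ZFI_<`: with `L` the language of `A`, the schemes
of `ZF` for `L(I)`; `I` is a cofinal subclass of the ordinals; `I` is a class of order
indiscernibles for `L`-formulae. -/
structure ModelsIndisc (A : SetStr w M) (I : M → Prop) : Prop where
  zf : ModelsZF A I
  ord : ∀ i, I i → IsOrd A.mem i
  cofinal : ∀ x, IsOrd A.mem x → ∃ i, I i ∧ (A.mem x i ∨ x = i)
  indisc : ∀ (n : ℕ) (φ : (LSet w false).Formula (Fin n)) (x y : Fin n → M),
    (∀ m, I (x m)) → (∀ m, I (y m)) →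
    (∀ l m, l < m → A.mem (x l) (x m)) → (∀ l m, l < m → A.mem (y l) (y m)) →
    (A.Sat φ x ↔ A.Sat φ y)

/-- `(A, I) ⊨ ZFI` -/
def ModelsZFI (A : SetStr false M) (I : M → Prop) : Prop := ModelsIndisc A I

/-- `A ⊨ GW`: `<` is a (strict) linear order, and each nonempty set has a `<`-least element. -/
structure ModelsGW (A : SetStr true M) : Prop where
  irrefl : ∀ x, ¬ A.lt rfl x x
  trans : ∀ x y z, A.lt rfl x y → A.lt rfl y z → A.lt rfl x z
  total : ∀ x y, A.lt rfl x y ∨ x = y ∨ A.lt rfl y x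
  least : ∀ s, (∃ x, A.mem x s) → ∃ x, A.mem x s ∧ ∀ y, A.mem y s → x = y ∨ A.lt rfl x y

/-- `(A, I) ⊨ ZFI_<` -/
structure ModelsZFILt (A : SetStr true M) (I : M → Prop) : Prop where
  indiscernibles : ModelsIndisc A I
  gw : ModelsGW A

end ZFIndisc

open ZFIndisc

/-! Satisfaction in a set is definable, so inside the model each level `U` of the cumulative
hierarchy has a truth predicate `LSat A U`. A sentence is put into the class when it is true in all
sufficiently large limit levels in which `I` is unbounded (`SatClass`). The point is that any two
such levels agree on every formula of standard Levy complexity.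

For a fixed metatheoretic `k`, the levels in `Ref A k` are defined without `I`. They are unbounded
by the reflection theorem (`exists_ref`), and a level that is exhausted by members in `Ref A k` is
in `Ref A k` itself (`ref_closed`). Given `i` in `I`, cofinality yields some `j'` in `I` beyond a
`Ref A k` level that contains `i`. The statement "some `Ref A k` level contains `i` but not `j`" is
a formula of the language without `I`, so indiscernibility carries it from `(i, j')` to every pair
`i ∈ j` of elements of `I` (`exists_ref_between`). Hence a limit level in which `I` is unbounded is
exhausted by `Ref A k` levels, for every `k` at once, although its definition mentions no `k`
(`indLim_ref`). So such levels agree on `Σ_k`-formulae (`lsat_abs`), and Tarski's clauses pass from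
`LSat` to `SatClass` (`isSigmaSatClass`); the clause for `∃` needs the substitution lemma
`lsat_subst`.

Amenability holds because the class is definable in `(A, I)`: the schemes for the new predicate
reduce to those for `I` (`isAmenable`). In an `ω`-standard model each natural number is a standard
numeral, so the class is full.

Since one formula has to serve all models, and since separation, collection and induction are
schemes, definability is tracked by instance search: `UDef` is uniform definability without
parameters, `PDef` is definability in one structure with parameters. -/

namespace ZFIndisc

set_option linter.unusedVariables false

open FirstOrder Language Relation

variable {w p : Bool}

/-! ### Definability -/

/-- The expansion of `A` by `X` if `p = true`, and `A` itself otherwise. -/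
@[reducible] def SetStr.str {M : Type u} (p : Bool) (A : SetStr w M) (X : M → Prop) :
    (LSet w p).Structure M where
  funMap := fun f => nomatch f
  RelMap := fun r => match r with
    | .mem => fun v => A.mem (v 0) (v 1)
    | .lt h => fun v => A.lt h (v 0) (v 1)
    | .pred _ => fun v => X (v 0)

/-- With the language indexed by `p`, one definability calculus covers both the formulae subject to
indiscernibility (`p = false`) and those of the `ZF` schemes (`p = true`). -/
theorem SetStr.str_false {M : Type u} (A : SetStr w M) (X : M → Prop) :
    A.str false X = A.base := by
  refine FirstOrder.Language.Structure.ext ?_ ?_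
  · funext n f; exact nomatch f
  · funext n r; cases r with
    | mem => rfl
    | lt h => rfl
    | pred h => exact absurd h (by decide)

theorem SetStr.str_true {M : Type u} (A : SetStr w M) (X : M → Prop) :
    A.str true X = A.expand X := by
  refine FirstOrder.Language.Structure.ext ?_ ?_
  · funext n f; exact nomatch f
  · funext n r; cases r <;> rfl

/-- Realization in `(A, X)`, or in `A` if `p = false`. -/
def SetStr.Holds {M : Type u} (p : Bool) (A : SetStr w M) (X : M → Prop) {β : Type*}
    (φ : (LSet w p).Formula β) (v : β → M) : Prop :=
  letI := A.str p X
  φ.Realize v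

/-- Families of relations, one for each structure. -/
abbrev Fam (w : Bool) (α : Type) :=
  ∀ (M : Type u) (_ : SetStr w M) (_ : M → Prop), (α → M) → Prop

/-- A family of relations is uniformly definable without parameters. -/
class UDef (p : Bool) {α : Type} (F : Fam.{u} w α) : Prop where
  out : ∃ φ : (LSet w p).Formula α, ∀ M A X v, A.Holds p X φ v ↔ F M A X v

/-- A relation on one structure is definable with parameters. -/
class PDef {M : Type u} (A : SetStr w M) (X : M → Prop) {α : Type} (P : (α → M) → Prop) :
    Prop where
  out : ∃ φ : (LSet w true).Formula (α ⊕ M), ∀ v, A.Holds true X φ (Sum.elim v id) ↔ P v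

/-- Projections and constants. -/
class Tm {M : Type u} {α : Type} (t : (α → M) → M) : Prop where
  out : ∃ j : α ⊕ M, ∀ v, Sum.elim v id j = t v

section

variable {M : Type u} {α : Type}

instance (i : α) : Tm (fun v : α → M => v i) := ⟨.inl i, fun _ => rfl⟩

instance (c : M) : Tm (fun _ : α → M => c) := ⟨.inr c, fun _ => rfl⟩

variable {A : SetStr w M} {X : M → Prop} {β : Type*}

theorem holds_relabel {γ : Type*} (φ : (LSet w p).Formula β) (f : β → γ) (v : γ → M) :
    A.Holds p X (φ.relabel f) v ↔ A.Holds p X φ (v ∘ f) := by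
  let _ := A.str p X
  exact Formula.realize_relabel

theorem holds_imp (φ ψ : (LSet w p).Formula β) (v : β → M) :
    A.Holds p X (φ.imp ψ) v ↔ (A.Holds p X φ v → A.Holds p X ψ v) := by
  let _ := A.str p X
  exact Formula.realize_imp

theorem holds_bot (v : β → M) : A.Holds p X (⊥ : (LSet w p).Formula β) v ↔ False := by
  let _ := A.str p X
  exact Formula.realize_bot

/-- A bound variable is represented by `none` in `Option β`, so passing under a quantifier only
changes the index type and instance search can recurse on the shape of a relation. -/
theorem holds_all (φ : (LSet w p).Formula (Option β)) (v : β → M) :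
    A.Holds p X
      ((φ.relabel (fun o : Option β => Option.elim o (Sum.inr ()) Sum.inl)).iAlls Unit) v ↔
    ∀ x, A.Holds p X φ (fun o => o.elim x v) := by
  let _ := A.str p X
  refine Formula.realize_iAlls.trans ⟨fun h x => ?_, fun h i => ?_⟩
  · have := (Formula.realize_relabel).1 (h (fun _ => x))
    refine cast (congrArg _ ?_) this
    funext o; cases o <;> rfl
  · refine Formula.realize_relabel.2 ?_
    refine cast (congrArg _ ?_) (h (i ()))
    funext o; cases o <;> rfl

theorem holds_eq (i j : β) (v : β → M) :
    A.Holds p X (Term.equal (L := LSet w p) (Term.var i) (Term.var j)) v ↔ v i = v j := by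
  let _ := A.str p X
  exact Formula.realize_equal

/-- The atomic formula `r(i, j)`. -/
def rel2 (r : SetRel w p 2) (i j : β) : (LSet w p).Formula β :=
  Relations.formula (L := LSet w p) (show (LSet w p).Relations 2 from r)
    ![Term.var i, Term.var j]

theorem holds_mem (i j : β) (v : β → M) :
    A.Holds p X (rel2 .mem i j) v ↔ A.mem (v i) (v j) := by
  let _ := A.str p X
  exact Formula.realize_rel

theorem holds_lt (h : w = true) (i j : β) (v : β → M) :
    A.Holds p X (rel2 (.lt h) i j) v ↔ A.lt h (v i) (v j) := by
  let _ := A.str p X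
  exact Formula.realize_rel

theorem holds_pred (i : β) (v : β → M) :
    A.Holds true X (Relations.formula (L := LSet w true)
      (show (LSet w true).Relations 1 from SetRel.pred rfl) ![Term.var i]) v ↔ X (v i) := by
  let _ := A.str true X
  exact Formula.realize_rel

end

/-! ### Closure of uniform definability under first-order operations -/

section UDef

variable {α : Type}

theorem UDef.congr {F G : Fam.{u} w α} [hG : UDef p G]
    (h : ∀ M A X v, F M A X v ↔ G M A X v) : UDef p F := by
  obtain ⟨φ, hφ⟩ := hG.out
  exact ⟨φ, fun M A X v => (hφ M A X v).trans (h M A X v).symm⟩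

instance UDef.false : UDef.{u} (w := w) p (fun M A X (v : α → M) => False) :=
  ⟨⊥, fun _ _ _ _ => holds_bot _⟩

instance UDef.imp {F G : Fam.{u} w α} [hF : UDef p F] [hG : UDef p G] :
    UDef p (fun M A X v => F M A X v → G M A X v) := by
  obtain ⟨φ, hφ⟩ := hF.out
  obtain ⟨ψ, hψ⟩ := hG.out
  exact ⟨φ.imp ψ, fun M A X v => (holds_imp _ _ _).trans (by rw [hφ, hψ])⟩

instance UDef.all {F : ∀ (M : Type u) (_ : SetStr w M) (_ : M → Prop), (α → M) → M → Prop}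
    [hF : UDef p (fun M A X (v : Option α → M) => F M A X (fun i => v (some i)) (v none))] :
    UDef p (fun M A X v => ∀ x, F M A X v x) := by
  obtain ⟨φ, hφ⟩ := hF.out
  exact ⟨_, fun M A X v => (holds_all φ v).trans (forall_congr' fun x => hφ M A X _)⟩

instance UDef.not {F : Fam.{u} w α} [hF : UDef p F] : UDef p (fun M A X v => ¬ F M A X v) :=
  inferInstanceAs (UDef p (fun M A X v => F M A X v → False))

instance UDef.and {F G : Fam.{u} w α} [hF : UDef p F] [hG : UDef p G] :
    UDef p (fun M A X v => F M A X v ∧ G M A X v) :=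
  UDef.congr (G := fun M A X v => ¬ (F M A X v → ¬ G M A X v)) fun _ _ _ _ => by tauto

instance UDef.or {F G : Fam.{u} w α} [hF : UDef p F] [hG : UDef p G] :
    UDef p (fun M A X v => F M A X v ∨ G M A X v) :=
  UDef.congr (G := fun M A X v => ¬ F M A X v → G M A X v) fun _ _ _ _ => by tauto

instance UDef.iff {F G : Fam.{u} w α} [hF : UDef p F] [hG : UDef p G] :
    UDef p (fun M A X v => F M A X v ↔ G M A X v) :=
  UDef.congr (G := fun M A X v => (F M A X v → G M A X v) ∧ (G M A X v → F M A X v))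
    fun _ _ _ _ => by tauto

instance UDef.ex {F : ∀ (M : Type u) (_ : SetStr w M) (_ : M → Prop), (α → M) → M → Prop}
    [hF : UDef p (fun M A X (v : Option α → M) => F M A X (fun i => v (some i)) (v none))] :
    UDef p (fun M A X v => ∃ x, F M A X v x) :=
  UDef.congr (G := fun M A X v => ¬ ∀ x, ¬ F M A X v x) fun _ _ _ _ => by push Not; rfl

instance UDef.eq {i j : α} : UDef.{u} (w := w) p (fun M A X v => v i = v j) :=
  ⟨_, fun _ _ _ v => holds_eq i j v⟩

instance UDef.mem {i j : α} : UDef.{u} (w := w) p (fun M A X v => A.mem (v i) (v j)) :=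
  ⟨_, fun _ _ _ v => holds_mem i j v⟩

instance UDef.pred {i : α} : UDef.{u} (w := w) true (fun M A X v => X (v i)) :=
  ⟨_, fun _ _ _ v => holds_pred i v⟩

/-- The existential over `w = true` makes the relation meaningful for both languages: it is
constantly false when there is no symbol `<`. -/
instance UDef.lt {i j : α} :
    UDef.{u} (w := w) p (fun M A X v => ∃ h : w = true, A.lt h (v i) (v j)) := by
  by_cases h : w = true
  · exact ⟨_, fun _ A _ v => (holds_lt h i j v).trans ⟨fun h' => ⟨h, h'⟩, fun h' => h'.2⟩⟩
  · exact UDef.congr (G := fun M A X v => False) fun _ _ _ _ =>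
      ⟨fun h' => h h'.1, False.elim⟩

instance UDef.const {c : Prop} : UDef.{u} (w := w) p (fun M A X (v : α → M) => c) := by
  by_cases h : c
  · exact UDef.congr (G := fun M A X v => ¬ False) fun _ _ _ _ => by simp [h]
  · exact UDef.congr (G := fun M A X v => False) fun _ _ _ _ => by simp [h]

end UDef

/-! ### Closure of definability with parameters -/

section PDef

variable {M : Type u} {α : Type} {A : SetStr w M} {X : M → Prop}

theorem PDef.congr {P Q : (α → M) → Prop} [hQ : PDef A X Q] (h : ∀ v, P v ↔ Q v) :
    PDef A X P := by
  obtain ⟨φ, hφ⟩ := hQ.out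
  exact ⟨φ, fun v => (hφ v).trans (h v).symm⟩

instance PDef.false : PDef A X (fun _ : α → M => False) :=
  ⟨⊥, fun _ => holds_bot _⟩

instance PDef.imp {P Q : (α → M) → Prop} [hP : PDef A X P] [hQ : PDef A X Q] :
    PDef A X (fun v => P v → Q v) := by
  obtain ⟨φ, hφ⟩ := hP.out
  obtain ⟨ψ, hψ⟩ := hQ.out
  exact ⟨φ.imp ψ, fun v => (holds_imp _ _ _).trans (by rw [hφ, hψ])⟩

instance PDef.all {P : (α → M) → M → Prop}
    [hP : PDef A X (fun v : Option α → M => P (fun i => v (some i)) (v none))] :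
    PDef A X (fun v => ∀ x, P v x) := by
  obtain ⟨φ, hφ⟩ := hP.out
  refine ⟨_, fun v => (holds_all (φ.relabel (fun s : Option α ⊕ M =>
    Sum.elim (fun o : Option α => o.map Sum.inl) (fun m => some (Sum.inr m)) s))
      (Sum.elim v id)).trans (forall_congr' fun x => ?_)⟩
  rw [holds_relabel]
  refine Iff.trans (iff_of_eq ?_) (hφ (fun o => o.elim x v))
  refine congrArg _ ?_
  funext s
  rcases s with (_ | _) | _ <;> rfl

instance PDef.not {P : (α → M) → Prop} [hP : PDef A X P] : PDef A X (fun v => ¬ P v) :=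
  inferInstanceAs (PDef A X (fun v => P v → False))

instance PDef.and {P Q : (α → M) → Prop} [hP : PDef A X P] [hQ : PDef A X Q] :
    PDef A X (fun v => P v ∧ Q v) :=
  PDef.congr (Q := fun v => ¬ (P v → ¬ Q v)) fun _ => by tauto

instance PDef.or {P Q : (α → M) → Prop} [hP : PDef A X P] [hQ : PDef A X Q] :
    PDef A X (fun v => P v ∨ Q v) :=
  PDef.congr (Q := fun v => ¬ P v → Q v) fun _ => by tauto

instance PDef.iff {P Q : (α → M) → Prop} [hP : PDef A X P] [hQ : PDef A X Q] :
    PDef A X (fun v => P v ↔ Q v) :=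
  PDef.congr (Q := fun v => (P v → Q v) ∧ (Q v → P v)) fun _ => by tauto

instance PDef.ex {P : (α → M) → M → Prop}
    [hP : PDef A X (fun v : Option α → M => P (fun i => v (some i)) (v none))] :
    PDef A X (fun v => ∃ x, P v x) :=
  PDef.congr (Q := fun v => ¬ ∀ x, ¬ P v x) fun _ => by push Not; rfl

instance PDef.eq {s t : (α → M) → M} [hs : Tm s] [ht : Tm t] :
    PDef A X (fun v => s v = t v) := by
  obtain ⟨i, hi⟩ := hs.out
  obtain ⟨j, hj⟩ := ht.out
  exact ⟨_, fun v => (holds_eq i j _).trans (by rw [hi, hj])⟩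

instance PDef.mem {s t : (α → M) → M} [hs : Tm s] [ht : Tm t] :
    PDef A X (fun v => A.mem (s v) (t v)) := by
  obtain ⟨i, hi⟩ := hs.out
  obtain ⟨j, hj⟩ := ht.out
  exact ⟨_, fun v => (holds_mem i j _).trans (by rw [hi, hj])⟩

instance PDef.pred {s : (α → M) → M} [hs : Tm s] : PDef A X (fun v => X (s v)) := by
  obtain ⟨i, hi⟩ := hs.out
  exact ⟨_, fun v => (holds_pred i _).trans (by rw [hi])⟩

instance PDef.const {c : Prop} : PDef A X (fun _ : α → M => c) := by
  by_cases h : c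
  · exact PDef.congr (Q := fun v => ¬ False) fun _ => by simp [h]
  · exact PDef.congr (Q := fun v => False) fun _ => by simp [h]

/-- Each notion is shown definable once, uniformly; specializing its arguments to variables or
parameters then gives the instances used by the schemes. -/
theorem UDef.pdef {n : ℕ} {F : Fam.{u} w (Fin n)} (hF : UDef true F) {t : Fin n → (α → M) → M}
    (ht : ∀ i, Tm (t i)) : PDef A X (fun v => F M A X (fun i => t i v)) := by
  obtain ⟨φ, hφ⟩ := hF.out
  choose f hf using fun i => (ht i).out
  refine ⟨φ.relabel f, fun v => ?_⟩
  rw [holds_relabel, hφ]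
  refine iff_of_eq (congrArg _ ?_)
  funext i
  exact hf i v

theorem UDef.pdef1 (F : ∀ (M : Type u) (_ : SetStr w M) (_ : M → Prop), M → Prop)
    [hF : UDef true (fun M A X (v : Fin 1 → M) => F M A X (v 0))]
    {s : (α → M) → M} [hs : Tm s] : PDef A X (fun v => F M A X (s v)) :=
  hF.pdef (t := ![s]) (by simp [hs])

theorem UDef.pdef2 (F : ∀ (M : Type u) (_ : SetStr w M) (_ : M → Prop), M → M → Prop)
    [hF : UDef true (fun M A X (v : Fin 2 → M) => F M A X (v 0) (v 1))]
    {s t : (α → M) → M} [hs : Tm s] [ht : Tm t] : PDef A X (fun v => F M A X (s v) (t v)) :=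
  hF.pdef (t := ![s, t]) (by simp [Fin.forall_fin_two, hs, ht])

theorem UDef.pdef3 (F : ∀ (M : Type u) (_ : SetStr w M) (_ : M → Prop), M → M → M → Prop)
    [hF : UDef true (fun M A X (v : Fin 3 → M) => F M A X (v 0) (v 1) (v 2))]
    {s t r : (α → M) → M} [hs : Tm s] [ht : Tm t] [hr : Tm r] :
    PDef A X (fun v => F M A X (s v) (t v) (r v)) :=
  hF.pdef (t := ![s, t, r]) (by simp [Fin.forall_fin_succ, hs, ht, hr])

theorem UDef.pdef4 (F : ∀ (M : Type u) (_ : SetStr w M) (_ : M → Prop), M → M → M → M → Prop)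
    [hF : UDef true (fun M A X (v : Fin 4 → M) => F M A X (v 0) (v 1) (v 2) (v 3))]
    {s t r q : (α → M) → M} [hs : Tm s] [ht : Tm t] [hr : Tm r] [hq : Tm q] :
    PDef A X (fun v => F M A X (s v) (t v) (r v) (q v)) :=
  hF.pdef (t := ![s, t, r, q]) (by simp [Fin.forall_fin_succ, hs, ht, hr, hq])

end PDef

/-! ### Definability of the notions of the statement -/

section

variable {α : Type} {i j k l : α}

instance : UDef.{u} (w := w) p (fun M A X v =>
    IsZero A.mem (v i)) := by
  unfold IsZero; infer_instance

instance : UDef.{u} (w := w) p (fun M A X v =>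
    IsSucc A.mem (v i) (v j)) := by
  unfold IsSucc; infer_instance

instance : UDef.{u} (w := w) p (fun M A X v =>
    IsInductive A.mem (v i)) := by
  unfold IsInductive; infer_instance

instance : UDef.{u} (w := w) p (fun M A X v =>
    IsNat A.mem (v i)) := by
  unfold IsNat; infer_instance

instance : UDef.{u} (w := w) p (fun M A X v =>
    IsOrd A.mem (v i)) := by
  unfold IsOrd; infer_instance

instance : UDef.{u} (w := w) p (fun M A X v =>
    IsUPair A.mem (v i) (v j) (v k)) := by
  unfold IsUPair; infer_instance

instance : UDef.{u} (w := w) p (fun M A X v =>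
    IsOPair A.mem (v i) (v j) (v k)) := by
  unfold IsOPair; infer_instance

instance : UDef.{u} (w := w) p (fun M A X v =>
    PairIn A.mem (v i) (v j) (v k)) := by
  unfold PairIn; infer_instance

theorem UDef.isNum (n : ℕ) : ∀ {α : Type} (i : α),
    UDef.{u} (w := w) p (fun M A X v => IsNum A.mem n (v i)) := by
  induction n with
  | zero => intro α i; unfold IsNum; infer_instance
  | succ n ih => intro α i; unfold IsNum; infer_instance

instance {n : ℕ} : UDef.{u} (w := w) p (fun M A X v => IsNum A.mem n (v i)) :=
  UDef.isNum n i

instance : UDef.{u} (w := w) p (fun M A X v =>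
    IsVar A.mem (v i) (v j)) := by
  unfold IsVar; infer_instance

instance : UDef.{u} (w := w) p (fun M A X v =>
    IsConst A.mem (v i) (v j)) := by
  unfold IsConst; infer_instance

instance {n : ℕ} : UDef.{u} (w := w) p (fun M A X v =>
    IsCode A.mem n (v i) (v j) (v k)) := by
  unfold IsCode; infer_instance

instance : UDef.{u} (w := w) p (fun M A X v =>
    IsEqF A.mem (v i) (v j) (v k)) := by
  unfold IsEqF; infer_instance

instance : UDef.{u} (w := w) p (fun M A X v =>
    IsMemF A.mem (v i) (v j) (v k)) := by
  unfold IsMemF; infer_instance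

instance : UDef.{u} (w := w) p (fun M A X v =>
    IsLtF A.mem (v i) (v j) (v k)) := by
  unfold IsLtF; infer_instance

instance : UDef.{u} (w := w) p (fun M A X v =>
    IsNeg A.mem (v i) (v j)) := by
  unfold IsNeg; infer_instance

instance : UDef.{u} (w := w) p (fun M A X v =>
    IsOr A.mem (v i) (v j) (v k)) := by
  unfold IsOr; infer_instance

instance : UDef.{u} (w := w) p (fun M A X v =>
    IsEx A.mem (v i) (v j) (v k)) := by
  unfold IsEx; infer_instance

instance : UDef.{u} (w := w) p (fun M A X v =>
    IsTerm A.mem (v i)) := by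
  unfold IsTerm; infer_instance

instance : UDef.{u} (w := w) p (fun M A X v =>
    IsBddEx A.mem (v i) (v j)) := by
  unfold IsBddEx; infer_instance

theorem exists_isRelTag {Q : ℕ → Prop} :
    (∃ k, IsRelTag w k ∧ Q k) ↔ Q 0 ∨ Q 1 ∨ (w = true ∧ Q 2) := by
  constructor
  · rintro ⟨k, rfl | rfl | ⟨rfl, h⟩, hk⟩
    exacts [.inl hk, .inr (.inl hk), .inr (.inr ⟨h, hk⟩)]
  · rintro (h | h | ⟨hw, h⟩)
    exacts [⟨0, .inl rfl, h⟩, ⟨1, .inr (.inl rfl), h⟩, ⟨2, .inr (.inr ⟨rfl, hw⟩), h⟩]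

instance : UDef.{u} (w := w) p (fun M A X v =>
    IsTermSubst A.mem (v i) (v j) (v k) (v l)) := by
  unfold IsTermSubst; infer_instance

end

section

variable {M : Type u} {A : SetStr w M} {X : M → Prop} {α : Type} {s t r q : (α → M) → M}

instance [Tm s] :
    PDef A X (fun v => IsZero A.mem (s v)) :=
  UDef.pdef1 (fun _ A _ => IsZero A.mem )

instance [Tm s] [Tm t] :
    PDef A X (fun v => IsSucc A.mem (s v) (t v)) :=
  UDef.pdef2 (fun _ A _ => IsSucc A.mem )

instance [Tm s] :
    PDef A X (fun v => IsNat A.mem (s v)) :=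
  UDef.pdef1 (fun _ A _ => IsNat A.mem )

instance [Tm s] :
    PDef A X (fun v => IsOrd A.mem (s v)) :=
  UDef.pdef1 (fun _ A _ => IsOrd A.mem )

instance [Tm s] [Tm t] [Tm r] :
    PDef A X (fun v => IsOPair A.mem (s v) (t v) (r v)) :=
  UDef.pdef3 (fun _ A _ => IsOPair A.mem )

instance [Tm s] [Tm t] [Tm r] :
    PDef A X (fun v => PairIn A.mem (s v) (t v) (r v)) :=
  UDef.pdef3 (fun _ A _ => PairIn A.mem )

instance [Tm s] [Tm t] : PDef A X (fun v => ∃ h : w = true, A.lt h (s v) (t v)) :=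
  UDef.pdef2 (fun _ A _ a b => ∃ h : w = true, A.lt h a b)

end

/-! ### Basic set theory in a model -/

section

variable {M : Type u} {A : SetStr w M} {X : M → Prop}

/-- A formula has finitely many free variables, so only finitely many elements of `M` occur as
parameters. This is the form in which the schemes of `ModelsZF` take them. -/
theorem PDef.exists_params {k : ℕ} {P : (Fin k → M) → Prop} (h : PDef A X P) (x₀ : M) :
    ∃ n, ∃ φ : (LSet w true).Formula (Fin k ⊕ Fin n), ∃ a : Fin n → M,
      ∀ v, A.Holds true X φ (Sum.elim v a) ↔ P v := by
  classical
  obtain ⟨φ, hφ⟩ := h.out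
  let e := φ.freeVarFinset.equivFin
  -- All free variables receive a parameter slot, including those on the `Fin k` side; the latter
  -- slots are never read, and `x₀` fills them.
  refine ⟨_, φ.restrictFreeVar (fun s => Sum.elim (fun i => Sum.inl i) (fun _ => Sum.inr (e s)) s.1),
    fun i => Sum.elim (fun _ => x₀) id (e.symm i).1, fun v => ?_⟩
  rw [← hφ]
  let _ := A.str true X
  refine BoundedFormula.realize_restrictFreeVar _ ?_
  rintro ⟨i | m, hs⟩
  · rfl
  · simp

theorem PDef.comp {k : ℕ} {P : (Fin k → M) → Prop} (h : PDef A X P) {α : Type}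
    {t : Fin k → (α → M) → M} (ht : ∀ i, Tm (t i)) :
    PDef A X (fun v => P (fun i => t i v)) := by
  obtain ⟨φ, hφ⟩ := h.out
  choose f hf using fun i => (ht i).out
  refine ⟨φ.relabel (Sum.elim f Sum.inr), fun v => ?_⟩
  rw [holds_relabel, ← hφ]
  refine iff_of_eq (congrArg _ ?_)
  funext i
  rcases i with i | m
  · exact hf i v
  · rfl

theorem PDef.comp2 {R : M → M → Prop} (h : PDef A X (fun v : Fin 2 → M => R (v 0) (v 1)))
    {α : Type} {s t : (α → M) → M} [hs : Tm s] [ht : Tm t] :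
    PDef A X (fun v => R (s v) (t v)) :=
  h.comp (t := ![s, t]) (by simp [Fin.forall_fin_two, hs, ht])

theorem PDef.comp3 {R : M → M → M → Prop}
    (h : PDef A X (fun v : Fin 3 → M => R (v 0) (v 1) (v 2)))
    {α : Type} {s t r : (α → M) → M} [hs : Tm s] [ht : Tm t] [hr : Tm r] :
    PDef A X (fun v => R (s v) (t v) (r v)) :=
  h.comp (t := ![s, t, r]) (by simp [Fin.forall_fin_succ, hs, ht, hr])

namespace ModelsZF

variable (hZ : ModelsZF A X)
include hZ

theorem sep (P : M → Prop) [h : PDef A X (fun v : Fin 1 → M => P (v 0))] (a : M) :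
    ∃ u, ∀ x, A.mem x u ↔ A.mem x a ∧ P x := by
  obtain ⟨n, φ, b, hφ⟩ := h.exists_params a
  obtain ⟨u, hu⟩ := hZ.separation n
    (φ.relabel (Sum.elim (fun _ => 0) Fin.succ : Fin 1 ⊕ Fin n → Fin (n + 1))) b a
  refine ⟨u, fun x => (hu x).trans (and_congr_right fun _ => ?_)⟩
  rw [SetStr.SatX, ← A.str_true X]
  refine (holds_relabel _ _ _).trans (Iff.trans (iff_of_eq (congrArg _ ?_)) (hφ (fun _ => x)))
  funext s
  rcases s with i | i
  · rfl
  · simp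

theorem coll (R : M → M → Prop) [h : PDef A X (fun v : Fin 2 → M => R (v 0) (v 1))] (a : M)
    (H : ∀ x, A.mem x a → ∃ y, R x y) : ∃ u, ∀ x, A.mem x a → ∃ y, A.mem y u ∧ R x y := by
  obtain ⟨n, φ, b, hφ⟩ := h.exists_params a
  have key : ∀ x y, A.SatX X (φ.relabel (Sum.elim ![0, 1] (fun i => i.succ.succ) :
      Fin 2 ⊕ Fin n → Fin (n + 2))) (Fin.cons x (Fin.cons y b)) ↔ R x y := by
    intro x y
    rw [SetStr.SatX, ← A.str_true X]
    refine (holds_relabel _ _ _).trans (Iff.trans (iff_of_eq (congrArg _ ?_)) (hφ ![x, y]))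
    funext s
    rcases s with i | i
    · fin_cases i <;> rfl
    · simp
  obtain ⟨u, hu⟩ := hZ.collection n _ b a fun x hx => (H x hx).imp fun y hy => (key x y).2 hy
  exact ⟨u, fun x hx => (hu x hx).imp fun y hy => ⟨hy.1, (key x y).1 hy.2⟩⟩

theorem ext {x y : M} (h : ∀ z, A.mem z x ↔ A.mem z y) : x = y := hZ.extensionality x y h

theorem exists_zero : ∃ e, IsZero A.mem e := by
  obtain ⟨x, ⟨z, hz, -⟩, -⟩ := hZ.infinity
  exact ⟨z, hz⟩

theorem repl (R : M → M → Prop) [h : PDef A X (fun v : Fin 2 → M => R (v 0) (v 1))] (a : M)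
    (H : ∀ x, A.mem x a → ∃ y, R x y) (H' : ∀ x y y', A.mem x a → R x y → R x y' → y = y') :
    ∃ u, ∀ y, A.mem y u ↔ ∃ x, A.mem x a ∧ R x y := by
  have : ∀ {α : Type} {s t : (α → M) → M} [Tm s] [Tm t], PDef A X (fun v => R (s v) (t v)) :=
    h.comp2
  obtain ⟨u, hu⟩ := hZ.coll R a H
  obtain ⟨u', hu'⟩ := hZ.sep (fun y => ∃ x, A.mem x a ∧ R x y) u
  refine ⟨u', fun y => (hu' y).trans ⟨fun h => h.2, fun ⟨x, hx, hxy⟩ => ⟨?_, x, hx, hxy⟩⟩⟩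
  obtain ⟨y', hy', hxy'⟩ := hu x hx
  exact H' x y y' hx hxy hxy' ▸ hy'

theorem exists_upair (a b : M) : ∃ z, IsUPair A.mem z a b := by
  obtain ⟨z, ha, hb⟩ := hZ.pairing a b
  obtain ⟨u, hu⟩ := hZ.sep (fun x => x = a ∨ x = b) z
  exact ⟨u, fun x => (hu x).trans ⟨fun h => h.2, by rintro (rfl | rfl) <;> simp [ha, hb]⟩⟩

theorem upair_unique {z z' a b : M} (h : IsUPair A.mem z a b) (h' : IsUPair A.mem z' a b) :
    z = z' := hZ.ext fun x => (h x).trans (h' x).symm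

theorem exists_opair (a b : M) : ∃ z, IsOPair A.mem z a b := by
  obtain ⟨c, hc⟩ := hZ.exists_upair a a
  obtain ⟨d, hd⟩ := hZ.exists_upair a b
  obtain ⟨z, hz⟩ := hZ.exists_upair c d
  refine ⟨z, fun x => (hz x).trans (or_congr ⟨?_, fun h => hZ.upair_unique h hc⟩
    ⟨?_, fun h => hZ.upair_unique h hd⟩)⟩
  · rintro rfl; exact hc
  · rintro rfl; exact hd

theorem opair_unique {z z' a b : M} (h : IsOPair A.mem z a b) (h' : IsOPair A.mem z' a b) :
    z = z' := hZ.ext fun x => (h x).trans (h' x).symm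

omit hZ in
theorem upair_inj {z a b c d : M} (h : IsUPair A.mem z a b) (h' : IsUPair A.mem z c d) :
    (a = c ∧ b = d) ∨ (a = d ∧ b = c) := by
  have h1 := (h' a).1 ((h a).2 (.inl rfl))
  have h2 := (h' b).1 ((h b).2 (.inr rfl))
  have h3 := (h c).1 ((h' c).2 (.inl rfl))
  have h4 := (h d).1 ((h' d).2 (.inr rfl))
  grind

theorem opair_inj {z a b c d : M} (h : IsOPair A.mem z a b) (h' : IsOPair A.mem z c d) :
    a = c ∧ b = d := by
  obtain ⟨x, hx⟩ := hZ.exists_upair a a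
  obtain ⟨y, hy⟩ := hZ.exists_upair a b
  obtain ⟨x', hx'⟩ := hZ.exists_upair c c
  obtain ⟨y', hy'⟩ := hZ.exists_upair c d
  have h1 := (h' x).1 ((h x).2 (.inl hx))
  have h2 := (h' y).1 ((h y).2 (.inr hy))
  have h3 := (h x').1 ((h' x').2 (.inl hx'))
  have h4 := (h y').1 ((h' y').2 (.inr hy'))
  have e1 : a = c := by
    rcases h1 with h1 | h1
    · rcases upair_inj hx h1 with h | h <;> exact h.1
    · rcases upair_inj hx h1 with h | h
      exacts [h.1, h.2]
  subst e1
  refine ⟨rfl, ?_⟩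
  rcases h2 with h2 | h2
  · have : b = a := by rcases upair_inj hy h2 with h | h <;> exact h.2
    subst this
    rcases h4 with h4 | h4
    · rcases upair_inj hy' h4 with h | h <;> exact h.2.symm
    · rcases upair_inj hy' h4 with h | h <;> exact h.2.symm
  · rcases upair_inj hy h2 with h | h
    exacts [h.2, h.2.trans h.1]

theorem pairIn_iff {W q a b : M} (h : IsOPair A.mem q a b) : PairIn A.mem W a b ↔ A.mem q W :=
  ⟨fun ⟨q', h', hq'⟩ => hZ.opair_unique h' h ▸ hq', fun hq => ⟨q, h, hq⟩⟩

theorem exists_sUnion (x : M) : ∃ u, ∀ z, A.mem z u ↔ ∃ y, A.mem y x ∧ A.mem z y := by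
  obtain ⟨u, hu⟩ := hZ.union x
  obtain ⟨u', hu'⟩ := hZ.sep (fun z => ∃ y, A.mem y x ∧ A.mem z y) u
  exact ⟨u', fun z => (hu' z).trans ⟨fun h => h.2, fun h => ⟨hu _ z h.choose_spec.1
    h.choose_spec.2, h⟩⟩⟩

theorem exists_union (x y : M) : ∃ u, ∀ z, A.mem z u ↔ A.mem z x ∨ A.mem z y := by
  obtain ⟨p, hp⟩ := hZ.exists_upair x y
  obtain ⟨u, hu⟩ := hZ.exists_sUnion p
  refine ⟨u, fun z => (hu z).trans ⟨?_, ?_⟩⟩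
  · rintro ⟨a, ha, hz⟩
    rcases (hp a).1 ha with rfl | rfl
    exacts [.inl hz, .inr hz]
  · rintro (h | h)
    exacts [⟨x, (hp x).2 (.inl rfl), h⟩, ⟨y, (hp y).2 (.inr rfl), h⟩]

theorem exists_insert (x a : M) : ∃ u, IsInsert A.mem u x a := by
  obtain ⟨p, hp⟩ := hZ.exists_upair a a
  obtain ⟨u, hu⟩ := hZ.exists_union x p
  exact ⟨u, fun z => (hu z).trans (or_congr_right ((hp z).trans (or_self_iff)))⟩

theorem exists_power (x : M) : ∃ u, ∀ y, A.mem y u ↔ ∀ z, A.mem z y → A.mem z x := by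
  obtain ⟨u, hu⟩ := hZ.powerset x
  obtain ⟨u', hu'⟩ := hZ.sep (fun y => ∀ z, A.mem z y → A.mem z x) u
  exact ⟨u', fun y => (hu' y).trans ⟨fun h => h.2, fun h => ⟨hu y h, h⟩⟩⟩

theorem mem_irrefl (x : M) : ¬ A.mem x x := by
  intro hx
  obtain ⟨p, hp⟩ := hZ.exists_upair x x
  obtain ⟨y, hy, h⟩ := hZ.foundation p ⟨x, (hp x).2 (.inl rfl)⟩
  obtain rfl : y = x := by simpa using (hp y).1 hy
  exact h y hx ((hp y).2 (.inl rfl))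

theorem mem_asymm {x y : M} (hxy : A.mem x y) : ¬ A.mem y x := by
  intro hyx
  obtain ⟨p, hp⟩ := hZ.exists_upair x y
  obtain ⟨z, hz, h⟩ := hZ.foundation p ⟨x, (hp x).2 (.inl rfl)⟩
  rcases (hp z).1 hz with rfl | rfl
  · exact h y hyx ((hp y).2 (.inr rfl))
  · exact h x hxy ((hp x).2 (.inl rfl))

/-! #### Natural numbers -/

theorem exists_succ (x : M) : ∃ y, IsSucc A.mem y x := hZ.exists_insert x x

theorem succ_unique {x y y' : M} (h : IsSucc A.mem y x) (h' : IsSucc A.mem y' x) : y = y' :=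
  hZ.ext fun z => (h z).trans (h' z).symm

theorem zero_unique {x y : M} (h : IsZero A.mem x) (h' : IsZero A.mem y) : x = y :=
  hZ.ext fun z => ⟨fun hz => (h z hz).elim, fun hz => (h' z hz).elim⟩

theorem succ_inj {x x' y : M} (h : IsSucc A.mem y x) (h' : IsSucc A.mem y x') : x = x' := by
  by_contra hne
  have h1 : A.mem x x' := ((h' x).1 ((h x).2 (.inr rfl))).resolve_right hne
  have h2 : A.mem x' x := ((h x').1 ((h' x').2 (.inr rfl))).resolve_right (Ne.symm hne)
  exact hZ.mem_asymm h1 h2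

omit hZ in
theorem succ_ne_zero {x y : M} (h : IsSucc A.mem y x) : ¬ IsZero A.mem y :=
  fun h0 => h0 x ((h x).2 (.inr rfl))

omit hZ in
theorem isNat_zero {x : M} (h : IsZero A.mem x) (hZ : ModelsZF A X) : IsNat A.mem x :=
  fun y ⟨⟨z, hz, hzy⟩, _⟩ => hZ.zero_unique hz h ▸ hzy

theorem isNat_succ {x y : M} (hx : IsNat A.mem x) (h : IsSucc A.mem y x) : IsNat A.mem y :=
  fun t ht => by
    obtain ⟨z, hz, hzt⟩ := ht.2 x (hx t ht)
    exact hZ.succ_unique hz h ▸ hzt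

theorem exists_omega : ∃ o, ∀ n, A.mem n o ↔ IsNat A.mem n := by
  obtain ⟨x, hx⟩ := hZ.infinity
  obtain ⟨o, ho⟩ := hZ.sep (fun n => IsNat A.mem n) x
  exact ⟨o, fun n => (ho n).trans ⟨fun h => h.2, fun h => ⟨h x hx, h⟩⟩⟩

theorem nat_induction (P : M → Prop) [h : PDef A X (fun v : Fin 1 → M => P (v 0))]
    (h0 : ∀ x, IsZero A.mem x → P x)
    (hs : ∀ x y, IsNat A.mem x → P x → IsSucc A.mem y x → P y) {n : M} (hn : IsNat A.mem n) :
    P n := by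
  obtain ⟨o, ho⟩ := hZ.exists_omega
  obtain ⟨u, hu⟩ := hZ.sep P o
  have : IsInductive A.mem u := by
    constructor
    · obtain ⟨e, he⟩ := hZ.exists_zero
      exact ⟨e, he, (hu e).2 ⟨(ho e).2 (isNat_zero he hZ), h0 e he⟩⟩
    · intro y hy
      obtain ⟨z, hz⟩ := hZ.exists_succ y
      obtain ⟨hyo, hyP⟩ := (hu y).1 hy
      have hyn := (ho y).1 hyo
      exact ⟨z, hz, (hu z).2 ⟨(ho z).2 (hZ.isNat_succ hyn hz), hs y z hyn hyP hz⟩⟩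
  exact ((hu n).1 (hn u this)).2

theorem isNum_unique {k : ℕ} : ∀ {x y : M}, IsNum A.mem k x → IsNum A.mem k y → x = y := by
  induction k with
  | zero => exact fun h h' => hZ.zero_unique h h'
  | succ k ih =>
    rintro x y ⟨x', hx', hx⟩ ⟨y', hy', hy⟩
    obtain rfl := ih hx' hy'
    exact hZ.succ_unique hx hy

theorem exists_isNum (k : ℕ) : ∃ x, IsNum A.mem k x := by
  induction k with
  | zero => exact hZ.exists_zero
  | succ k ih =>
    obtain ⟨x, hx⟩ := ih
    obtain ⟨y, hy⟩ := hZ.exists_succ x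
    exact ⟨y, x, hx, hy⟩

/-- This separates the tags of the coding, hence the syntactic kinds of formulae. -/
theorem isNum_inj {k : ℕ} : ∀ {l : ℕ} {x : M}, IsNum A.mem k x → IsNum A.mem l x → k = l := by
  induction k with
  | zero =>
    rintro (_ | l) x h h'
    · rfl
    · obtain ⟨y, -, hy⟩ := h'
      exact (succ_ne_zero hy h).elim
  | succ k ih =>
    rintro (_ | l) x ⟨y, hy, hxy⟩ h'
    · exact (succ_ne_zero hxy h').elim
    · obtain ⟨y', hy', hxy'⟩ := h'
      obtain rfl := hZ.succ_inj hxy hxy'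
      rw [ih hy hy']

theorem mem_isNat {n m : M} (hn : IsNat A.mem n) (hm : A.mem m n) : IsNat A.mem m := by
  refine hZ.nat_induction (fun n => ∀ m, A.mem m n → IsNat A.mem m) ?_ ?_ hn m hm
  · exact fun x hx m hm => (hx m hm).elim
  · intro x y hx ih hy m hm
    rcases (hy m).1 hm with h | rfl
    exacts [ih m h, hx]

/-! #### Iteration along the natural numbers -/

omit hZ in
/-- `⟨n, u⟩ ∈ W`, where `W` derives its elements by `⟨0, u₀⟩` and
`⟨m, v⟩ ↦ ⟨m + 1, G v⟩`. -/
def IterWitness (E : M → M → Prop) (G : M → M → Prop) (u₀ W : M) : Prop :=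
  ∀ q, E q W → ∃ m v, IsOPair E q m v ∧
    ((IsZero E m ∧ v = u₀) ∨ ∃ m' v', IsSucc E m m' ∧ PairIn E W m' v' ∧ G v' v)

/-- Recursion along the `ω` of the model, by set-sized derivations: induction in the model gives
existence and uniqueness of the `n`-th iterate, also for nonstandard `n`, and replacement collects
the iterates in a set closed under `G`. -/
theorem exists_iterate (G : M → M → Prop) [h : PDef A X (fun v : Fin 2 → M => G (v 0) (v 1))]
    (htot : ∀ u, ∃ v, G u v) (hfun : ∀ u v v', G u v → G u v' → v = v') (u₀ : M) :
    ∃ B, A.mem u₀ B ∧ ∀ u, A.mem u B → ∃ v, A.mem v B ∧ G u v := by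
  have : ∀ {α : Type} {s t : (α → M) → M} [Tm s] [Tm t], PDef A X (fun v => G (s v) (t v)) :=
    h.comp2
  let N : M → M → Prop := fun n u => ∃ W, IterWitness A.mem G u₀ W ∧ PairIn A.mem W n u
  have hN : ∀ {α : Type} {s t : (α → M) → M} [Tm s] [Tm t], PDef A X (fun v => N (s v) (t v)) := by
    have : PDef A X (fun v : Fin 2 → M => N (v 0) (v 1)) := by
      unfold N IterWitness; infer_instance
    exact fun {α s t} hs ht => PDef.comp2 (R := N) this
  have hstep : ∀ n m u v, N n u → IsSucc A.mem m n → G u v → N m v := by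
    rintro n m u v ⟨W, hW, hnu⟩ hm huv
    obtain ⟨q, hq⟩ := hZ.exists_opair m v
    obtain ⟨W', hW'⟩ := hZ.exists_insert W q
    have mono : ∀ a b, PairIn A.mem W a b → PairIn A.mem W' a b :=
      fun a b ⟨r, hr, hrW⟩ => ⟨r, hr, (hW' r).2 (.inl hrW)⟩
    refine ⟨W', fun r hr => ?_, q, hq, (hW' q).2 (.inr rfl)⟩
    rcases (hW' r).1 hr with hr | rfl
    · obtain ⟨a, b, hab, h | ⟨a', b', h1, h2, h3⟩⟩ := hW r hr
      exacts [⟨a, b, hab, .inl h⟩, ⟨a, b, hab, .inr ⟨a', b', h1, mono _ _ h2, h3⟩⟩]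
    · exact ⟨m, v, hq, .inr ⟨n, u, hm, mono _ _ hnu, huv⟩⟩
  have hzero : ∀ n, IsZero A.mem n → N n u₀ := by
    intro n hn
    obtain ⟨q, hq⟩ := hZ.exists_opair n u₀
    obtain ⟨W, hW⟩ := hZ.exists_upair q q
    refine ⟨W, fun r hr => ?_, q, hq, (hW q).2 (.inl rfl)⟩
    obtain rfl : r = q := by simpa using (hW r).1 hr
    exact ⟨n, u₀, hq, .inl ⟨hn, rfl⟩⟩
  have hinv : ∀ n u, N n u → (IsZero A.mem n ∧ u = u₀) ∨
      ∃ n' u', IsSucc A.mem n n' ∧ N n' u' ∧ G u' u := by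
    rintro n u ⟨W, hW, q, hq, hqW⟩
    obtain ⟨a, b, hab, h⟩ := hW q hqW
    obtain ⟨rfl, rfl⟩ := hZ.opair_inj hq hab
    rcases h with h | ⟨a', b', h1, h2, h3⟩
    exacts [.inl h, .inr ⟨a', b', h1, ⟨W, hW, h2⟩, h3⟩]
  have huniq : ∀ n, IsNat A.mem n → ∀ u u', N n u → N n u' → u = u' := by
    intro n hn
    refine hZ.nat_induction (fun n => ∀ u u', N n u → N n u' → u = u') ?_ ?_ hn
    · intro x hx u u' hu hu'
      rcases hinv _ _ hu with ⟨-, rfl⟩ | ⟨_, _, h, -, -⟩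
      · rcases hinv _ _ hu' with ⟨-, rfl⟩ | ⟨_, _, h, -, -⟩
        exacts [rfl, (succ_ne_zero h hx).elim]
      · exact (succ_ne_zero h hx).elim
    · intro x y hx ih hy u u' hu hu'
      rcases hinv _ _ hu with ⟨h, -⟩ | ⟨a, b, h1, h2, h3⟩
      · exact (succ_ne_zero hy h).elim
      rcases hinv _ _ hu' with ⟨h, -⟩ | ⟨a', b', h1', h2', h3'⟩
      · exact (succ_ne_zero hy h).elim
      obtain rfl := hZ.succ_inj hy h1
      obtain rfl := hZ.succ_inj hy h1'
      obtain rfl := ih _ _ h2 h2'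
      exact hfun _ _ _ h3 h3'
  have hex : ∀ n, IsNat A.mem n → ∃ u, N n u := by
    intro n hn
    refine hZ.nat_induction (fun n => ∃ u, N n u) ?_ ?_ hn
    · exact fun x hx => ⟨u₀, hzero x hx⟩
    · rintro x y hx ⟨u, hu⟩ hy
      obtain ⟨v, hv⟩ := htot u
      exact ⟨v, hstep _ _ _ _ hu hy hv⟩
  obtain ⟨o, ho⟩ := hZ.exists_omega
  obtain ⟨B, hB⟩ := hZ.repl N o (fun n hn => hex n ((ho n).1 hn))
    (fun n u u' hn => huniq n ((ho n).1 hn) u u')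
  refine ⟨B, ?_, fun u hu => ?_⟩
  · obtain ⟨e, he⟩ := hZ.exists_zero
    exact (hB u₀).2 ⟨e, (ho e).2 (isNat_zero he hZ), hzero e he⟩
  · obtain ⟨n, hn, hnu⟩ := (hB u).1 hu
    obtain ⟨v, hv⟩ := htot u
    obtain ⟨m, hm⟩ := hZ.exists_succ n
    exact ⟨v, (hB v).2 ⟨m, (ho m).2 (hZ.isNat_succ ((ho n).1 hn) hm), hstep _ _ _ _ hnu hm hv⟩, hv⟩

/-- The iterates of the union operation starting from `{x}` have a transitive union. -/
theorem exists_transitive (x : M) :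
    ∃ t, A.mem x t ∧ ∀ y, A.mem y t → ∀ z, A.mem z y → A.mem z t := by
  obtain ⟨x', hx'⟩ := hZ.exists_upair x x
  obtain ⟨B, hB, hB'⟩ := hZ.exists_iterate
    (fun u v => ∀ z, A.mem z v ↔ ∃ y, A.mem y u ∧ A.mem z y) hZ.exists_sUnion
    (fun u v v' h h' => hZ.ext fun z => (h z).trans (h' z).symm) x'
  obtain ⟨t, ht⟩ := hZ.exists_sUnion B
  refine ⟨t, (ht x).2 ⟨x', hB, (hx' x).2 (.inl rfl)⟩, fun y hy z hz => ?_⟩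
  obtain ⟨u, hu, hyu⟩ := (ht y).1 hy
  obtain ⟨v, hv, huv⟩ := hB' u hu
  exact (ht z).2 ⟨v, hv, (huv z).2 ⟨y, hyu, hz⟩⟩

/-- Foundation speaks only of sets, so it is applied to the counterexamples inside a transitive set
around a given one; a minimal element there is minimal outright. -/
theorem mem_induction (P : M → Prop) [h : PDef A X (fun v : Fin 1 → M => P (v 0))]
    (hP : ∀ x, (∀ y, A.mem y x → P y) → P x) (x : M) : P x := by
  have : ∀ {α : Type} {s : (α → M) → M} [Tm s], PDef A X (fun v => P (s v)) :=
    fun {α s} hs => h.comp (t := ![s]) (by simp [hs])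
  by_contra hx
  obtain ⟨t, hxt, ht⟩ := hZ.exists_transitive x
  obtain ⟨u, hu⟩ := hZ.sep (fun z => ¬ P z) t
  obtain ⟨m, hm, hmin⟩ := hZ.foundation u ⟨x, (hu x).2 ⟨hxt, hx⟩⟩
  obtain ⟨hmt, hmP⟩ := (hu m).1 hm
  refine hmP (hP m fun y hy => ?_)
  by_contra hyP
  exact hmin y hy ((hu y).2 ⟨ht m hmt y hy, hyP⟩)

theorem exists_minimal (P : M → Prop) [h : PDef A X (fun v : Fin 1 → M => P (v 0))]
    (hP : ∃ x, P x) : ∃ x, P x ∧ ∀ y, A.mem y x → ¬ P y := by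
  by_contra! H
  obtain ⟨x, hx⟩ := hP
  exact hZ.mem_induction (fun x => ¬ P x)
    (fun x ih hx => (H x hx).elim fun y hy => ih y hy.1 hy.2) x hx

end ModelsZF

end

/-! ### Recursion along membership -/

section

variable {M : Type u}

/-- `x ⊆ y` -/
def Sub (E : M → M → Prop) (x y : M) : Prop := ∀ z, E z x → E z y

/-- Every element of `W` is a pair `⟨x, v⟩` such that `W` has a value at each element of `x` and
`v = {z | Θ x u z}`, where `u` is the union of the values of `W` at the elements of `x`. -/
def RecWitness (E : M → M → Prop) (Θ : M → M → M → Prop) (W : M) : Prop :=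
  ∀ q, E q W → ∃ x v u, IsOPair E q x v ∧ (∀ y, E y x → ∃ b, PairIn E W y b) ∧
    (∀ a, E a u ↔ ∃ y b, E y x ∧ PairIn E W y b ∧ E a b) ∧ ∀ z, E z v ↔ Θ x u z

/-- `v = F x`, where `F` is defined by the recursion `F x = {z | Θ x (⋃ y ∈ x, F y) z}`. -/
def Rec (E : M → M → Prop) (Θ : M → M → M → Prop) (x v : M) : Prop :=
  ∃ W, RecWitness E Θ W ∧ PairIn E W x v

variable {A : SetStr w M} {X : M → Prop}

namespace ModelsZF

variable (hZ : ModelsZF A X)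
include hZ

section Rec

variable (Θ : M → M → M → Prop) [hΘ : PDef A X (fun v : Fin 3 → M => Θ (v 0) (v 1) (v 2))]
  (hset : ∀ x u, ∃ v, ∀ z, A.mem z v ↔ Θ x u z)

include hΘ

omit hZ in
theorem pdef_rec {α : Type} {s t : (α → M) → M} [Tm s] [Tm t] :
    PDef A X (fun v => Rec A.mem Θ (s v) (t v)) := by
  have : ∀ {α : Type} {s t r : (α → M) → M} [Tm s] [Tm t] [Tm r],
    PDef A X (fun v => Θ (s v) (t v) (r v)) := hΘ.comp3
  have : PDef A X (fun v : Fin 2 → M => Rec A.mem Θ (v 0) (v 1)) := by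
    unfold Rec RecWitness; infer_instance
  exact PDef.comp2 (R := Rec A.mem Θ) this

/-- By induction on membership two witnesses agree at the elements of `x`, so the unions fed into
`Θ` coincide. -/
theorem rec_unique {x v v' : M} (h : Rec A.mem Θ x v) (h' : Rec A.mem Θ x v') : v = v' := by
  have : ∀ {α : Type} {s t : (α → M) → M} [Tm s] [Tm t],
    PDef A X (fun v => Rec A.mem Θ (s v) (t v)) := pdef_rec Θ
  refine hZ.mem_induction
    (fun x => ∀ v v', Rec A.mem Θ x v → Rec A.mem Θ x v' → v = v') ?_ x v v' h h'
  clear h h' x v v'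
  rintro x ih v v' ⟨W, hW, q, hq, hqW⟩ ⟨W', hW', q', hq', hqW'⟩
  obtain ⟨a, b, u, hab, h1, h2, h3⟩ := hW q hqW
  obtain ⟨rfl, rfl⟩ := hZ.opair_inj hq hab
  obtain ⟨a', b', u', hab', h1', h2', h3'⟩ := hW' q' hqW'
  obtain ⟨rfl, rfl⟩ := hZ.opair_inj hq' hab'
  have : u = u' := by
    refine hZ.ext fun c => (h2 c).trans (Iff.trans ⟨?_, ?_⟩ (h2' c).symm)
    · rintro ⟨y, b, hy, hyb, hc⟩
      obtain ⟨b', hb'⟩ := h1' y hy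
      obtain rfl := ih y hy b b' ⟨W, hW, hyb⟩ ⟨W', hW', hb'⟩
      exact ⟨y, b, hy, hb', hc⟩
    · rintro ⟨y, b, hy, hyb, hc⟩
      obtain ⟨b', hb'⟩ := h1 y hy
      obtain rfl := ih y hy b b' ⟨W', hW', hyb⟩ ⟨W, hW, hb'⟩
      exact ⟨y, b, hy, hb', hc⟩
  subst this
  exact hZ.ext fun z => (h3 z).trans (h3' z).symm

include hset

/-- By induction, the elements of `x` have witnesses; since values are unique, the union of a set of
witnesses is again one, and one new pair extends it to `x`. -/
theorem exists_rec (x : M) : ∃ v, Rec A.mem Θ x v := by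
  have hΘ' : ∀ {α : Type} {s t r : (α → M) → M} [Tm s] [Tm t] [Tm r],
    PDef A X (fun v => Θ (s v) (t v) (r v)) := hΘ.comp3
  have hR : ∀ {α : Type} {s t : (α → M) → M} [Tm s] [Tm t],
    PDef A X (fun v => Rec A.mem Θ (s v) (t v)) := pdef_rec Θ
  have hRW : ∀ {α : Type} {s : (α → M) → M} [Tm s],
      PDef A X (fun v => RecWitness A.mem Θ (s v)) := by
    have : PDef A X (fun v : Fin 1 → M => RecWitness A.mem Θ (v 0)) := by
      unfold RecWitness; infer_instance
    exact fun {α s} hs => PDef.comp this (t := ![s]) (by simp [hs])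
  refine hZ.mem_induction (fun x => ∃ v, Rec A.mem Θ x v) ?_ x
  intro x ih
  -- Witnesses are not unique, so collection is used rather than replacement, and members that are
  -- not witnesses are discarded afterwards.
  obtain ⟨𝒲, h𝒲⟩ := hZ.coll (fun y W => RecWitness A.mem Θ W ∧ ∃ b, PairIn A.mem W y b) x
    fun y hy => by
      obtain ⟨b, W, hW, hb⟩ := ih y hy
      exact ⟨W, hW, b, hb⟩
  obtain ⟨𝒱, h𝒱⟩ := hZ.sep (fun W => RecWitness A.mem Θ W) 𝒲
  obtain ⟨W, hW⟩ := hZ.exists_sUnion 𝒱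
  have hW1 : ∀ y b, PairIn A.mem W y b → Rec A.mem Θ y b := by
    rintro y b ⟨q, hq, hqW⟩
    obtain ⟨W', hW', hqW'⟩ := (hW q).1 hqW
    exact ⟨W', ((h𝒱 W').1 hW').2, q, hq, hqW'⟩
  obtain ⟨c, hc⟩ := hZ.repl (fun y b => Rec A.mem Θ y b) x ih
    fun y b b' _ h h' => hZ.rec_unique Θ h h'
  obtain ⟨u, hu⟩ := hZ.exists_sUnion c
  obtain ⟨v, hv⟩ := hset x u
  obtain ⟨q, hq⟩ := hZ.exists_opair x v
  obtain ⟨W₁, hW₁⟩ := hZ.exists_insert W q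
  have mono : ∀ y b, PairIn A.mem W y b → PairIn A.mem W₁ y b :=
    fun y b ⟨r, hr, hrW⟩ => ⟨r, hr, (hW₁ r).2 (.inl hrW)⟩
  have hxW : ∀ y, A.mem y x → ∃ b, PairIn A.mem W y b := by
    intro y hy
    obtain ⟨W', h1, h2, b, q, hq, hb⟩ := h𝒲 y hy
    exact ⟨b, q, hq, (hW q).2 ⟨W', (h𝒱 W').2 ⟨h1, h2⟩, hb⟩⟩
  have hW₁' : ∀ x' u', (∀ y, A.mem y x' → ∃ b, PairIn A.mem W y b) → ¬ A.mem x x' →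
      ((∀ a, A.mem a u' ↔ ∃ y b, A.mem y x' ∧ Rec A.mem Θ y b ∧ A.mem a b) →
      ∀ a, A.mem a u' ↔ ∃ y b, A.mem y x' ∧ PairIn A.mem W₁ y b ∧ A.mem a b) := by
    intro x' u' h1 hxx' h2 a
    refine (h2 a).trans ⟨?_, ?_⟩
    · rintro ⟨y, b, hy, hb, ha⟩
      obtain ⟨b', hb'⟩ := h1 y hy
      obtain rfl := hZ.rec_unique Θ hb (hW1 _ _ hb')
      exact ⟨y, b, hy, mono _ _ hb', ha⟩
    · rintro ⟨y, b, hy, ⟨r, hr, hrW⟩, ha⟩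
      rcases (hW₁ r).1 hrW with h | rfl
      · exact ⟨y, b, hy, hW1 _ _ ⟨r, hr, h⟩, ha⟩
      · obtain ⟨rfl, -⟩ := hZ.opair_inj hr hq
        exact (hxx' hy).elim
  -- If `x` has no value in `W`, then `x` is not an element of any `x'` with a value in `W`, so the
  -- new pair does not change the unions at the old pairs.
  by_cases hxin : ∃ b, PairIn A.mem W x b
  · exact hxin.imp fun b hb => hW1 _ _ hb
  have hWtr : ∀ q, A.mem q W → ∃ x v u, IsOPair A.mem q x v ∧
      (∀ y, A.mem y x → ∃ b, PairIn A.mem W y b) ∧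
      (∀ a, A.mem a u ↔ ∃ y b, A.mem y x ∧ Rec A.mem Θ y b ∧ A.mem a b) ∧
      ∀ z, A.mem z v ↔ Θ x u z := by
    intro q hq
    obtain ⟨W', hW', hqW'⟩ := (hW q).1 hq
    have hR' := ((h𝒱 W').1 hW').2
    obtain ⟨x, v, u, hxv, h1, h2, h3⟩ := hR' q hqW'
    have sub : ∀ y b, PairIn A.mem W' y b → PairIn A.mem W y b :=
      fun y b ⟨r, hr, hr'⟩ => ⟨r, hr, (hW r).2 ⟨W', hW', hr'⟩⟩
    refine ⟨x, v, u, hxv, fun y hy => (h1 y hy).imp (sub y), fun a => (h2 a).trans ⟨?_, ?_⟩, h3⟩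
    · rintro ⟨y, b, hy, hb, ha⟩
      exact ⟨y, b, hy, ⟨W', hR', hb⟩, ha⟩
    · rintro ⟨y, b, hy, hb, ha⟩
      obtain ⟨b', hb'⟩ := h1 y hy
      obtain rfl := hZ.rec_unique Θ hb ⟨W', hR', hb'⟩
      exact ⟨y, b, hy, hb', ha⟩
  refine ⟨v, W₁, fun r hr => ?_, q, hq, (hW₁ q).2 (.inr rfl)⟩
  rcases (hW₁ r).1 hr with hr | rfl
  · obtain ⟨x', v', u', hxv, h1, h2, h3⟩ := hWtr r hr
    exact ⟨x', v', u', hxv, fun y hy => (h1 y hy).imp (mono y),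
      hW₁' x' u' h1 (fun h => hxin (h1 x h)) h2, h3⟩
  · refine ⟨x, v, u, hq, fun y hy => (hxW y hy).imp (mono y),
      hW₁' x u hxW (hZ.mem_irrefl x) (fun a => (hu a).trans ⟨?_, ?_⟩), hv⟩
    · rintro ⟨b, hb, ha⟩
      obtain ⟨y, hy, hyb⟩ := (hc b).1 hb
      exact ⟨y, b, hy, hyb, ha⟩
    · rintro ⟨y, b, hy, hyb, ha⟩
      exact ⟨b, (hc b).2 ⟨y, hy, hyb⟩, ha⟩

theorem exists_union_rec (x : M) :
    ∃ u, ∀ a, A.mem a u ↔ ∃ y b, A.mem y x ∧ Rec A.mem Θ y b ∧ A.mem a b := by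
  have hR : ∀ {α : Type} {s t : (α → M) → M} [Tm s] [Tm t],
    PDef A X (fun v => Rec A.mem Θ (s v) (t v)) := pdef_rec Θ
  obtain ⟨c, hc⟩ := hZ.repl (fun y b => Rec A.mem Θ y b) x (fun y _ => hZ.exists_rec Θ hset y)
    fun y b b' _ h h' => hZ.rec_unique Θ h h'
  obtain ⟨u, hu⟩ := hZ.exists_sUnion c
  refine ⟨u, fun a => (hu a).trans ⟨?_, ?_⟩⟩
  · rintro ⟨b, hb, ha⟩
    obtain ⟨y, hy, hyb⟩ := (hc b).1 hb
    exact ⟨y, b, hy, hyb, ha⟩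
  · rintro ⟨y, b, hy, hyb, ha⟩
    exact ⟨b, (hc b).2 ⟨y, hy, hyb⟩, ha⟩

omit hset in
theorem mem_rec {x v : M} (h : Rec A.mem Θ x v) {u : M}
    (hu : ∀ a, A.mem a u ↔ ∃ y b, A.mem y x ∧ Rec A.mem Θ y b ∧ A.mem a b) (z : M) :
    A.mem z v ↔ Θ x u z := by
  obtain ⟨W, hW, q, hq, hqW⟩ := h
  obtain ⟨x', v', u', hab, h1, h2, h3⟩ := hW q hqW
  obtain ⟨rfl, rfl⟩ := hZ.opair_inj hq hab
  have : u' = u := by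
    refine hZ.ext fun a => (h2 a).trans (Iff.trans ⟨?_, ?_⟩ (hu a).symm)
    · rintro ⟨y, b, hy, hb, ha⟩
      exact ⟨y, b, hy, ⟨W, hW, hb⟩, ha⟩
    · rintro ⟨y, b, hy, hb, ha⟩
      obtain ⟨b', hb'⟩ := h1 y hy
      obtain rfl := hZ.rec_unique Θ hb ⟨W, hW, hb'⟩
      exact ⟨y, b, hy, hb', ha⟩
  exact this ▸ h3 z

end Rec

end ModelsZF

/-! ### The cumulative hierarchy -/

/-- `u` is the union of the power sets of the `V y` for `y ∈ x`, that is, `u = V_α` for the rank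
`α` of `x`. -/
def IsV (E : M → M → Prop) (x u : M) : Prop :=
  ∀ a, E a u ↔ ∃ y b, E y x ∧ Rec E (fun _ u z => Sub E z u) y b ∧ E a b

/-- `u` is a level of the cumulative hierarchy. -/
def Lev (E : M → M → Prop) (u : M) : Prop := ∃ x, IsV E x u

/-- `u` is a limit level of the cumulative hierarchy. -/
def Lim (E : M → M → Prop) (u : M) : Prop :=
  Lev E u ∧ (∃ x, E x u) ∧ ∀ x, E x u → ∃ v, E v u ∧ Lev E v ∧ E x v

section

variable {α : Type} {i j : α}

instance : UDef.{u} (w := w) p (fun M A X v => Sub A.mem (v i) (v j)) := by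
  unfold Sub; infer_instance

instance : UDef.{u} (w := w) p (fun M A X v => IsV A.mem (v i) (v j)) := by
  unfold IsV Rec RecWitness; infer_instance

instance : UDef.{u} (w := w) p (fun M A X v => Lev A.mem (v i)) := by
  unfold Lev; infer_instance

instance : UDef.{u} (w := w) p (fun M A X v => Lim A.mem (v i)) := by
  unfold Lim; infer_instance

end

section

variable {α : Type} {s t : (α → M) → M}

instance [Tm s] [Tm t] : PDef A X (fun v => Sub A.mem (s v) (t v)) :=
  UDef.pdef2 (fun _ A _ => Sub A.mem)

instance [Tm s] [Tm t] : PDef A X (fun v => IsV A.mem (s v) (t v)) :=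
  UDef.pdef2 (fun _ A _ => IsV A.mem)

instance [Tm s] : PDef A X (fun v => Lev A.mem (s v)) := UDef.pdef1 (fun _ A _ => Lev A.mem)

end

namespace ModelsZF

variable (hZ : ModelsZF A X)

include hZ

theorem exists_isV (x : M) : ∃ u, IsV A.mem x u :=
  hZ.exists_union_rec (fun _ u z => Sub A.mem z u) (fun _ u => hZ.exists_power u) x

/-- The level `V_α` for the rank `α` of `x`. -/
noncomputable def V (x : M) : M := Classical.choose (hZ.exists_isV x)

theorem isV_V (x : M) : IsV A.mem x (hZ.V x) := Classical.choose_spec (hZ.exists_isV x)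

theorem isV_iff {x u : M} : IsV A.mem x u ↔ u = hZ.V x := by
  constructor
  · exact fun h => hZ.ext fun z => (h z).trans (hZ.isV_V x z).symm
  · rintro rfl
    exact hZ.isV_V x

theorem lev_V (x : M) : Lev A.mem (hZ.V x) := ⟨x, hZ.isV_V x⟩

/-- This equation, `V x = ⋃ {𝒫 (V y) | y ∈ x}`, is all that is used about the recursion from here
on. -/
theorem mem_V {a x : M} : A.mem a (hZ.V x) ↔ ∃ y, A.mem y x ∧ Sub A.mem a (hZ.V y) := by
  refine (hZ.isV_V x a).trans ⟨?_, ?_⟩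
  · rintro ⟨y, b, hy, hb, ha⟩
    exact ⟨y, hy, (hZ.mem_rec _ hb (hZ.isV_V y) a).1 ha⟩
  · rintro ⟨y, hy, ha⟩
    obtain ⟨b, hb⟩ := hZ.exists_rec _ (fun _ u => hZ.exists_power u) y
    exact ⟨y, b, hy, hb, (hZ.mem_rec _ hb (hZ.isV_V y) a).2 ha⟩

theorem pdef_mem_V {α : Type} {s t : (α → M) → M} [Tm s] [Tm t] :
    PDef A X (fun v => A.mem (s v) (hZ.V (t v))) := by
  have : PDef A X (fun v : Fin 2 → M => A.mem (v 0) (hZ.V (v 1))) :=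
    PDef.congr (Q := fun v => ∃ u, IsV A.mem (v 1) u ∧ A.mem (v 0) u) fun v => by
      simp [hZ.isV_iff]
  exact PDef.comp2 (R := fun a b => A.mem a (hZ.V b)) this

theorem pdef_V_mem_V {α : Type} {s t : (α → M) → M} [Tm s] [Tm t] :
    PDef A X (fun v => A.mem (hZ.V (s v)) (hZ.V (t v))) := by
  have : PDef A X (fun v : Fin 2 → M => A.mem (hZ.V (v 0)) (hZ.V (v 1))) :=
    PDef.congr (Q := fun v => ∃ u u', IsV A.mem (v 1) u ∧ IsV A.mem (v 0) u' ∧ A.mem u' u)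
      fun v => by simp [hZ.isV_iff]
  exact PDef.comp2 (R := fun a b => A.mem (hZ.V a) (hZ.V b)) this

theorem V_super {x y z : M} (hz : A.mem z (hZ.V x)) (hy : Sub A.mem y z) :
    A.mem y (hZ.V x) := by
  obtain ⟨a, ha, h⟩ := hZ.mem_V.1 hz
  exact hZ.mem_V.2 ⟨a, ha, fun b hb => h b (hy b hb)⟩

theorem V_trans (x : M) : ∀ z, A.mem z (hZ.V x) → Sub A.mem z (hZ.V x) := by
  have := @pdef_mem_V w M A X hZ
  unfold Sub
  refine hZ.mem_induction
    (fun x => ∀ z, A.mem z (hZ.V x) → ∀ y, A.mem y z → A.mem y (hZ.V x)) ?_ x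
  intro x ih z hz y hy
  obtain ⟨a, ha, h⟩ := hZ.mem_V.1 hz
  exact hZ.mem_V.2 ⟨a, ha, ih a ha y (h y hy)⟩

theorem V_mem_V {x y : M} (h : A.mem y x) : A.mem (hZ.V y) (hZ.V x) :=
  hZ.mem_V.2 ⟨y, h, fun _ h => h⟩

theorem sub_V (x : M) : Sub A.mem x (hZ.V x) := by
  have := @pdef_mem_V w M A X hZ
  unfold Sub
  refine hZ.mem_induction (fun x => ∀ y, A.mem y x → A.mem y (hZ.V x)) ?_ x
  exact fun x ih y hy => hZ.mem_V.2 ⟨y, hy, ih y hy⟩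

theorem V_linear (x y : M) : Sub A.mem (hZ.V x) (hZ.V y) ∨ A.mem (hZ.V y) (hZ.V x) := by
  have := @pdef_mem_V w M A X hZ
  have := @pdef_V_mem_V w M A X hZ
  have step : ∀ x y, (∀ a, A.mem a x → Sub A.mem (hZ.V y) (hZ.V a) ∨ A.mem (hZ.V a) (hZ.V y)) →
      Sub A.mem (hZ.V x) (hZ.V y) ∨ A.mem (hZ.V y) (hZ.V x) := by
    intro x y H
    by_cases h : ∃ a, A.mem a x ∧ Sub A.mem (hZ.V y) (hZ.V a)
    · obtain ⟨a, ha, h⟩ := h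
      exact .inr (hZ.mem_V.2 ⟨a, ha, h⟩)
    · push Not at h
      refine .inl fun z hz => ?_
      obtain ⟨a, ha, hza⟩ := hZ.mem_V.1 hz
      exact hZ.V_super ((H a ha).resolve_left (h a ha)) hza
  revert y
  unfold Sub at step ⊢
  refine hZ.mem_induction (fun x => ∀ y, (∀ z, A.mem z (hZ.V x) → A.mem z (hZ.V y)) ∨
    A.mem (hZ.V y) (hZ.V x)) ?_ x
  -- One induction on `x`, for all `y`, suffices: `step` reduces `(x, y)` to `(y, a)` with `a ∈ x`,
  -- and a second use reduces this to `(a, b)` with `b ∈ y`.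
  exact fun x ih y => step x y fun a ha => step y a fun b hb => ih a ha b

theorem lev_super {u y z : M} (hu : Lev A.mem u) (hz : A.mem z u) (hy : Sub A.mem y z) :
    A.mem y u := by
  obtain ⟨x, hx⟩ := hu
  obtain rfl := hZ.isV_iff.1 hx
  exact hZ.V_super hz hy

theorem lev_trans {u y z : M} (hu : Lev A.mem u) (hz : A.mem z u) (hy : A.mem y z) :
    A.mem y u := by
  obtain ⟨x, hx⟩ := hu
  obtain rfl := hZ.isV_iff.1 hx
  exact hZ.V_trans x z hz y hy

theorem lev_linear {u v : M} (hu : Lev A.mem u) (hv : Lev A.mem v) :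
    Sub A.mem u v ∨ A.mem v u := by
  obtain ⟨x, hx⟩ := hu
  obtain rfl := hZ.isV_iff.1 hx
  obtain ⟨y, hy⟩ := hv
  obtain rfl := hZ.isV_iff.1 hy
  exact hZ.V_linear x y

theorem exists_lev (x : M) : ∃ u, Lev A.mem u ∧ A.mem x u := by
  obtain ⟨y, hy⟩ := hZ.exists_upair x x
  exact ⟨hZ.V y, hZ.lev_V y, hZ.sub_V y x ((hy x).2 (.inl rfl))⟩

/-- As `V` commutes with unions of its argument, it suffices to collect a set of indices for the
given levels and to take its union. -/
theorem lev_sUnion {B u : M} (hB : ∀ b, A.mem b B → Lev A.mem b)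
    (hu : ∀ z, A.mem z u ↔ ∃ y, A.mem y B ∧ A.mem z y) : Lev A.mem u := by
  obtain ⟨c, hc⟩ := hZ.coll (fun b x => IsV A.mem x b) B hB
  obtain ⟨c', hc'⟩ := hZ.sep (fun x => ∃ b, A.mem b B ∧ IsV A.mem x b) c
  obtain ⟨d, hd⟩ := hZ.exists_sUnion c'
  refine ⟨d, hZ.isV_iff.2 (hZ.ext fun z => (hu z).trans ⟨?_, ?_⟩)⟩
  · rintro ⟨b, hb, hz⟩
    obtain ⟨x, hx, hxb⟩ := hc b hb
    obtain rfl := hZ.isV_iff.1 hxb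
    obtain ⟨y, hy, hzy⟩ := hZ.mem_V.1 hz
    exact hZ.mem_V.2 ⟨y, (hd y).2 ⟨x, (hc' x).2 ⟨hx, _, hb, hxb⟩, hy⟩, hzy⟩
  · intro hz
    obtain ⟨y, hy, hzy⟩ := hZ.mem_V.1 hz
    obtain ⟨x, hx, hyx⟩ := (hd y).1 hy
    obtain ⟨-, b, hb, hxb⟩ := (hc' x).1 hx
    obtain rfl := hZ.isV_iff.1 hxb
    exact ⟨_, hb, hZ.mem_V.2 ⟨y, hyx, hzy⟩⟩

/-- Components of a code are not elements of it, only elements of its transitive closure; they do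
have smaller rank, so this is the induction suited to formulae. -/
theorem rank_induction (P : M → Prop) [h : PDef A X (fun v : Fin 1 → M => P (v 0))]
    (hP : ∀ x, (∀ y, A.mem (hZ.V y) (hZ.V x) → P y) → P x) (x : M) : P x := by
  have : ∀ {α : Type} {s : (α → M) → M} [Tm s], PDef A X (fun v => P (s v)) :=
    fun {α s} hs => h.comp (t := ![s]) (by simp [hs])
  have key := hZ.mem_induction (fun u => ∀ x, IsV A.mem x u → P x)
    (fun u ih x hx => hP x fun y hy => ih _ (hZ.isV_iff.1 hx ▸ hy) y (hZ.isV_V y))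
  exact key _ x (hZ.isV_V x)

theorem exists_least_lev (P : M → Prop) [h : PDef A X (fun v : Fin 1 → M => P (v 0))]
    (hP : ∃ u, Lev A.mem u ∧ P u) :
    ∃ u, Lev A.mem u ∧ P u ∧ ∀ v, Lev A.mem v → P v → Sub A.mem u v := by
  obtain ⟨u, ⟨hu, hPu⟩, hmin⟩ := hZ.exists_minimal (fun u => Lev A.mem u ∧ P u) hP
  exact ⟨u, hu, hPu, fun v hv hPv =>
    (hZ.lev_linear hu hv).resolve_right fun h => hmin v h ⟨hv, hPv⟩⟩

/-- The closure argument of the reflection theorem: each level is followed by the least level that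
contains it and has `R`-values for its elements, and `ω` such steps are united. Leastness makes the
step functional without choice. -/
theorem exists_lim_closed (R : M → M → Prop)
    [h : PDef A X (fun v : Fin 2 → M => R (v 0) (v 1))] (hR : ∀ x, ∃ y, R x y) (a : M) :
    ∃ U, Lim A.mem U ∧ A.mem a U ∧ ∀ x, A.mem x U → ∃ y, A.mem y U ∧ R x y := by
  have : ∀ {α : Type} {s t : (α → M) → M} [Tm s] [Tm t], PDef A X (fun v => R (s v) (t v)) :=
    h.comp2
  let Q : M → M → Prop := fun u v => A.mem u v ∧ ∀ x, A.mem x u → ∃ y, A.mem y v ∧ R x y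
  have hQ : ∀ u, ∃ v, Lev A.mem v ∧ Q u v := by
    intro u
    obtain ⟨c, hc⟩ := hZ.coll R u fun x _ => hR x
    obtain ⟨q, hq⟩ := hZ.exists_upair u c
    obtain ⟨v, hv, hqv⟩ := hZ.exists_lev q
    refine ⟨v, hv, hZ.lev_trans hv hqv ((hq u).2 (.inl rfl)), fun x hx => ?_⟩
    obtain ⟨y, hy, hxy⟩ := hc x hx
    exact ⟨y, hZ.lev_trans hv (hZ.lev_trans hv hqv ((hq c).2 (.inr rfl))) hy, hxy⟩
  obtain ⟨u₀, hu₀, hau₀⟩ := hZ.exists_lev a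
  have hex : ∀ u, ∃ v, Lev A.mem v ∧ Q u v ∧ ∀ v', Lev A.mem v' → Q u v' → Sub A.mem v v' :=
    fun u => hZ.exists_least_lev (Q u) (hQ u)
  obtain ⟨B, hB, hB'⟩ := hZ.exists_iterate
    (fun u v => Lev A.mem v ∧ Q u v ∧ ∀ v', Lev A.mem v' → Q u v' → Sub A.mem v v') hex
    (fun u v v' ⟨h1, h2, h3⟩ ⟨h1', h2', h3'⟩ =>
      hZ.ext fun z => ⟨h3 v' h1' h2' z, h3' v h1 h2 z⟩) u₀
  -- The iteration only promises a set closed under the step, so the levels are cut out of `B`; they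
  -- remain closed because the step leads to levels.
  obtain ⟨C, hC⟩ := hZ.sep (fun u => Lev A.mem u) B
  obtain ⟨U, hU⟩ := hZ.exists_sUnion C
  have hstep : ∀ u, A.mem u C → ∃ v, A.mem v C ∧ Q u v := by
    intro u hu
    obtain ⟨v, hv, h1, h2, -⟩ := hB' u ((hC u).1 hu).1
    exact ⟨v, (hC v).2 ⟨hv, h1⟩, h2⟩
  have haU : A.mem a U := (hU a).2 ⟨u₀, (hC u₀).2 ⟨hB, hu₀⟩, hau₀⟩
  refine ⟨U, ⟨hZ.lev_sUnion (fun b hb => ((hC b).1 hb).2) hU, ⟨a, haU⟩, fun x hx => ?_⟩, haU,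
    fun x hx => ?_⟩
  · obtain ⟨u, hu, hxu⟩ := (hU x).1 hx
    obtain ⟨v, hv, huv, -⟩ := hstep u hu
    exact ⟨u, (hU u).2 ⟨v, hv, huv⟩, ((hC u).1 hu).2, hxu⟩
  · obtain ⟨u, hu, hxu⟩ := (hU x).1 hx
    obtain ⟨v, hv, -, huv⟩ := hstep u hu
    obtain ⟨y, hy, hxy⟩ := huv x hxu
    exact ⟨y, (hU y).2 ⟨v, hv, hy⟩, hxy⟩

end ModelsZF

end

/-! ### Coding and limit levels -/

section

variable {M : Type u}

/-- `φ = ⟨k, q⟩` -/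
def IsTagged (E : M → M → Prop) (k : ℕ) (φ q : M) : Prop := ∃ c, IsNum E k c ∧ IsOPair E φ c q

/-- `s'` is the result of changing the value of the assignment `s` at `n` to `x`. -/
def IsUpd (E : M → M → Prop) (s n x s' : M) : Prop :=
  ∀ q, E q s' ↔ (E q s ∧ ¬ ∃ y, IsOPair E q n y) ∨ IsOPair E q n x

/-- `x` is a value of the term `t` under the assignment `s`. -/
def Val (E : M → M → Prop) (s t x : M) : Prop :=
  IsConst E t x ∨ ∃ n, IsVar E t n ∧ PairIn E s n x

/-- One step of the recursive definition of satisfaction in `U`. -/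
def SatStep (A : SetStr w M) (U : M) (T : M → M → Prop) (φ s : M) : Prop :=
  (∃ t₁ t₂ x, IsEqF A.mem φ t₁ t₂ ∧ Val A.mem s t₁ x ∧ Val A.mem s t₂ x) ∨
  (∃ t₁ t₂ x y, IsMemF A.mem φ t₁ t₂ ∧ Val A.mem s t₁ x ∧ Val A.mem s t₂ y ∧ A.mem x y) ∨
  (∃ t₁ t₂ x y, IsLtF A.mem φ t₁ t₂ ∧ Val A.mem s t₁ x ∧ Val A.mem s t₂ y ∧
    ∃ h : w = true, A.lt h x y) ∨
  (∃ ψ, IsNeg A.mem φ ψ ∧ ¬ T ψ s) ∨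
  (∃ ψ₁ ψ₂, IsOr A.mem φ ψ₁ ψ₂ ∧ (T ψ₁ s ∨ T ψ₂ s)) ∨
  ∃ n ψ x s', IsEx A.mem φ n ψ ∧ A.mem x U ∧ IsUpd A.mem s n x s' ∧ T ψ s'

/-- The relation defining by recursion the set of all `⟨φ, s⟩` with `s ∈ U` such that `φ` is
satisfied by `s` in `U`, where `φ` ranges over the transitive closure of `{x}`. -/
def SatRel (A : SetStr w M) (U x u z : M) : Prop :=
  A.mem z u ∨ ∃ s, A.mem s U ∧ IsOPair A.mem z x s ∧ SatStep A U (PairIn A.mem u) x s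

/-- `φ` is satisfied in `U` by the assignment `s ∈ U`. Any set serves as an assignment; it assigns
to `v_n` each `x` with `⟨n, x⟩ ∈ s`. -/
def LSat (A : SetStr w M) (U φ s : M) : Prop :=
  ∃ T, Rec A.mem (SatRel A U) φ T ∧ PairIn A.mem T φ s

end

section

variable {α : Type} {i j k l : α}

instance : UDef.{u} (w := w) p (fun M A X v => IsUpd A.mem (v i) (v j) (v k) (v l)) := by
  unfold IsUpd; infer_instance

instance : UDef.{u} (w := w) p (fun M A X v => Val A.mem (v i) (v j) (v k)) := by
  unfold Val; infer_instance

instance : UDef.{u} (w := w) p (fun M A X v => SatRel A (v i) (v j) (v k) (v l)) := by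
  unfold SatRel SatStep; infer_instance

instance : UDef.{u} (w := w) p (fun M A X v => LSat A (v i) (v j) (v k)) := by
  unfold LSat Rec RecWitness; infer_instance

end

section

variable {M : Type u} {A : SetStr w M} {X : M → Prop} {α : Type} {s t r q : (α → M) → M}

instance [Tm s] [Tm t] [Tm r] [Tm q] :
    PDef A X (fun v => IsUpd A.mem (s v) (t v) (r v) (q v)) :=
  UDef.pdef4 (fun _ A _ => IsUpd A.mem)

instance [Tm s] [Tm t] [Tm r] [Tm q] :
    PDef A X (fun v => SatRel A (s v) (t v) (r v) (q v)) :=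
  UDef.pdef4 (fun _ A _ => SatRel A)

instance [Tm s] [Tm t] [Tm r] : PDef A X (fun v => LSat A (s v) (t v) (r v)) :=
  UDef.pdef3 (fun _ A _ => LSat A)

end

section

variable {M : Type u} {A : SetStr w M} {X : M → Prop}

open Relation

theorem IsCode.tagged {k : ℕ} {φ a b : M} (h : IsCode A.mem k φ a b) :
    ∃ q, IsTagged A.mem k φ q ∧ IsOPair A.mem q a b :=
  let ⟨c, q, hc, hq, hφ⟩ := h
  ⟨q, ⟨c, hc, hφ⟩, hq⟩

theorem IsTagged.code {k : ℕ} {φ q a b : M} (h : IsTagged A.mem k φ q)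
    (hq : IsOPair A.mem q a b) : IsCode A.mem k φ a b :=
  let ⟨c, hc, hφ⟩ := h
  ⟨c, q, hc, hq, hφ⟩

namespace ModelsZF

variable (hZ : ModelsZF A X)
include hZ

theorem tagged_inj {k l : ℕ} {φ q q' : M} (h : IsTagged A.mem k φ q)
    (h' : IsTagged A.mem l φ q') : k = l ∧ q = q' := by
  obtain ⟨c, hc, hφ⟩ := h
  obtain ⟨c', hc', hφ'⟩ := h'
  obtain ⟨rfl, rfl⟩ := hZ.opair_inj hφ hφ'
  exact ⟨hZ.isNum_inj hc hc', rfl⟩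

theorem code_inj {k l : ℕ} {φ a b a' b' : M} (h : IsCode A.mem k φ a b)
    (h' : IsCode A.mem l φ a' b') : k = l ∧ a = a' ∧ b = b' := by
  obtain ⟨q, h1, h2⟩ := h.tagged
  obtain ⟨q', h1', h2'⟩ := h'.tagged
  obtain ⟨rfl, rfl⟩ := hZ.tagged_inj h1 h1'
  exact ⟨rfl, hZ.opair_inj h2 h2'⟩

theorem neg_code {k : ℕ} {φ ψ a b : M} (h : IsNeg A.mem φ ψ) (h' : IsCode A.mem k φ a b) :
    k = 3 := by
  obtain ⟨q', h1', h2'⟩ := h'.tagged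
  exact (hZ.tagged_inj h1' h).1

theorem neg_inj {φ ψ ψ' : M} (h : IsNeg A.mem φ ψ) (h' : IsNeg A.mem φ ψ') : ψ = ψ' :=
  (hZ.tagged_inj (k := 3) (l := 3) h h').2

theorem const_inj {t x y : M} (h : IsConst A.mem t x) (h' : IsConst A.mem t y) : x = y :=
  (hZ.tagged_inj (k := 1) (l := 1) h h').2

theorem var_inj {t x y : M} (h : IsVar A.mem t x) (h' : IsVar A.mem t y) : x = y :=
  (hZ.tagged_inj (k := 0) (l := 0) h.2 h'.2).2

theorem var_const {t x y : M} (h : IsVar A.mem t x) (h' : IsConst A.mem t y) : False :=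
  absurd (hZ.tagged_inj (k := 0) (l := 1) h.2 h').1 (by decide)

theorem exists_tagged (k : ℕ) (q : M) : ∃ φ, IsTagged A.mem k φ q := by
  obtain ⟨c, hc⟩ := hZ.exists_isNum k
  obtain ⟨φ, hφ⟩ := hZ.exists_opair c q
  exact ⟨φ, c, hc, hφ⟩

theorem exists_code (k : ℕ) (a b : M) : ∃ φ, IsCode A.mem k φ a b := by
  obtain ⟨q, hq⟩ := hZ.exists_opair a b
  obtain ⟨φ, hφ⟩ := hZ.exists_tagged k q
  exact ⟨φ, hφ.code hq⟩

theorem opair_transGen {q a b : M} (h : IsOPair A.mem q a b) :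
    TransGen A.mem a q ∧ TransGen A.mem b q := by
  obtain ⟨d, hd⟩ := hZ.exists_upair a b
  have hdq : A.mem d q := (h d).2 (.inr hd)
  exact ⟨.tail (.single ((hd a).2 (.inl rfl))) hdq, .tail (.single ((hd b).2 (.inr rfl))) hdq⟩

theorem tagged_transGen {k : ℕ} {φ q : M} (h : IsTagged A.mem k φ q) : TransGen A.mem q φ :=
  let ⟨c, hc, hφ⟩ := h
  (hZ.opair_transGen hφ).2

theorem neg_transGen {φ ψ : M} (h : IsNeg A.mem φ ψ) : TransGen A.mem ψ φ :=
  hZ.tagged_transGen (k := 3) h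

theorem code_transGen {k : ℕ} {φ a b : M} (h : IsCode A.mem k φ a b) :
    TransGen A.mem a φ ∧ TransGen A.mem b φ := by
  obtain ⟨q, h1, h2⟩ := h.tagged
  exact ⟨(hZ.opair_transGen h2).1.trans (hZ.tagged_transGen h1),
    (hZ.opair_transGen h2).2.trans (hZ.tagged_transGen h1)⟩

theorem transGen_V {x y : M} (h : TransGen A.mem x y) : A.mem (hZ.V x) (hZ.V y) := by
  induction h with
  | single h => exact hZ.V_mem_V h
  | tail _ h ih => exact hZ.V_trans _ _ (hZ.V_mem_V h) _ ih

theorem transGen_mem {U x y : M} (hU : Lev A.mem U) (h : TransGen A.mem x y)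
    (hy : A.mem y U) : A.mem x U := by
  induction h with
  | single h => exact hZ.lev_trans hU hy h
  | tail _ h ih => exact ih (hZ.lev_trans hU hy h)

/-! #### Closure properties of limit levels -/

theorem lim_lev {U x y : M} (hU : Lim A.mem U) (hx : A.mem x U) (hy : A.mem y U) :
    ∃ u, A.mem u U ∧ Lev A.mem u ∧ A.mem x u ∧ A.mem y u := by
  obtain ⟨u, huU, hu, hxu⟩ := hU.2.2 x hx
  obtain ⟨v, hvU, hv, hyv⟩ := hU.2.2 y hy
  rcases hZ.lev_linear hu hv with h | h
  · exact ⟨v, hvU, hv, h x hxu, hyv⟩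
  · exact ⟨u, huU, hu, hxu, hZ.lev_trans hu h hyv⟩

theorem lim_upair {U x y z : M} (hU : Lim A.mem U) (hx : A.mem x U) (hy : A.mem y U)
    (hz : IsUPair A.mem z x y) : A.mem z U := by
  obtain ⟨u, huU, hu, hxu, hyu⟩ := hZ.lim_lev hU hx hy
  refine hZ.lev_super hU.1 huU fun a ha => ?_
  rcases (hz a).1 ha with rfl | rfl
  exacts [hxu, hyu]

theorem lim_opair {U x y z : M} (hU : Lim A.mem U) (hx : A.mem x U) (hy : A.mem y U)
    (hz : IsOPair A.mem z x y) : A.mem z U := by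
  obtain ⟨c, hc⟩ := hZ.exists_upair x x
  obtain ⟨d, hd⟩ := hZ.exists_upair x y
  refine hZ.lim_upair hU (hZ.lim_upair hU hx hx hc) (hZ.lim_upair hU hx hy hd) fun a =>
    (hz a).trans (or_congr ⟨fun h => hZ.upair_unique h hc, ?_⟩
      ⟨fun h => hZ.upair_unique h hd, ?_⟩)
  · rintro rfl; exact hc
  · rintro rfl; exact hd

theorem exists_upd (s n x : M) : ∃ s', IsUpd A.mem s n x s' := by
  obtain ⟨s₁, hs₁⟩ := hZ.sep (fun q => ¬ ∃ y, IsOPair A.mem q n y) s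
  obtain ⟨q, hq⟩ := hZ.exists_opair n x
  obtain ⟨s', hs'⟩ := hZ.exists_insert s₁ q
  refine ⟨s', fun r => (hs' r).trans (or_congr (hs₁ r) ⟨?_, fun h => hZ.opair_unique h hq⟩)⟩
  rintro rfl; exact hq

theorem lim_upd {U s n x s' : M} (hU : Lim A.mem U) (hs : A.mem s U) (hn : A.mem n U)
    (hx : A.mem x U) (h : IsUpd A.mem s n x s') : A.mem s' U := by
  obtain ⟨q, hq⟩ := hZ.exists_opair n x
  obtain ⟨u, huU, hu, hsu, hqu⟩ := hZ.lim_lev hU hs (hZ.lim_opair hU hn hx hq)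
  refine hZ.lev_super hU.1 huU fun r hr => ?_
  rcases (h r).1 hr with h | h
  · exact hZ.lev_trans hu hsu h.1
  · exact hZ.opair_unique h hq ▸ hqu

theorem pairIn_upd {s n x s' m y : M} (h : IsUpd A.mem s n x s') :
    PairIn A.mem s' m y ↔ (m ≠ n ∧ PairIn A.mem s m y) ∨ (m = n ∧ y = x) := by
  constructor
  · rintro ⟨q, hq, hqs⟩
    rcases (h q).1 hqs with ⟨h1, h2⟩ | h
    · refine .inl ⟨?_, q, hq, h1⟩
      rintro rfl
      exact h2 ⟨y, hq⟩
    · exact .inr (hZ.opair_inj hq h)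
  · rintro (⟨h1, q, hq, hqs⟩ | ⟨rfl, rfl⟩)
    · exact ⟨q, hq, (h q).2 (.inl ⟨hqs, fun ⟨z, hz⟩ => h1 (hZ.opair_inj hq hz).1⟩)⟩
    · obtain ⟨q, hq⟩ := hZ.exists_opair m y
      exact ⟨q, hq, (h q).2 (.inr hq)⟩

theorem val_const {s t a x : M} (h : IsConst A.mem t a) : Val A.mem s t x ↔ x = a := by
  constructor
  · rintro (h' | ⟨n, hn, -⟩)
    exacts [hZ.const_inj h' h, (hZ.var_const hn h).elim]
  · rintro rfl; exact .inl h

theorem val_var {s t n x : M} (h : IsVar A.mem t n) : Val A.mem s t x ↔ PairIn A.mem s n x := by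
  constructor
  · rintro (h' | ⟨m, hm, hs⟩)
    exacts [(hZ.var_const h h').elim, hZ.var_inj h hm ▸ hs]
  · exact fun h' => .inr ⟨n, h, h'⟩

/-- Substitution in terms. -/
theorem val_subst {s s' n x t r y : M} (hs : IsUpd A.mem s n x s')
    (h : IsTermSubst A.mem n x t r) : Val A.mem s r y ↔ Val A.mem s' t y := by
  rcases h with ⟨h1, h2⟩ | ⟨h, rfl⟩
  · rw [hZ.val_const h2, hZ.val_var h1, hZ.pairIn_upd hs]
    simp
  · refine or_congr_right (exists_congr fun m => and_congr_right fun hm => ?_)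
    rw [hZ.pairIn_upd hs]
    have : m ≠ n := fun hmn => h (hmn ▸ hm)
    simp [this]

/-! #### Satisfaction in a set -/

theorem exists_satRel (U x u : M) : ∃ v, ∀ z, A.mem z v ↔ SatRel A U x u z := by
  obtain ⟨c, hc⟩ := hZ.repl (fun s z => IsOPair A.mem z x s) U (fun s _ => hZ.exists_opair x s)
    fun s z z' _ h h' => hZ.opair_unique h h'
  obtain ⟨d, hd⟩ := hZ.exists_union u c
  obtain ⟨v, hv⟩ := hZ.sep (fun z => SatRel A U x u z) d
  refine ⟨v, fun z => (hv z).trans (and_iff_right_of_imp ?_)⟩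
  rintro (h | ⟨s, hs, hz, -⟩)
  exacts [(hd z).2 (.inl h), (hd z).2 (.inr ((hc z).2 ⟨s, hs, hz⟩))]

theorem exists_satRec (U x : M) : ∃ T, Rec A.mem (SatRel A U) x T :=
  hZ.exists_rec (SatRel A U) (hZ.exists_satRel U) x

theorem mem_satRec {U x T z : M} (h : Rec A.mem (SatRel A U) x T) :
    ∃ u, (∀ a, A.mem a u ↔ ∃ y b, A.mem y x ∧ Rec A.mem (SatRel A U) y b ∧ A.mem a b) ∧
      (A.mem z T ↔ SatRel A U x u z) := by
  obtain ⟨u, hu⟩ := hZ.exists_union_rec (SatRel A U) (hZ.exists_satRel U) x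
  exact ⟨u, hu, hZ.mem_rec _ h hu z⟩

/-- The recursion accumulates entries, and an entry about `y` can only have been created at stage
`y`; it is therefore correct, and `y` is `x` or has smaller rank. -/
theorem satRec_coherent {U x T y s : M} (h : Rec A.mem (SatRel A U) x T)
    (hy : PairIn A.mem T y s) : LSat A U y s ∧ (y = x ∨ A.mem (hZ.V y) (hZ.V x)) := by
  have := @pdef_V_mem_V w M A X hZ
  have : ∀ {α : Type} {s t : (α → M) → M} [Tm s] [Tm t],
    PDef A X (fun v => Rec A.mem (SatRel A U) (s v) (t v)) := pdef_rec _
  refine hZ.mem_induction (fun x => ∀ T y s, Rec A.mem (SatRel A U) x T → PairIn A.mem T y s →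
    LSat A U y s ∧ (y = x ∨ A.mem (hZ.V y) (hZ.V x))) ?_ x T y s h hy
  clear h hy x T y s
  rintro x ih T y s h ⟨q, hq, hqT⟩
  obtain ⟨u, hu, hqu⟩ := hZ.mem_satRec (z := q) h
  rcases hqu.1 hqT with h' | ⟨s', hs', hq', -⟩
  · obtain ⟨z, b, hz, hzb, hqb⟩ := (hu q).1 h'
    obtain ⟨h1, h2⟩ := ih z hz b y s hzb ⟨q, hq, hqb⟩
    refine ⟨h1, .inr ?_⟩
    rcases h2 with rfl | h2
    · exact hZ.V_mem_V hz
    · exact hZ.V_trans _ _ (hZ.V_mem_V hz) _ h2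
  · obtain ⟨rfl, rfl⟩ := hZ.opair_inj hq hq'
    exact ⟨⟨T, h, q, hq, hqT⟩, .inl rfl⟩

theorem satRec_mono {U x y u T : M} (hyx : TransGen A.mem y x)
    (hu : ∀ a, A.mem a u ↔ ∃ y b, A.mem y x ∧ Rec A.mem (SatRel A U) y b ∧ A.mem a b)
    (hT : Rec A.mem (SatRel A U) y T) : Sub A.mem T u := by
  induction hyx generalizing u with
  | single h => exact fun a ha => (hu a).2 ⟨y, T, h, hT, ha⟩
  | @tail b c _ h ih =>
    intro a ha
    obtain ⟨T', hT'⟩ := hZ.exists_satRec U b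
    obtain ⟨u', hu', hau'⟩ := hZ.mem_satRec (z := a) hT'
    exact (hu a).2 ⟨b, T', h, hT', hau'.2 (.inl (ih hu' a ha))⟩

-- A step consults only the immediate subformulae, which lie in the transitive closure of the code.
omit hZ in
theorem satStep_congr {U : M} {T T' : M → M → Prop} {φ s : M} (hZ : ModelsZF A X)
    (h : ∀ ψ s, TransGen A.mem ψ φ → (T ψ s ↔ T' ψ s)) :
    SatStep A U T φ s ↔ SatStep A U T' φ s := by
  unfold SatStep
  refine or_congr_right (or_congr_right (or_congr_right (or_congr ?_ (or_congr ?_ ?_))))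
  · exact exists_congr fun ψ => and_congr_right fun hψ =>
      not_congr (h ψ s (hZ.neg_transGen hψ))
  · exact exists_congr fun ψ₁ => exists_congr fun ψ₂ => and_congr_right fun hψ =>
      or_congr (h _ s (hZ.code_transGen hψ).1) (h _ s (hZ.code_transGen hψ).2)
  · exact exists_congr fun n => exists_congr fun ψ => exists_congr fun x => exists_congr fun s' =>
      and_congr_right fun hψ => and_congr_right fun _ => and_congr_right fun _ =>
      h _ s' (hZ.code_transGen hψ.2).2

/-- Tarski's recursion. On formulae in the transitive closure of `φ`, the table available at stage
`φ` agrees with `LSat`, by `satRec_coherent` in one direction and `satRec_mono` in the other. -/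
theorem lsat_iff {U φ s : M} : LSat A U φ s ↔ A.mem s U ∧ SatStep A U (LSat A U) φ s := by
  obtain ⟨T, hT⟩ := hZ.exists_satRec U φ
  obtain ⟨q, hq⟩ := hZ.exists_opair φ s
  obtain ⟨u, hu, hqu⟩ := hZ.mem_satRec (z := q) hT
  have h1 : LSat A U φ s ↔ A.mem q T := by
    constructor
    · rintro ⟨T', hT', h⟩
      obtain rfl := hZ.rec_unique _ hT' hT
      exact (hZ.pairIn_iff hq).1 h
    · exact fun h => ⟨T, hT, q, hq, h⟩
  have h2 : SatStep A U (PairIn A.mem u) φ s ↔ SatStep A U (LSat A U) φ s := by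
    refine satStep_congr hZ fun ψ s' hψ => ⟨?_, ?_⟩
    · rintro ⟨r, hr, hru⟩
      obtain ⟨y, b, -, hb, hrb⟩ := (hu r).1 hru
      exact (hZ.satRec_coherent hb ⟨r, hr, hrb⟩).1
    · rintro ⟨T', hT', r, hr, hrT⟩
      exact ⟨r, hr, hZ.satRec_mono hψ hu hT' r hrT⟩
  rw [h1, hqu, ← h2]
  constructor
  · rintro (h | ⟨s', hs', hq', h⟩)
    -- An entry about `φ` that existed before stage `φ` would come from some `y ∈ φ`, and `φ` would
    -- be `y` or of smaller rank than `y`.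
    · obtain ⟨y, b, hy, hb, hqb⟩ := (hu q).1 h
      rcases (hZ.satRec_coherent hb ⟨q, hq, hqb⟩).2 with rfl | h'
      · exact (hZ.mem_irrefl _ hy).elim
      · exact (hZ.mem_asymm h' (hZ.V_mem_V hy)).elim
    · obtain ⟨-, rfl⟩ := hZ.opair_inj hq hq'
      exact ⟨hs', h⟩
  · exact fun ⟨h, h'⟩ => .inr ⟨s, h, hq, h'⟩

theorem lsat_neg {U φ ψ s : M} (hs : A.mem s U) (h : IsNeg A.mem φ ψ) :
    LSat A U φ s ↔ ¬ LSat A U ψ s := by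
  rw [hZ.lsat_iff]
  constructor
  · rintro ⟨-, h' | h' | h' | h' | h' | h'⟩
    · obtain ⟨_, _, _, h', -⟩ := h'; exact absurd (hZ.neg_code h h') (by decide)
    · obtain ⟨_, _, _, _, h', -⟩ := h'; exact absurd (hZ.neg_code h h') (by decide)
    · obtain ⟨_, _, _, _, h', -⟩ := h'; exact absurd (hZ.neg_code h h') (by decide)
    · obtain ⟨ψ', h', h''⟩ := h'
      exact hZ.neg_inj h h' ▸ h''
    · obtain ⟨_, _, h', -⟩ := h'; exact absurd (hZ.neg_code h h') (by decide)
    · obtain ⟨_, _, _, _, h', -⟩ := h'; exact absurd (hZ.neg_code h h'.2) (by decide)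
  · exact fun h' => ⟨hs, .inr (.inr (.inr (.inl ⟨ψ, h, h'⟩)))⟩

/-- Negation is the only construction without two components, so a single case analysis serves all
the others. -/
theorem lsat_code {k : ℕ} (hk : k ≠ 3) {U φ a b s : M} (hs : A.mem s U) (h : IsCode A.mem k φ a b) :
    LSat A U φ s ↔ (k = 0 ∧ ∃ x, Val A.mem s a x ∧ Val A.mem s b x) ∨
      (k = 1 ∧ ∃ x y, Val A.mem s a x ∧ Val A.mem s b y ∧ A.mem x y) ∨
      (k = 2 ∧ ∃ x y, Val A.mem s a x ∧ Val A.mem s b y ∧ ∃ h : w = true, A.lt h x y) ∨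
      (k = 4 ∧ (LSat A U a s ∨ LSat A U b s)) ∨
      (k = 5 ∧ IsNat A.mem a ∧
        ∃ x s', A.mem x U ∧ IsUpd A.mem s a x s' ∧ LSat A U b s') := by
  rw [hZ.lsat_iff, and_iff_right hs]
  unfold SatStep
  refine or_congr ⟨?_, ?_⟩ (or_congr ⟨?_, ?_⟩ (or_congr ⟨?_, ?_⟩ (Iff.trans
    (or_iff_right ?_) (or_congr ⟨?_, ?_⟩ ⟨?_, ?_⟩))))
  · rintro ⟨t₁, t₂, x, h', h1⟩
    obtain ⟨rfl, rfl, rfl⟩ := hZ.code_inj h h'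
    exact ⟨rfl, x, h1⟩
  · rintro ⟨rfl, x, h1⟩
    exact ⟨a, b, x, h, h1⟩
  · rintro ⟨t₁, t₂, x, y, h', h1⟩
    obtain ⟨rfl, rfl, rfl⟩ := hZ.code_inj h h'
    exact ⟨rfl, x, y, h1⟩
  · rintro ⟨rfl, x, y, h1⟩
    exact ⟨a, b, x, y, h, h1⟩
  · rintro ⟨t₁, t₂, x, y, h', h1⟩
    obtain ⟨rfl, rfl, rfl⟩ := hZ.code_inj h h'
    exact ⟨rfl, x, y, h1⟩
  · rintro ⟨rfl, x, y, h1⟩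
    exact ⟨a, b, x, y, h, h1⟩
  · rintro ⟨ψ, h', h1⟩
    exact hk (hZ.neg_code h' h)
  · rintro ⟨t₁, t₂, h', h1⟩
    obtain ⟨rfl, rfl, rfl⟩ := hZ.code_inj h h'
    exact ⟨rfl, h1⟩
  · rintro ⟨rfl, h1⟩
    exact ⟨a, b, h, h1⟩
  · rintro ⟨n, ψ, x, s', h', h1⟩
    obtain ⟨rfl, rfl, rfl⟩ := hZ.code_inj h h'.2
    exact ⟨rfl, h'.1, x, s', h1⟩
  · rintro ⟨rfl, h0, x, s', h1⟩
    exact ⟨a, b, x, s', ⟨h0, h⟩, h1⟩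

theorem lsat_eq {U φ a b s : M} (hs : A.mem s U) (h : IsEqF A.mem φ a b) :
    LSat A U φ s ↔ ∃ x, Val A.mem s a x ∧ Val A.mem s b x := by
  simp [hZ.lsat_code (k := 0) (by decide) hs h]

theorem lsat_mem {U φ a b s : M} (hs : A.mem s U) (h : IsMemF A.mem φ a b) :
    LSat A U φ s ↔ ∃ x y, Val A.mem s a x ∧ Val A.mem s b y ∧ A.mem x y := by
  simp [hZ.lsat_code (k := 1) (by decide) hs h]

theorem lsat_lt {U φ a b s : M} (hs : A.mem s U) (h : IsLtF A.mem φ a b) :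
    LSat A U φ s ↔
      ∃ x y, Val A.mem s a x ∧ Val A.mem s b y ∧ ∃ h : w = true, A.lt h x y := by
  simp [hZ.lsat_code (k := 2) (by decide) hs h]

theorem lsat_or {U φ a b s : M} (hs : A.mem s U) (h : IsOr A.mem φ a b) :
    LSat A U φ s ↔ LSat A U a s ∨ LSat A U b s := by
  simp [hZ.lsat_code (k := 4) (by decide) hs h]

theorem lsat_ex {U φ n ψ s : M} (hs : A.mem s U) (h : IsEx A.mem φ n ψ) :
    LSat A U φ s ↔ ∃ x s', A.mem x U ∧ IsUpd A.mem s n x s' ∧ LSat A U ψ s' := by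
  simp [hZ.lsat_code (k := 5) (by decide) hs h.2, h.1]

/-- The truth value of an atomic formula depends only on the values of its terms. -/
theorem lsat_atomic {k : ℕ} (hk : IsRelTag w k) {U U' φ φ' a b a' b' s s' : M}
    (hs : A.mem s U) (hs' : A.mem s' U') (h : IsCode A.mem k φ a b)
    (h' : IsCode A.mem k φ' a' b') (ha : ∀ x, Val A.mem s a x ↔ Val A.mem s' a' x)
    (hb : ∀ x, Val A.mem s b x ↔ Val A.mem s' b' x) :
    LSat A U φ s ↔ LSat A U' φ' s' := by
  rcases hk with rfl | rfl | ⟨rfl, -⟩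
  · rw [hZ.lsat_eq hs h, hZ.lsat_eq hs' h']
    simp only [ha, hb]
  · rw [hZ.lsat_mem hs h, hZ.lsat_mem hs' h']
    simp only [ha, hb]
  · rw [hZ.lsat_lt hs h, hZ.lsat_lt hs' h']
    simp only [ha, hb]

end ModelsZF

end

/-! ### Ordinals -/

section

variable {M : Type u} {A : SetStr w M} {X : M → Prop}

namespace ModelsZF

variable (hZ : ModelsZF A X)
include hZ

theorem isOrd_iff {x : M} : IsOrd A.mem x ↔ (∀ y, A.mem y x → ∀ z, A.mem z y → A.mem z x) ∧
    ∀ a b, A.mem a x → A.mem b x → A.mem a b ∨ a = b ∨ A.mem b a := by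
  refine ⟨fun h => ⟨h.1, h.2.2.2.1⟩, fun ⟨h1, h2⟩ => ⟨h1, fun y _ => hZ.mem_irrefl y, ?_, h2, ?_⟩⟩
  · intro a b c ha _ hc hab hbc
    rcases h2 a c ha hc with h | rfl | h
    · exact h
    · exact (hZ.mem_asymm hab hbc).elim
    · exact (hZ.mem_asymm (hZ.V_mem_V h)
        (hZ.V_trans _ _ (hZ.V_mem_V hbc) _ (hZ.V_mem_V hab))).elim
  · intro s hs hne
    obtain ⟨m, hm, hmin⟩ := hZ.foundation s hne
    refine ⟨m, hm, fun y hy => ?_⟩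
    rcases h2 m y (hs m hm) (hs y hy) with h | rfl | h
    exacts [.inr h, .inl rfl, (hmin y h hy).elim]

theorem isOrd_mem {x y : M} (hx : IsOrd A.mem x) (hy : A.mem y x) : IsOrd A.mem y :=
  hZ.isOrd_iff.2 ⟨fun z hz t ht => hx.2.2.1 t z y (hx.1 z (hx.1 y hy z hz) t ht)
    (hx.1 y hy z hz) hy ht hz, fun a b ha hb => hx.2.2.2.1 a b (hx.1 y hy a ha) (hx.1 y hy b hb)⟩

theorem isOrd_trichotomy {x y : M} (hx : IsOrd A.mem x) (hy : IsOrd A.mem y) :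
    A.mem x y ∨ x = y ∨ A.mem y x := by
  refine hZ.mem_induction (fun x => IsOrd A.mem x → ∀ y, IsOrd A.mem y →
    A.mem x y ∨ x = y ∨ A.mem y x) ?_ x hx y hy
  clear hx hy x y
  intro x ihx hx
  refine hZ.mem_induction (fun y => IsOrd A.mem y → A.mem x y ∨ x = y ∨ A.mem y x) ?_
  intro y ihy hy
  by_contra! H
  refine H.2.1 (hZ.ext fun z => ⟨fun hz => ?_, fun hz => ?_⟩)
  · rcases ihx z hz (hZ.isOrd_mem hx hz) y hy with h | rfl | h
    exacts [h, (H.2.2 hz).elim, (H.2.2 (hx.1 z hz y h)).elim]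
  · rcases ihy z hz (hZ.isOrd_mem hy hz) with h | rfl | h
    exacts [(H.1 (hy.1 z hz x h)).elim, (H.1 hz).elim, h]

/-- Burali-Forti: otherwise the ordinals would form a set, and that set would be an ordinal. -/
theorem exists_isOrd_not_mem (u : M) : ∃ o, IsOrd A.mem o ∧ ¬ A.mem o u := by
  by_contra! H
  obtain ⟨o, ho⟩ := hZ.sep (fun x => IsOrd A.mem x) u
  have ho' : ∀ x, A.mem x o ↔ IsOrd A.mem x := fun x => (ho x).trans (and_iff_right_of_imp (H x))
  have : IsOrd A.mem o := hZ.isOrd_iff.2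
    ⟨fun y hy z hz => (ho' z).2 (hZ.isOrd_mem ((ho' y).1 hy) hz),
      fun a b ha hb => hZ.isOrd_trichotomy ((ho' a).1 ha) ((ho' b).1 hb)⟩
  exact hZ.mem_irrefl o ((ho' o).2 this)

theorem isOrd_succ {x y : M} (hx : IsOrd A.mem x) (h : IsSucc A.mem y x) : IsOrd A.mem y := by
  refine hZ.isOrd_iff.2 ⟨fun z hz t ht => (h t).2 (.inl ?_), fun a b ha hb => ?_⟩
  · rcases (h z).1 hz with hz | rfl
    exacts [hx.1 z hz t ht, ht]
  · have : ∀ a, A.mem a y → IsOrd A.mem a := by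
      intro a ha
      rcases (h a).1 ha with ha | rfl
      exacts [hZ.isOrd_mem hx ha, hx]
    exact hZ.isOrd_trichotomy (this a ha) (this b hb)

end ModelsZF

end

/-! ### Definability of syntactic notions -/

/-- `φ` is a `Σ_n`-formula. -/
def IsSig {M : Type u} (E : M → M → Prop) (w : Bool) (n φ : M) : Prop :=
  ∃ P Q, LevyWitness E w P Q ∧ PairIn E P n φ

/-- `φ` is a `Π_n`-formula. -/
def IsPi {M : Type u} (E : M → M → Prop) (w : Bool) (n φ : M) : Prop :=
  ∃ P Q, LevyWitness E w P Q ∧ PairIn E Q n φ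

section

variable {α : Type} {i j k l : α}

/-- The tag `k` ranges over metatheoretic numbers, not over the model; definability survives because
only the tags `0`, `1`, `2` occur, so the quantifier is a finite disjunction. -/
instance UDef.relTag₂
    {F : ℕ → ∀ (M : Type u) (_ : SetStr w M) (_ : M → Prop), (α → M) → M → M → Prop}
    [h : ∀ k, UDef p (fun M A X v => ∃ t₁ t₂, F k M A X v t₁ t₂)] :
    UDef p (fun M A X v => ∃ (k : ℕ) (t₁ t₂ : M), IsRelTag w k ∧ F k M A X v t₁ t₂) :=
  UDef.congr (G := fun M A X v => (∃ t₁ t₂, F 0 M A X v t₁ t₂) ∨ (∃ t₁ t₂, F 1 M A X v t₁ t₂) ∨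
    (w = true ∧ ∃ t₁ t₂, F 2 M A X v t₁ t₂)) fun M A X v => by
      rw [← exists_isRelTag (Q := fun k => ∃ t₁ t₂, F k M A X v t₁ t₂)]
      exact exists_congr fun k => ⟨fun ⟨a, b, h, h'⟩ => ⟨h, a, b, h'⟩,
        fun ⟨h, a, b, h'⟩ => ⟨a, b, h, h'⟩⟩

instance UDef.relTag₄
    {F : ℕ → ∀ (M : Type u) (_ : SetStr w M) (_ : M → Prop),
      (α → M) → M → M → M → M → Prop}
    [h : ∀ k, UDef p (fun M A X v => ∃ t₁ t₂ r₁ r₂, F k M A X v t₁ t₂ r₁ r₂)] :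
    UDef p (fun M A X v =>
      ∃ (k : ℕ) (t₁ t₂ r₁ r₂ : M), IsRelTag w k ∧ F k M A X v t₁ t₂ r₁ r₂) :=
  UDef.congr (G := fun M A X v => (∃ t₁ t₂ r₁ r₂, F 0 M A X v t₁ t₂ r₁ r₂) ∨
    (∃ t₁ t₂ r₁ r₂, F 1 M A X v t₁ t₂ r₁ r₂) ∨
    (w = true ∧ ∃ t₁ t₂ r₁ r₂, F 2 M A X v t₁ t₂ r₁ r₂)) fun M A X v => by
      rw [← exists_isRelTag (Q := fun k => ∃ t₁ t₂ r₁ r₂, F k M A X v t₁ t₂ r₁ r₂)]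
      exact exists_congr fun k => ⟨fun ⟨a, b, c, d, h, h'⟩ => ⟨h, a, b, c, d, h'⟩,
        fun ⟨h, a, b, c, d, h'⟩ => ⟨a, b, c, d, h, h'⟩⟩

instance : UDef.{u} (w := w) p (fun M A X v => IsDelta0 A.mem w (v i)) := by
  unfold IsDelta0; infer_instance

instance : UDef.{u} (w := w) p (fun M A X v => LevyWitness A.mem w (v i) (v j)) := by
  unfold LevyWitness; infer_instance

instance : UDef.{u} (w := w) p (fun M A X v => IsSig A.mem w (v i) (v j)) := by
  unfold IsSig; infer_instance

instance : UDef.{u} (w := w) p (fun M A X v => IsPi A.mem w (v i) (v j)) := by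
  unfold IsPi; infer_instance

set_option synthInstance.maxHeartbeats 200000 in
instance : UDef.{u} (w := w) p (fun M A X v => SubstWitness A.mem w (v i) (v j) (v k)) := by
  unfold SubstWitness; infer_instance

instance : UDef.{u} (w := w) p (fun M A X v => IsSubst A.mem w (v i) (v j) (v k) (v l)) := by
  unfold IsSubst; infer_instance

end

section

variable {M : Type u} {A : SetStr w M} {X : M → Prop} {α : Type} {s t r q : (α → M) → M}

instance [Tm s] : PDef A X (fun v => IsDelta0 A.mem w (s v)) :=
  UDef.pdef1 (fun _ A _ => IsDelta0 A.mem w)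

instance [Tm s] [Tm t] : PDef A X (fun v => IsSig A.mem w (s v) (t v)) :=
  UDef.pdef2 (fun _ A _ => IsSig A.mem w)

instance [Tm s] [Tm t] : PDef A X (fun v => IsPi A.mem w (s v) (t v)) :=
  UDef.pdef2 (fun _ A _ => IsPi A.mem w)

instance [Tm s] [Tm t] [Tm r] [Tm q] :
    PDef A X (fun v => IsSubst A.mem w (s v) (t v) (r v) (q v)) :=
  UDef.pdef4 (fun _ A _ => IsSubst A.mem w)

end

/-! ### Substitution -/

section

variable {M : Type u} {A : SetStr w M} {X : M → Prop}

/-- One step of the recursive definition of "`χ` results from `φ` by replacing the free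
occurrences of `v_n` by `c_x`". -/
def SubstStep (A : SetStr w M) (n x : M) (T : M → M → Prop) (φ χ : M) : Prop :=
  (∃ k t₁ t₂ r₁ r₂, IsRelTag w k ∧ IsCode A.mem k φ t₁ t₂ ∧ IsCode A.mem k χ r₁ r₂ ∧
    IsTermSubst A.mem n x t₁ r₁ ∧ IsTermSubst A.mem n x t₂ r₂) ∨
  (∃ φ₁ χ₁, IsNeg A.mem φ φ₁ ∧ IsNeg A.mem χ χ₁ ∧ T φ₁ χ₁) ∨
  (∃ φ₁ φ₂ χ₁ χ₂, IsOr A.mem φ φ₁ φ₂ ∧ IsOr A.mem χ χ₁ χ₂ ∧ T φ₁ χ₁ ∧ T φ₂ χ₂) ∨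
  (∃ φ₁, IsEx A.mem φ n φ₁ ∧ χ = φ) ∨
  (∃ m φ₁ χ₁, m ≠ n ∧ IsEx A.mem φ m φ₁ ∧ IsEx A.mem χ m χ₁ ∧ T φ₁ χ₁)

theorem SubstStep.mono {n x φ χ : M} {T T' : M → M → Prop} (hT : ∀ a b, T a b → T' a b)
    (h : SubstStep A n x T φ χ) : SubstStep A n x T' φ χ := by
  rcases h with h | ⟨a, b, h1, h2, h3⟩ | ⟨a, b, c, d, h1, h2, h3, h4⟩ | h |
    ⟨m, a, b, h1, h2, h3, h4⟩
  · exact .inl h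
  · exact .inr (.inl ⟨a, b, h1, h2, hT _ _ h3⟩)
  · exact .inr (.inr (.inl ⟨a, b, c, d, h1, h2, hT _ _ h3, hT _ _ h4⟩))
  · exact .inr (.inr (.inr (.inl h)))
  · exact .inr (.inr (.inr (.inr ⟨m, a, b, h1, h2, h3, hT _ _ h4⟩)))

namespace ModelsZF

variable (hZ : ModelsZF A X)
include hZ

theorem isSubst_of_step {n x φ χ R : M} (hR : SubstWitness A.mem w n x R)
    (h : SubstStep A n x (PairIn A.mem R) φ χ) : IsSubst A.mem w φ n x χ := by
  obtain ⟨q, hq⟩ := hZ.exists_opair φ χ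
  obtain ⟨R', hR'⟩ := hZ.exists_insert R q
  have hsub : ∀ a b, PairIn A.mem R a b → PairIn A.mem R' a b :=
    fun a b => Exists.imp fun r hr => ⟨hr.1, (hR' r).2 (.inl hr.2)⟩
  refine ⟨R', fun r hr => ?_, q, hq, (hR' q).2 (.inr rfl)⟩
  rcases (hR' r).1 hr with hr | rfl
  · obtain ⟨a, b, hab, h⟩ := hR r hr
    exact ⟨a, b, hab, SubstStep.mono hsub h⟩
  · exact ⟨φ, χ, hq, SubstStep.mono hsub h⟩

/-- The clauses of the recursive definition of substitution. -/
theorem isSubst_of {n x φ χ : M} (h : SubstStep A n x (fun φ χ => IsSubst A.mem w φ n x χ) φ χ) :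
    IsSubst A.mem w φ n x χ := by
  obtain ⟨e, he⟩ := hZ.exists_zero
  have hSe : SubstWitness A.mem w n x e := fun r hr => (he r hr).elim
  rcases h with h | ⟨a, b, h1, h2, R, hR, h3⟩ | ⟨a, b, c, d, h1, h2, ⟨R, hR, h3⟩, R', hR', h4⟩ | h |
      ⟨m, a, b, h1, h2, h3, R, hR, h4⟩
  · exact hZ.isSubst_of_step hSe (.inl h)
  · exact hZ.isSubst_of_step hR (.inr (.inl ⟨a, b, h1, h2, h3⟩))
  · obtain ⟨R₁, hR₁⟩ := hZ.exists_union R R'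
    have hs1 : ∀ a b, PairIn A.mem R a b → PairIn A.mem R₁ a b :=
      fun a b => Exists.imp fun r hr => ⟨hr.1, (hR₁ r).2 (.inl hr.2)⟩
    have hs2 : ∀ a b, PairIn A.mem R' a b → PairIn A.mem R₁ a b :=
      fun a b => Exists.imp fun r hr => ⟨hr.1, (hR₁ r).2 (.inr hr.2)⟩
    refine hZ.isSubst_of_step (R := R₁) (fun r hr => ?_)
      (.inr (.inr (.inl ⟨a, b, c, d, h1, h2, hs1 _ _ h3, hs2 _ _ h4⟩)))
    rcases (hR₁ r).1 hr with hr | hr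
    · obtain ⟨a, b, hab, h⟩ := hR r hr
      exact ⟨a, b, hab, SubstStep.mono hs1 h⟩
    · obtain ⟨a, b, hab, h⟩ := hR' r hr
      exact ⟨a, b, hab, SubstStep.mono hs2 h⟩
  · exact hZ.isSubst_of_step hSe (.inr (.inr (.inr (.inl h))))
  · exact hZ.isSubst_of_step hR (.inr (.inr (.inr (.inr ⟨m, a, b, h1, h2, h3, h4⟩))))

theorem exists_termSubst (n x t : M) : ∃ r, IsTermSubst A.mem n x t r := by
  by_cases h : IsVar A.mem t n
  · exact (hZ.exists_tagged 1 x).imp fun r hr => .inl ⟨h, hr⟩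
  · exact ⟨t, .inr ⟨h, rfl⟩⟩

/-- Substitution is defined only on genuine formulae, so the induction on rank follows a formation
derivation. -/
theorem exists_isSubst {W ψ r : M} (hW : FormWitness A.mem w W) (n x : M)
    (h : PairIn A.mem W ψ r) : ∃ χ, IsSubst A.mem w ψ n x χ := by
  have := @pdef_V_mem_V w M A X hZ
  refine hZ.rank_induction (fun ψ => ∀ r, PairIn A.mem W ψ r → ∃ χ, IsSubst A.mem w ψ n x χ)
    ?_ ψ r h
  rintro ψ ih r ⟨q, hq, hqW⟩
  obtain ⟨φ, s, hφs, H⟩ := hW q hqW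
  obtain ⟨rfl, rfl⟩ := hZ.opair_inj hq hφs
  rcases H with ⟨k, t₁, t₂, hk, hc, -, -⟩ | ⟨ψ', h1, h2⟩ | ⟨ψ₁, ψ₂, h1, h2, h3⟩ | ⟨m, ψ', s, h1, -, h2⟩
  · obtain ⟨r₁, hr₁⟩ := hZ.exists_termSubst n x t₁
    obtain ⟨r₂, hr₂⟩ := hZ.exists_termSubst n x t₂
    obtain ⟨χ, hχ⟩ := hZ.exists_code k r₁ r₂
    exact ⟨χ, hZ.isSubst_of (.inl ⟨k, t₁, t₂, r₁, r₂, hk, hc, hχ, hr₁, hr₂⟩)⟩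
  · obtain ⟨χ', hχ'⟩ := ih ψ' (hZ.transGen_V (hZ.neg_transGen h1)) _ h2
    obtain ⟨χ, hχ⟩ := hZ.exists_tagged 3 χ'
    exact ⟨χ, hZ.isSubst_of (.inr (.inl ⟨ψ', χ', h1, hχ, hχ'⟩))⟩
  · obtain ⟨χ₁, hχ₁⟩ := ih ψ₁ (hZ.transGen_V (hZ.code_transGen h1).1) _ h2
    obtain ⟨χ₂, hχ₂⟩ := ih ψ₂ (hZ.transGen_V (hZ.code_transGen h1).2) _ h3
    obtain ⟨χ, hχ⟩ := hZ.exists_code 4 χ₁ χ₂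
    exact ⟨χ, hZ.isSubst_of (.inr (.inr (.inl ⟨ψ₁, ψ₂, χ₁, χ₂, h1, hχ, hχ₁, hχ₂⟩)))⟩
  · by_cases hm : m = n
    · subst hm
      exact ⟨ψ, hZ.isSubst_of (.inr (.inr (.inr (.inl ⟨ψ', h1, rfl⟩))))⟩
    · obtain ⟨χ', hχ'⟩ := ih ψ' (hZ.transGen_V (hZ.code_transGen h1.2).2) _ h2
      obtain ⟨χ, hχ⟩ := hZ.exists_code 5 m χ'
      exact ⟨χ, hZ.isSubst_of (.inr (.inr (.inr (.inr ⟨m, ψ', χ', hm, h1, ⟨h1.1, hχ⟩, hχ'⟩))))⟩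

omit hZ in
theorem upd_upd_same {s n x y s' t : M} (h : IsUpd A.mem s n x s') :
    IsUpd A.mem s n y t ↔ IsUpd A.mem s' n y t := by
  refine forall_congr' fun q => iff_congr Iff.rfl (or_congr_left ?_)
  rw [h q]
  constructor
  · exact fun h => ⟨.inl h, h.2⟩
  · rintro ⟨h | h, h'⟩
    exacts [h, (h' ⟨x, h⟩).elim]

theorem upd_comm {s n m x y s₁ s₂ t : M} (hmn : m ≠ n) (h₁ : IsUpd A.mem s n x s₁)
    (h₂ : IsUpd A.mem s m y s₂) (h : IsUpd A.mem s₁ m y t) : IsUpd A.mem s₂ n x t := by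
  intro q
  rw [h q, h₁ q, h₂ q]
  have key : ∀ a b, IsOPair A.mem q n a → IsOPair A.mem q m b → False :=
    fun a b ha hb => hmn (hZ.opair_inj hb ha).1
  constructor
  · rintro (⟨⟨h1, h2⟩ | h1, h3⟩ | h1)
    · exact .inl ⟨.inl ⟨h1, h3⟩, h2⟩
    · exact .inr h1
    · exact .inl ⟨.inr h1, fun ⟨a, ha⟩ => key a y ha h1⟩
  · rintro (⟨⟨h1, h2⟩ | h1, h3⟩ | h1)
    · exact .inl ⟨.inl ⟨h1, h3⟩, h2⟩
    · exact .inr h1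
    · exact .inl ⟨.inr h1, fun ⟨a, ha⟩ => key x a h1 ha⟩

/-- By induction on rank: replacing `v_n` by `c_x` has the effect of resetting the assignment at `n`
to `x`. Since `ψ ∈ U`, the indices of its quantified variables are in `U`, and a limit level then
contains the updated assignments. -/
theorem lsat_subst {U n x ψ χ s s' : M} (hU : Lim A.mem U) (hχ : IsSubst A.mem w ψ n x χ)
    (hψ : A.mem ψ U) (hs : A.mem s U) (hs' : A.mem s' U) (h : IsUpd A.mem s n x s') :
    LSat A U χ s ↔ LSat A U ψ s' := by
  have := @pdef_V_mem_V w M A X hZ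
  obtain ⟨R, hR, hψχ⟩ := hχ
  refine hZ.rank_induction (fun ψ => ∀ χ s s', PairIn A.mem R ψ χ → A.mem ψ U → A.mem s U →
    A.mem s' U → IsUpd A.mem s n x s' → (LSat A U χ s ↔ LSat A U ψ s')) ?_ ψ χ s s' hψχ hψ hs hs' h
  clear hψχ hψ hs hs' h ψ χ s s'
  rintro ψ ih χ s s' ⟨q, hq, hqR⟩ hψ hs hs' h
  obtain ⟨φ, χ', hφ, H⟩ := hR q hqR
  obtain ⟨rfl, rfl⟩ := hZ.opair_inj hq hφ
  rcases H with ⟨k, t₁, t₂, r₁, r₂, hk, hc, hc', h1, h2⟩ | ⟨ψ', χ', h1, h2, h3⟩ |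
    ⟨ψ₁, ψ₂, χ₁, χ₂, h1, h2, h3, h4⟩ | ⟨ψ', h1, rfl⟩ | ⟨m, ψ', χ', h1, h2, h3, h4⟩
  · exact hZ.lsat_atomic hk hs hs' hc' hc (fun y => hZ.val_subst h h1)
      (fun y => hZ.val_subst h h2)
  · have hT := hZ.neg_transGen h1
    rw [hZ.lsat_neg hs h2, hZ.lsat_neg hs' h1,
      ih ψ' (hZ.transGen_V hT) χ' s s' h3 (hZ.transGen_mem hU.1 hT hψ) hs hs' h]
  · have hT := hZ.code_transGen h1
    rw [hZ.lsat_or hs h2, hZ.lsat_or hs' h1,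
      ih ψ₁ (hZ.transGen_V hT.1) χ₁ s s' h3 (hZ.transGen_mem hU.1 hT.1 hψ) hs hs' h,
      ih ψ₂ (hZ.transGen_V hT.2) χ₂ s s' h4 (hZ.transGen_mem hU.1 hT.2 hψ) hs hs' h]
  -- Here `v_n` itself is quantified: nothing is replaced, and the quantifier overwrites the value
  -- at `n`.
  · rw [hZ.lsat_ex hs h1, hZ.lsat_ex hs' h1]
    exact exists_congr fun y => exists_congr fun t => and_congr_right fun _ =>
      and_congr_left fun _ => upd_upd_same h
  · have hT := hZ.code_transGen h2.2
    have hm := hZ.transGen_mem hU.1 hT.1 hψ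
    have hψ' := hZ.transGen_mem hU.1 hT.2 hψ
    rw [hZ.lsat_ex hs h3, hZ.lsat_ex hs' h2]
    constructor
    · rintro ⟨y, t, hy, ht, hsat⟩
      obtain ⟨t', ht'⟩ := hZ.exists_upd s' m y
      exact ⟨y, t', hy, ht', (ih ψ' (hZ.transGen_V hT.2) χ' t t' h4 hψ' (hZ.lim_upd hU hs hm hy ht)
        (hZ.lim_upd hU hs' hm hy ht') (hZ.upd_comm h1 h ht ht')).1 hsat⟩
    · rintro ⟨y, t', hy, ht', hsat⟩
      obtain ⟨t, ht⟩ := hZ.exists_upd s m y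
      exact ⟨y, t, hy, ht, (ih ψ' (hZ.transGen_V hT.2) χ' t t' h4 hψ' (hZ.lim_upd hU hs hm hy ht)
        (hZ.lim_upd hU hs' hm hy ht') (hZ.upd_comm h1 h ht ht')).2 hsat⟩

end ModelsZF

end

section

variable {M : Type u} {A : SetStr w M} {X : M → Prop}

/-! ### Formulae of the Levy hierarchy -/

/-- `ψ` is an immediate subformula of `φ`. -/
def IsSub (E : M → M → Prop) (φ ψ : M) : Prop :=
  IsNeg E φ ψ ∨ (∃ χ, IsOr E φ ψ χ ∨ IsOr E φ χ ψ) ∨ ∃ n, IsEx E φ n ψ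

/-- `φ` belongs to the Levy hierarchy at a standard place. -/
def StdLevy (A : SetStr w M) (φ : M) : Prop :=
  IsDelta0 A.mem w φ ∨
    ∃ (k : ℕ) (n : M), IsNum A.mem k n ∧ (IsSig A.mem w n φ ∨ IsPi A.mem w n φ)

theorem IsDelta0.cases {φ : M} (h : IsDelta0 A.mem w φ) :
    (∃ k t₁ t₂, IsRelTag w k ∧ IsCode A.mem k φ t₁ t₂ ∧ IsTerm A.mem t₁ ∧ IsTerm A.mem t₂) ∨
    (∃ ψ, IsNeg A.mem φ ψ ∧ IsDelta0 A.mem w ψ) ∨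
    (∃ ψ₁ ψ₂, IsOr A.mem φ ψ₁ ψ₂ ∧ IsDelta0 A.mem w ψ₁ ∧ IsDelta0 A.mem w ψ₂) ∨
    (∃ θ, IsBddEx A.mem φ θ ∧ IsDelta0 A.mem w θ) := by
  obtain ⟨W, hφ, hW⟩ := h
  rcases hW φ hφ with h | ⟨ψ, h, h'⟩ | ⟨ψ₁, ψ₂, h, h', h''⟩ | ⟨θ, h, h'⟩
  · exact .inl h
  · exact .inr (.inl ⟨ψ, h, W, h', hW⟩)
  · exact .inr (.inr (.inl ⟨ψ₁, ψ₂, h, ⟨W, h', hW⟩, W, h'', hW⟩))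
  · exact .inr (.inr (.inr ⟨θ, h, W, h', hW⟩))

theorem IsSig.cases {n φ : M} (h : IsSig A.mem w n φ) (hZ : ModelsZF A X) :
    IsDelta0 A.mem w φ ∨ (∃ ψ, IsNeg A.mem φ ψ ∧ IsPi A.mem w n ψ) ∨
    (∃ ψ₁ ψ₂, IsOr A.mem φ ψ₁ ψ₂ ∧ IsSig A.mem w n ψ₁ ∧ IsSig A.mem w n ψ₂) ∨
    (∃ v ψ, IsEx A.mem φ v ψ ∧ IsSig A.mem w n ψ) ∨
    (∃ m, IsSucc A.mem n m ∧ IsPi A.mem w m φ) := by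
  obtain ⟨P, Q, hPQ, q, hq, hqP⟩ := h
  obtain ⟨n', φ', -, hq', H⟩ := hPQ.1 q hqP
  obtain ⟨rfl, rfl⟩ := hZ.opair_inj hq hq'
  rcases H with h | ⟨ψ, h, h'⟩ | ⟨ψ₁, ψ₂, h, h', h''⟩ | ⟨m, v, ψ, -, h, h'⟩ | ⟨m, h, h'⟩
  · exact .inl h
  · exact .inr (.inl ⟨ψ, h, P, Q, hPQ, h'⟩)
  · exact .inr (.inr (.inl ⟨ψ₁, ψ₂, h, ⟨P, Q, hPQ, h'⟩, P, Q, hPQ, h''⟩))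
  · exact .inr (.inr (.inr (.inl ⟨v, ψ, h, P, Q, hPQ, h'⟩)))
  · exact .inr (.inr (.inr (.inr ⟨m, h, P, Q, hPQ, h'⟩)))

theorem IsPi.cases {n φ : M} (h : IsPi A.mem w n φ) (hZ : ModelsZF A X) :
    IsDelta0 A.mem w φ ∨ (∃ ψ, IsNeg A.mem φ ψ ∧ IsSig A.mem w n ψ) ∨
    (∃ ψ₁ ψ₂, IsOr A.mem φ ψ₁ ψ₂ ∧ IsPi A.mem w n ψ₁ ∧ IsPi A.mem w n ψ₂) ∨
    (∃ m, IsSucc A.mem n m ∧ IsSig A.mem w m φ) := by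
  obtain ⟨P, Q, hPQ, q, hq, hqP⟩ := h
  obtain ⟨n', φ', -, hq', H⟩ := hPQ.2 q hqP
  obtain ⟨rfl, rfl⟩ := hZ.opair_inj hq hq'
  rcases H with h | ⟨ψ, h, h'⟩ | ⟨ψ₁, ψ₂, h, h', h''⟩ | ⟨m, h, h'⟩
  · exact .inl h
  · exact .inr (.inl ⟨ψ, h, P, Q, hPQ, h'⟩)
  · exact .inr (.inr (.inl ⟨ψ₁, ψ₂, h, ⟨P, Q, hPQ, h'⟩, P, Q, hPQ, h''⟩))
  · exact .inr (.inr (.inr ⟨m, h, P, Q, hPQ, h'⟩))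

namespace ModelsZF

variable (hZ : ModelsZF A X)
include hZ

/-- The `Σ₀`-formulae in the level `V φ`, together with `φ`, form a witness. -/
theorem isDelta0_of {φ : M}
    (h : (∃ k t₁ t₂, IsRelTag w k ∧ IsCode A.mem k φ t₁ t₂ ∧ IsTerm A.mem t₁ ∧ IsTerm A.mem t₂) ∨
      (∃ ψ, IsNeg A.mem φ ψ ∧ IsDelta0 A.mem w ψ) ∨
      (∃ ψ₁ ψ₂, IsOr A.mem φ ψ₁ ψ₂ ∧ IsDelta0 A.mem w ψ₁ ∧ IsDelta0 A.mem w ψ₂)) :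
    IsDelta0 A.mem w φ := by
  obtain ⟨V, hV⟩ := hZ.sep (fun χ => IsDelta0 A.mem w χ) (hZ.V φ)
  obtain ⟨W, hW⟩ := hZ.exists_insert V φ
  have key : ∀ ψ, TransGen A.mem ψ φ → IsDelta0 A.mem w ψ → A.mem ψ W := by
    intro ψ hψ h
    refine (hW ψ).2 (.inl ((hV ψ).2 ⟨?_, h⟩))
    exact hZ.lev_super (hZ.lev_V φ) (hZ.transGen_V hψ) (hZ.sub_V ψ)
  have key' : ∀ χ, A.mem χ V → ∀ ψ, TransGen A.mem ψ χ → IsDelta0 A.mem w ψ → A.mem ψ W :=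
    fun χ hχ ψ hψ h => (hW ψ).2 (.inl ((hV ψ).2
      ⟨hZ.transGen_mem (hZ.lev_V φ) hψ ((hV χ).1 hχ).1, h⟩))
  refine ⟨W, (hW φ).2 (.inr rfl), fun χ hχ => ?_⟩
  rcases (hW χ).1 hχ with hχ | rfl
  · rcases ((hV χ).1 hχ).2.cases with h | ⟨ψ, h, h'⟩ | ⟨ψ₁, ψ₂, h, h', h''⟩ | ⟨θ, h, h'⟩
    · exact .inl h
    · exact .inr (.inl ⟨ψ, h, key' χ hχ ψ (hZ.neg_transGen h) h'⟩)
    · exact .inr (.inr (.inl ⟨ψ₁, ψ₂, h, key' χ hχ _ (hZ.code_transGen h).1 h',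
        key' χ hχ _ (hZ.code_transGen h).2 h''⟩))
    · refine .inr (.inr (.inr ⟨θ, h, key' χ hχ _ ?_ h'⟩))
      obtain ⟨n, t, v, a, b, d, e, -, -, -, -, -, h1, h2, h3⟩ := h
      exact (hZ.code_transGen h1).2.trans
        ((hZ.neg_transGen h2).trans (hZ.code_transGen h3.2).2)
  · rcases h with h | ⟨ψ, h, h'⟩ | ⟨ψ₁, ψ₂, h, h', h''⟩
    · exact .inl h
    · exact .inr (.inl ⟨ψ, h, key ψ (hZ.neg_transGen h) h'⟩)
    · exact .inr (.inr (.inl ⟨ψ₁, ψ₂, h, key _ (hZ.code_transGen h).1 h',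
        key _ (hZ.code_transGen h).2 h''⟩))

theorem isSub_neg {φ ψ χ : M} (h : IsNeg A.mem φ ψ) (h' : IsSub A.mem φ χ) : χ = ψ := by
  rcases h' with h' | ⟨a, h' | h'⟩ | ⟨n, h'⟩
  · exact hZ.neg_inj h' h
  · exact absurd (hZ.neg_code h h') (by decide)
  · exact absurd (hZ.neg_code h h') (by decide)
  · exact absurd (hZ.neg_code h h'.2) (by decide)

theorem isSub_code {k : ℕ} (hk : k ≠ 3) {φ a b χ : M} (h : IsCode A.mem k φ a b)
    (h' : IsSub A.mem φ χ) : (k = 4 ∧ (χ = a ∨ χ = b)) ∨ (k = 5 ∧ χ = b) := by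
  rcases h' with h' | ⟨c, h' | h'⟩ | ⟨n, h'⟩
  · exact absurd (hZ.neg_code h' h) hk
  · obtain ⟨rfl, rfl, rfl⟩ := hZ.code_inj h h'
    exact .inl ⟨rfl, .inl rfl⟩
  · obtain ⟨rfl, rfl, rfl⟩ := hZ.code_inj h h'
    exact .inl ⟨rfl, .inr rfl⟩
  · obtain ⟨rfl, rfl, rfl⟩ := hZ.code_inj h h'.2
    exact .inr ⟨rfl, rfl⟩

theorem isSub_or {φ a b χ : M} (h : IsOr A.mem φ a b) (h' : IsSub A.mem φ χ) : χ = a ∨ χ = b := by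
  simpa using hZ.isSub_code (k := 4) (by decide) h h'

theorem isSub_ex {φ n ψ χ : M} (h : IsEx A.mem φ n ψ) (h' : IsSub A.mem φ χ) : χ = ψ := by
  simpa using hZ.isSub_code (k := 5) (by decide) h.2 h'

theorem isDelta0_isSub {φ χ : M} (h : IsDelta0 A.mem w φ) (hχ : IsSub A.mem φ χ) :
    IsDelta0 A.mem w χ := by
  rcases h.cases with ⟨k, t₁, t₂, hk, h, -⟩ | ⟨ψ, h, h'⟩ | ⟨ψ₁, ψ₂, h, h', h''⟩ | ⟨θ, h, h'⟩
  · rcases hk with rfl | rfl | ⟨rfl, -⟩ <;>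
      exact absurd (hZ.isSub_code (by decide) h hχ) (by simp)
  · exact hZ.isSub_neg h hχ ▸ h'
  · rcases hZ.isSub_or h hχ with rfl | rfl
    exacts [h', h'']
  · obtain ⟨n, t, v, a, b, d, e, h1, h2, h3, h4, h5, h6, h7, h8⟩ := h
    obtain rfl := hZ.isSub_ex h8 hχ
    -- The definition treats bounded quantification as one step, so the matrix `¬(¬(v_n ∈ t) ∨ θ)`
    -- has to be rebuilt as a `Σ₀`-formula.
    exact hZ.isDelta0_of (.inr (.inl ⟨d, h7, hZ.isDelta0_of (.inr (.inr ⟨b, θ, h6,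
      hZ.isDelta0_of (.inr (.inl ⟨a, h5, hZ.isDelta0_of
        (.inl ⟨1, v, t, .inr (.inl rfl), h4, .inl ⟨n, h1⟩, h2⟩)⟩)), h'⟩))⟩))

/-- Negation swaps `Σ` and `Π` and inclusion lowers the index, so neither a fixed class nor a fixed
index is tracked. The induction is on the metatheoretic index. -/
theorem stdLevy_isSub {φ χ : M} (h : StdLevy A φ) (hχ : IsSub A.mem φ χ) : StdLevy A χ := by
  rcases h with h | ⟨k, n, hn, h⟩
  · exact .inl (hZ.isDelta0_isSub h hχ)
  induction k generalizing n with
  | zero =>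
    rcases h with h | h
    · rcases h.cases hZ with h | ⟨ψ, h, h'⟩ | ⟨ψ₁, ψ₂, h, h', h''⟩ | ⟨v, ψ, h, h'⟩ | ⟨m, h, h'⟩
      · exact .inl (hZ.isDelta0_isSub h hχ)
      · exact hZ.isSub_neg h hχ ▸ .inr ⟨0, n, hn, .inr h'⟩
      · rcases hZ.isSub_or h hχ with rfl | rfl
        exacts [.inr ⟨0, n, hn, .inl h'⟩, .inr ⟨0, n, hn, .inl h''⟩]
      · exact hZ.isSub_ex h hχ ▸ .inr ⟨0, n, hn, .inl h'⟩
      · exact (succ_ne_zero h hn).elim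
    · rcases h.cases hZ with h | ⟨ψ, h, h'⟩ | ⟨ψ₁, ψ₂, h, h', h''⟩ | ⟨m, h, h'⟩
      · exact .inl (hZ.isDelta0_isSub h hχ)
      · exact hZ.isSub_neg h hχ ▸ .inr ⟨0, n, hn, .inl h'⟩
      · rcases hZ.isSub_or h hχ with rfl | rfl
        exacts [.inr ⟨0, n, hn, .inr h'⟩, .inr ⟨0, n, hn, .inr h''⟩]
      · exact (succ_ne_zero h hn).elim
  | succ k ih =>
    have hn' := hn
    obtain ⟨n', hn'', hnn'⟩ := hn
    rcases h with h | h
    · rcases h.cases hZ with h | ⟨ψ, h, h'⟩ | ⟨ψ₁, ψ₂, h, h', h''⟩ | ⟨v, ψ, h, h'⟩ | ⟨m, h, h'⟩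
      · exact .inl (hZ.isDelta0_isSub h hχ)
      · exact hZ.isSub_neg h hχ ▸ .inr ⟨k + 1, n, hn', .inr h'⟩
      · rcases hZ.isSub_or h hχ with rfl | rfl
        exacts [.inr ⟨k + 1, n, hn', .inl h'⟩, .inr ⟨k + 1, n, hn', .inl h''⟩]
      · exact hZ.isSub_ex h hχ ▸ .inr ⟨k + 1, n, hn', .inl h'⟩
      · obtain rfl := hZ.succ_inj hnn' h
        exact ih n' hn'' (.inr h')
    · rcases h.cases hZ with h | ⟨ψ, h, h'⟩ | ⟨ψ₁, ψ₂, h, h', h''⟩ | ⟨m, h, h'⟩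
      · exact .inl (hZ.isDelta0_isSub h hχ)
      · exact hZ.isSub_neg h hχ ▸ .inr ⟨k + 1, n, hn', .inl h'⟩
      · rcases hZ.isSub_or h hχ with rfl | rfl
        exacts [.inr ⟨k + 1, n, hn', .inr h'⟩, .inr ⟨k + 1, n, hn', .inr h''⟩]
      · obtain rfl := hZ.succ_inj hnn' h
        exact ih n' hn'' (.inl h')

/-! ### Absoluteness -/

/-- Bounded quantifiers range over elements of values of terms; those values lie in `U`, which is
transitive. -/
theorem lsat_delta0 {U U' φ s : M} (hU : Lim A.mem U) (hU' : Lim A.mem U')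
    (hsub : Sub A.mem U U') (h : IsDelta0 A.mem w φ) (hφ : A.mem φ U) (hs : A.mem s U) :
    LSat A U φ s ↔ LSat A U' φ s := by
  have := @pdef_V_mem_V w M A X hZ
  refine hZ.rank_induction (fun φ => IsDelta0 A.mem w φ → A.mem φ U → ∀ s, A.mem s U →
    (LSat A U φ s ↔ LSat A U' φ s)) ?_ φ h hφ s hs
  clear h hφ hs φ s
  intro φ ih h hφ s hs
  rcases h.cases with ⟨k, t₁, t₂, hk, h, -⟩ | ⟨ψ, h, h'⟩ | ⟨ψ₁, ψ₂, h, h', h''⟩ | ⟨θ, h, h'⟩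
  · exact hZ.lsat_atomic hk hs (hsub s hs) h h (fun _ => Iff.rfl) fun _ => Iff.rfl
  · have hT := hZ.neg_transGen h
    rw [hZ.lsat_neg hs h, hZ.lsat_neg (hsub s hs) h,
      ih ψ (hZ.transGen_V hT) h' (hZ.transGen_mem hU.1 hT hφ) s hs]
  · have hT := hZ.code_transGen h
    rw [hZ.lsat_or hs h, hZ.lsat_or (hsub s hs) h,
      ih ψ₁ (hZ.transGen_V hT.1) h' (hZ.transGen_mem hU.1 hT.1 hφ) s hs,
      ih ψ₂ (hZ.transGen_V hT.2) h'' (hZ.transGen_mem hU.1 hT.2 hφ) s hs]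
  · obtain ⟨n, t, v, a, b, d, e, hv, ht, htn, ha, hb, hd, he, hφe⟩ := h
    have hTe := (hZ.code_transGen hφe.2).2
    have hTd := (hZ.neg_transGen he).trans hTe
    have hTb := (hZ.code_transGen hd).1.trans hTd
    have hTθ := (hZ.code_transGen hd).2.trans hTd
    have hTa := (hZ.neg_transGen hb).trans hTb
    have hTt := (hZ.code_transGen ha).2.trans hTa
    have hn := hZ.transGen_mem hU.1 (hZ.code_transGen hφe.2).1 hφ
    have expand : ∀ U s', A.mem s' U →
        (LSat A U e s' ↔ LSat A U a s' ∧ ¬ LSat A U θ s') := by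
      intro U s' hs'
      rw [hZ.lsat_neg hs' he, hZ.lsat_or hs' hd, hZ.lsat_neg hs' hb]
      tauto
    rw [hZ.lsat_ex hs hφe, hZ.lsat_ex (hsub s hs) hφe]
    refine exists_congr fun x => exists_congr fun s' => ?_
    have key : A.mem x U → IsUpd A.mem s n x s' → (LSat A U e s' ↔ LSat A U' e s') := by
      intro hx hs'
      have hs'U := hZ.lim_upd hU hs hn hx hs'
      rw [expand U s' hs'U, expand U' s' (hsub s' hs'U),
        ih θ (hZ.transGen_V hTθ) h' (hZ.transGen_mem hU.1 hTθ hφ) s' hs'U,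
        hZ.lsat_mem hs'U ha, hZ.lsat_mem (hsub s' hs'U) ha]
    constructor
    · exact fun ⟨h1, h2, h3⟩ => ⟨hsub x h1, h2, (key h1 h2).1 h3⟩
    · rintro ⟨h1, h2, h3⟩
      have hs'U := hZ.lim_upd hU' (hsub s hs) (hsub n hn) h1 h2
      obtain ⟨x', y, hx', hy, hxy⟩ := (hZ.lsat_mem hs'U ha).1 ((expand U' s' hs'U).1 h3).1
      rw [hZ.val_var hv, hZ.pairIn_upd h2] at hx'
      obtain rfl : x' = x := by simpa using hx'
      -- The value of the bound `t` comes from a constant in `φ ∈ U`, or from `s ∈ U`, as `t` is not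
      -- the updated variable.
      have hyU : A.mem y U := by
        rcases ht with ⟨m, hm⟩ | ⟨c, hc⟩
        · rw [hZ.val_var hm, hZ.pairIn_upd h2] at hy
          have hmn : m ≠ n := fun h => htn (h ▸ hm)
          obtain ⟨q, hq, hqs⟩ : PairIn A.mem s m y := by simpa [hmn] using hy
          exact hZ.transGen_mem hU.1 (hZ.opair_transGen hq).2 (hZ.lev_trans hU.1 hs hqs)
        · rw [hZ.val_const hc] at hy
          exact hy ▸ hZ.transGen_mem hU.1 ((hZ.tagged_transGen (k := 1) hc).trans hTt) hφ
      have hxU := hZ.lev_trans hU.1 hyU hxy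
      exact ⟨hxU, h2, (key hxU h2).2 h3⟩

/-- If `Σ_m`- and `Π_m`-formulae are absolute between `U ⊆ U'`, then `Σ_{m+1}`-formulae go up and
`Π_{m+1}`-formulae go down. -/
theorem lsat_levy {U U' n φ : M} (hU : Lim A.mem U) (hU' : Lim A.mem U')
    (hsub : Sub A.mem U U')
    (habs : ∀ m, IsSucc A.mem n m → ∀ ψ s, A.mem ψ U → A.mem s U →
      IsSig A.mem w m ψ ∨ IsPi A.mem w m ψ → (LSat A U ψ s ↔ LSat A U' ψ s))
    (hφ : A.mem φ U) :
    (IsSig A.mem w n φ → ∀ s, A.mem s U → LSat A U φ s → LSat A U' φ s) ∧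
    (IsPi A.mem w n φ → ∀ s, A.mem s U → LSat A U' φ s → LSat A U φ s) := by
  have := @pdef_V_mem_V w M A X hZ
  refine hZ.rank_induction (fun φ => A.mem φ U →
    (IsSig A.mem w n φ → ∀ s, A.mem s U → LSat A U φ s → LSat A U' φ s) ∧
    (IsPi A.mem w n φ → ∀ s, A.mem s U → LSat A U' φ s → LSat A U φ s)) ?_ φ hφ
  clear hφ φ
  intro φ ih hφ
  constructor
  · intro h s hs hsat
    rcases h.cases hZ with h | ⟨ψ, h, h'⟩ | ⟨ψ₁, ψ₂, h, h', h''⟩ | ⟨v, ψ, h, h'⟩ | ⟨m, h, h'⟩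
    · exact (hZ.lsat_delta0 hU hU' hsub h hφ hs).1 hsat
    · have hT := hZ.neg_transGen h
      rw [hZ.lsat_neg hs h] at hsat
      rw [hZ.lsat_neg (hsub s hs) h]
      exact fun h => hsat ((ih ψ (hZ.transGen_V hT) (hZ.transGen_mem hU.1 hT hφ)).2 h' s hs h)
    · have hT := hZ.code_transGen h
      rw [hZ.lsat_or hs h] at hsat
      rw [hZ.lsat_or (hsub s hs) h]
      exact hsat.imp
        ((ih ψ₁ (hZ.transGen_V hT.1) (hZ.transGen_mem hU.1 hT.1 hφ)).1 h' s hs)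
        ((ih ψ₂ (hZ.transGen_V hT.2) (hZ.transGen_mem hU.1 hT.2 hφ)).1 h'' s hs)
    · have hT := hZ.code_transGen h.2
      rw [hZ.lsat_ex hs h] at hsat
      rw [hZ.lsat_ex (hsub s hs) h]
      obtain ⟨x, s', hx, hs', hsat⟩ := hsat
      have hs'U := hZ.lim_upd hU hs (hZ.transGen_mem hU.1 hT.1 hφ) hx hs'
      exact ⟨x, s', hsub x hx, hs',
        (ih ψ (hZ.transGen_V hT.2) (hZ.transGen_mem hU.1 hT.2 hφ)).1 h' s' hs'U hsat⟩
    · exact (habs m h φ s hφ hs (.inr h')).1 hsat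
  · intro h s hs hsat
    rcases h.cases hZ with h | ⟨ψ, h, h'⟩ | ⟨ψ₁, ψ₂, h, h', h''⟩ | ⟨m, h, h'⟩
    · exact (hZ.lsat_delta0 hU hU' hsub h hφ hs).2 hsat
    · have hT := hZ.neg_transGen h
      rw [hZ.lsat_neg (hsub s hs) h] at hsat
      rw [hZ.lsat_neg hs h]
      exact fun h => hsat ((ih ψ (hZ.transGen_V hT) (hZ.transGen_mem hU.1 hT hφ)).1 h' s hs h)
    · have hT := hZ.code_transGen h
      rw [hZ.lsat_or (hsub s hs) h] at hsat
      rw [hZ.lsat_or hs h]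
      exact hsat.imp
        ((ih ψ₁ (hZ.transGen_V hT.1) (hZ.transGen_mem hU.1 hT.1 hφ)).2 h' s hs)
        ((ih ψ₂ (hZ.transGen_V hT.2) (hZ.transGen_mem hU.1 hT.2 hφ)).2 h'' s hs)
    · exact (habs m h φ s hφ hs (.inl h')).2 hsat

end ModelsZF

/-! ### Reflecting levels -/

/-- The limit levels `U` such that `Σ_j`-formulae, for `j < k`, are absolute between `U` and the
larger levels of this kind. -/
def Ref (A : SetStr w M) : ℕ → M → Prop
  | 0, U => Lim A.mem U
  | k + 1, U => Ref A k U ∧ ∀ U', Ref A k U' → Sub A.mem U U' → ∀ n, IsNum A.mem k n →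
      ∀ ψ s, A.mem ψ U → A.mem s U → IsSig A.mem w n ψ ∨ IsPi A.mem w n ψ →
        (LSat A U ψ s ↔ LSat A U' ψ s)

theorem UDef.ref (k : ℕ) : ∀ {α : Type} (i : α),
    UDef.{u} (w := w) p (fun M A X v => Ref A k (v i)) := by
  induction k with
  | zero => intro α i; unfold Ref; infer_instance
  | succ k ih => intro α i; unfold Ref; infer_instance

instance {k : ℕ} {α : Type} {i : α} : UDef.{u} (w := w) p (fun M A X v => Ref A k (v i)) :=
  UDef.ref k i

instance {k : ℕ} {α : Type} {s : (α → M) → M} [Tm s] : PDef A X (fun v => Ref A k (s v)) :=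
  UDef.pdef1 (fun _ A _ => Ref A k)

theorem Ref.lim {k : ℕ} {U : M} (h : Ref A k U) : Lim A.mem U := by
  induction k with
  | zero => exact h
  | succ k ih => exact ih h.1

namespace ModelsZF

variable (hZ : ModelsZF A X)
include hZ

/-- Membership in `Ref A k` provides absoluteness below `k`, which gives persistence in one
direction at `k` itself. -/
theorem ref_levy {k : ℕ} {U U' n φ : M} (hU : Ref A k U) (hU' : Ref A k U')
    (hsub : Sub A.mem U U') (hn : IsNum A.mem k n) (hφ : A.mem φ U) :
    (IsSig A.mem w n φ → ∀ s, A.mem s U → LSat A U φ s → LSat A U' φ s) ∧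
    (IsPi A.mem w n φ → ∀ s, A.mem s U → LSat A U' φ s → LSat A U φ s) := by
  refine hZ.lsat_levy hU.lim hU'.lim hsub ?_ hφ
  intro m hm
  cases k with
  | zero => exact (succ_ne_zero hm hn).elim
  | succ k =>
    obtain ⟨m', hm', hnm'⟩ := hn
    obtain rfl := hZ.succ_inj hm hnm'
    exact hU.2 U' hU'.1 hsub m hm'

/-- A formula and an assignment in `U` already lie in some `Ref` level `y ∈ U`; comparing `y` with
`U` and `y` with `U'` compares `U` with `U'`. -/
theorem ref_closed {k : ℕ} {U : M} (hU : Lev A.mem U) (hne : ∃ x, A.mem x U)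
    (h : ∀ x, A.mem x U → ∃ y, A.mem y U ∧ Ref A k y ∧ A.mem x y) : Ref A k U := by
  induction k with
  | zero => exact ⟨hU, hne, fun x hx => (h x hx).imp fun y hy => ⟨hy.1, hy.2.1.1, hy.2.2⟩⟩
  | succ k ih =>
    have hUk := ih fun x hx => (h x hx).imp fun y hy => ⟨hy.1, hy.2.1.1, hy.2.2⟩
    refine ⟨hUk, fun U' hU' hsub n hn ψ s hψ hs hψ' => ?_⟩
    obtain ⟨q, hq⟩ := hZ.exists_opair ψ s
    obtain ⟨y, hyU, hy, hqy⟩ := h q (hZ.lim_opair hUk.lim hψ hs hq)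
    have hψy := hZ.transGen_mem hy.lim.1 (hZ.opair_transGen hq).1 hqy
    have hsy := hZ.transGen_mem hy.lim.1 (hZ.opair_transGen hq).2 hqy
    have hyU' : Sub A.mem y U := fun z hz => hZ.lev_trans hU hyU hz
    rw [← hy.2 U hUk hyU' n hn ψ s hψy hsy hψ',
      hy.2 U' hU' (fun z hz => hsub z (hyU' z hz)) n hn ψ s hψy hsy hψ']

/-- The reflection theorem, by induction on the metatheoretic `k`: a limit level closed under
catching all `Σ_k`-truths and `Π_k`-failures that occur in some `Ref A k` level lies in `Ref A (k +
1)`. -/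
theorem exists_ref (k : ℕ) (a : M) : ∃ U, Ref A k U ∧ A.mem a U := by
  induction k generalizing a with
  | zero =>
    obtain ⟨U, hU, ha, -⟩ := hZ.exists_lim_closed (fun _ _ => True) (fun x => ⟨x, trivial⟩) a
    exact ⟨U, hU, ha⟩
  | succ k ih =>
    obtain ⟨n, hn⟩ := hZ.exists_isNum k
    -- For `x = ⟨ψ, s⟩`, the level `y` realizes the outcome that persists upwards (truth for `Σ`,
    -- falsity for `Π`) as soon as any `Ref A k` level containing `x` does.
    let R : M → M → Prop := fun x y => Ref A k y ∧ A.mem x y ∧ ∀ ψ s, IsOPair A.mem x ψ s →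
      (IsSig A.mem w n ψ → (∃ U, Ref A k U ∧ A.mem x U ∧ LSat A U ψ s) → LSat A y ψ s) ∧
      (IsPi A.mem w n ψ → (∃ U, Ref A k U ∧ A.mem x U ∧ ¬ LSat A U ψ s) → ¬ LSat A y ψ s)
    have hR : ∀ x, ∃ y, R x y := by
      intro x
      by_cases hx : ∃ ψ s, IsOPair A.mem x ψ s
      · obtain ⟨ψ, s, hx⟩ := hx
        have pick : ∀ P : M → Prop, ∃ U, Ref A k U ∧ A.mem x U ∧
            ((∃ U, Ref A k U ∧ A.mem x U ∧ P U) → P U) := by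
          intro P
          by_cases hP : ∃ U, Ref A k U ∧ A.mem x U ∧ P U
          · exact hP.imp fun U hU => ⟨hU.1, hU.2.1, fun _ => hU.2.2⟩
          · exact (ih x).imp fun U hU => ⟨hU.1, hU.2, fun h => (hP h).elim⟩
        -- `U₁` and `U₂` take care of the `Σ` and the `Π` case; both outcomes persist to any `Ref A
        -- k` level above them.
        obtain ⟨U₁, hU₁, hxU₁, h₁⟩ := pick fun U => LSat A U ψ s
        obtain ⟨U₂, hU₂, hxU₂, h₂⟩ := pick fun U => ¬ LSat A U ψ s
        obtain ⟨c, hc⟩ := hZ.exists_upair U₁ U₂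
        obtain ⟨y, hy, hcy⟩ := ih c
        have hsub : ∀ U, A.mem U c → Sub A.mem U y := fun U hU z hz =>
          hZ.lev_trans hy.lim.1 (hZ.lev_trans hy.lim.1 hcy hU) hz
        have hs₁ := hsub U₁ ((hc U₁).2 (.inl rfl))
        have hs₂ := hsub U₂ ((hc U₂).2 (.inr rfl))
        refine ⟨y, hy, hs₁ x hxU₁, fun ψ' s' hx' => ?_⟩
        obtain ⟨rfl, rfl⟩ := hZ.opair_inj hx hx'
        have hT := hZ.opair_transGen hx
        constructor
        · exact fun hψ h => (hZ.ref_levy hU₁ hy hs₁ hn (hZ.transGen_mem hU₁.lim.1 hT.1 hxU₁)).1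
            hψ s (hZ.transGen_mem hU₁.lim.1 hT.2 hxU₁) (h₁ h)
        · exact fun hψ h h' => h₂ h <| (hZ.ref_levy hU₂ hy hs₂ hn
            (hZ.transGen_mem hU₂.lim.1 hT.1 hxU₂)).2 hψ s (hZ.transGen_mem hU₂.lim.1 hT.2 hxU₂) h'
      · obtain ⟨y, hy, hxy⟩ := ih x
        exact ⟨y, hy, hxy, fun ψ s h => (hx ⟨ψ, s, h⟩).elim⟩
    obtain ⟨U, hU, haU, hUR⟩ := hZ.exists_lim_closed R hR a
    have hUk : Ref A k U := hZ.ref_closed hU.1 hU.2.1 fun x hx =>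
      (hUR x hx).imp fun y hy => ⟨hy.1, hy.2.1, hy.2.2.1⟩
    refine ⟨U, ⟨hUk, fun U' hU' hsub n' hn' ψ s hψ hs hψ' => ?_⟩, haU⟩
    obtain rfl := hZ.isNum_unique hn hn'
    obtain ⟨q, hq⟩ := hZ.exists_opair ψ s
    have hqU := hZ.lim_opair hU hψ hs hq
    obtain ⟨y, hyU, hy, hqy, hR'⟩ := hUR q hqU
    have hψy := hZ.transGen_mem hy.lim.1 (hZ.opair_transGen hq).1 hqy
    have hsy := hZ.transGen_mem hy.lim.1 (hZ.opair_transGen hq).2 hqy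
    have hyU' : Sub A.mem y U := fun z hz => hZ.lev_trans hU.1 hyU hz
    have up := hZ.ref_levy hUk hU' hsub hn hψ
    have up' := hZ.ref_levy hy hUk hyU' hn hψy
    rcases hψ' with hψ' | hψ'
    · exact ⟨up.1 hψ' s hs, fun h => up'.1 hψ' s hsy
        ((hR' ψ s hq).1 hψ' ⟨U', hU', hsub q hqU, h⟩)⟩
    · refine ⟨fun h => ?_, up.2 hψ' s hs⟩
      by_contra h'
      exact (hR' ψ s hq).2 hψ' ⟨U', hU', hsub q hqU, h'⟩ (up'.2 hψ' s hsy h)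

end ModelsZF

end

section

variable {M : Type u}

/-! ### The satisfaction class defined from indiscernibles -/

/-- `U` is a limit level in which the elements of `I` have unbounded rank, and each of them is an
element of another one. -/
def IndLim (A : SetStr w M) (I : M → Prop) (U : M) : Prop :=
  Lim A.mem U ∧ ∀ x, A.mem x U → ∃ i j, A.mem i U ∧ A.mem j U ∧ I i ∧ I j ∧ A.mem i j ∧
    ∀ W, Lev A.mem W → A.mem i W → A.mem x W

/-- `φ` is satisfied in all sufficiently large levels in which `I` is unbounded. -/
def SatClass (A : SetStr w M) (I : M → Prop) (φ : M) : Prop :=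
  ∃ a, ∀ U, IndLim A I U → A.mem a U → ∀ e, IsZero A.mem e → LSat A U φ e

end

instance {α : Type} {i : α} : UDef.{u} (w := w) true (fun M A X v => SatClass A X (v i)) := by
  unfold SatClass IndLim; infer_instance

section

variable {M : Type u} {A : SetStr w M} {I : M → Prop}

instance {α : Type} {s : (α → M) → M} [Tm s] : PDef A I (fun v => SatClass A I (s v)) :=
  UDef.pdef1 (fun _ A I => SatClass A I)

/-! ### Reflection at levels in which the indiscernibles are unbounded -/

namespace ModelsIndisc

variable (hI : ModelsIndisc A I)
include hI

theorem exists_indLim (a : M) : ∃ U, IndLim A I U ∧ A.mem a U := by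
  have hZ := hI.zf
  let R : M → M → Prop := fun x y => ∃ i j, A.mem i y ∧ A.mem j y ∧ I i ∧ I j ∧ A.mem i j ∧
    ∀ W, Lev A.mem W → A.mem i W → A.mem x W
  have hR : ∀ x, ∃ y, R x y := by
    intro x
    obtain ⟨u, hu, hxu⟩ := hZ.exists_lev x
    -- With `i` at least `o ∉ u`, a level that contains `i` cannot be included in `u`, so it has `u`
    -- as an element and contains `x`.
    obtain ⟨o, ho, hou⟩ := hZ.exists_isOrd_not_mem u
    obtain ⟨i, hi, hoi⟩ := hI.cofinal o ho
    obtain ⟨i', hi'⟩ := hZ.exists_succ i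
    obtain ⟨j, hj, hij⟩ := hI.cofinal i' (hZ.isOrd_succ (hI.ord i hi) hi')
    have hii' : A.mem i i' := (hi' i).2 (.inr rfl)
    have hij : A.mem i j := by
      rcases hij with h | rfl
      exacts [(hI.ord j hj).1 i' h i hii', hii']
    obtain ⟨y, hy⟩ := hZ.exists_upair i j
    refine ⟨y, i, j, (hy i).2 (.inl rfl), (hy j).2 (.inr rfl), hi, hj, hij, fun W hW hiW => ?_⟩
    rcases hZ.lev_linear hW hu with h | h
    · refine (hou ?_).elim
      rcases hoi with hoi | rfl
      exacts [hZ.lev_trans hu (h i hiW) hoi, h o hiW]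
    · exact hZ.lev_trans hW h hxu
  obtain ⟨U, hU, ha, hR⟩ := hZ.exists_lim_closed R hR a
  refine ⟨U, ⟨hU, fun x hx => ?_⟩, ha⟩
  obtain ⟨y, hy, i, j, hi, hj, h⟩ := hR x hx
  exact ⟨i, j, hZ.lev_trans hU.1 hy hi, hZ.lev_trans hU.1 hy hj, h⟩

/-- The only use of indiscernibility: the claim is clear when `j` is chosen large enough for `i`,
and it is expressed without `I`, so it holds for every `j` above `i`. -/
theorem exists_ref_between (k : ℕ) {i j : M} (hi : I i) (hj : I j) (hij : A.mem i j) :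
    ∃ U, Ref A k U ∧ A.mem i U ∧ ¬ A.mem j U := by
  have hZ := hI.zf
  -- The value `false` matters: the formula must not contain the predicate `I`.
  obtain ⟨φ, hφ⟩ := (inferInstance : UDef.{u} (w := w) false
    (fun M A X (v : Fin 2 → M) => ∃ U, Ref A k U ∧ A.mem (v 0) U ∧ ¬ A.mem (v 1) U)).out
  have hφ' : ∀ v, A.Sat φ v ↔ ∃ U, Ref A k U ∧ A.mem (v 0) U ∧ ¬ A.mem (v 1) U := by
    intro v
    rw [← hφ M A I v, SetStr.Sat, ← A.str_false I]
    exact Iff.rfl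
  obtain ⟨U, hU, hiU⟩ := hZ.exists_ref k i
  obtain ⟨o, ho, hoU⟩ := hZ.exists_isOrd_not_mem U
  obtain ⟨j', hj', hoj'⟩ := hI.cofinal o ho
  have hj'U : ¬ A.mem j' U := by
    intro h
    rcases hoj' with hoj' | rfl
    exacts [hoU (hZ.lev_trans hU.lim.1 h hoj'), hoU h]
  have hij' : A.mem i j' := by
    rcases hZ.isOrd_trichotomy (hI.ord i hi) (hI.ord j' hj') with h | rfl | h
    exacts [h, (hj'U hiU).elim, (hj'U (hZ.lev_trans hU.lim.1 hiU h)).elim]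
  have mono : ∀ j, A.mem i j → ∀ l m : Fin 2, l < m → A.mem (![i, j] l) (![i, j] m) := by
    intro j hij l m hlm
    obtain rfl : l = 0 := by omega
    obtain rfl : m = 1 := by omega
    exact hij
  have h := (hI.indisc 2 φ ![i, j] ![i, j'] (by simp [Fin.forall_fin_two, hi, hj])
    (by simp [Fin.forall_fin_two, hi, hj']) (mono j hij) (mono j' hij')).2
      ((hφ' _).2 ⟨U, hU, hiU, hj'U⟩)
  exact (hφ' _).1 h

/-- Each `x ∈ U` has rank at most that of some `i` with `i ∈ j` in `I ∩ U`. A `Ref A k` level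
between `i` and `j` contains `x` and, missing `j ∈ U`, is an element of `U`. -/
theorem indLim_ref {U : M} (hU : IndLim A I U) (k : ℕ) : Ref A k U := by
  have hZ := hI.zf
  refine hZ.ref_closed hU.1.1 hU.1.2.1 fun x hx => ?_
  obtain ⟨i, j, hiU, hjU, hi, hj, hij, hxi⟩ := hU.2 x hx
  obtain ⟨W, hW, hiW, hjW⟩ := hI.exists_ref_between k hi hj hij
  refine ⟨W, ?_, hW, hxi W hW.lim.1 hiW⟩
  exact (hZ.lev_linear hU.1.1 hW.lim.1).resolve_left fun h => hjW (h j hjU)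

theorem lsat_abs {U U' φ s : M} (hU : IndLim A I U) (hU' : IndLim A I U')
    (hsub : Sub A.mem U U') (h : StdLevy A φ) (hφ : A.mem φ U) (hs : A.mem s U) :
    LSat A U φ s ↔ LSat A U' φ s := by
  rcases h with h | ⟨k, n, hn, h⟩
  · exact hI.zf.lsat_delta0 hU.1 hU'.1 hsub h hφ hs
  · exact (hI.indLim_ref hU (k + 1)).2 U' (hI.indLim_ref hU' k) hsub n hn φ s hφ hs h

/-- By absoluteness a single level containing `φ` decides membership in the class; for the forward
direction it is compared with a larger one beyond the threshold. -/
theorem satClass_iff {U φ e : M} (hU : IndLim A I U) (h : StdLevy A φ) (hφ : A.mem φ U)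
    (he : IsZero A.mem e) : SatClass A I φ ↔ LSat A U φ e := by
  have hZ := hI.zf
  have heU : ∀ {U}, IndLim A I U → A.mem e U := fun hU =>
    let ⟨x, hx⟩ := hU.1.2.1
    hZ.lev_super hU.1.1 hx fun z hz => (he z hz).elim
  constructor
  · rintro ⟨a, ha⟩
    obtain ⟨c, hc⟩ := hZ.exists_upair a U
    obtain ⟨U', hU', hcU'⟩ := hI.exists_indLim c
    have h1 := ha U' hU' (hZ.lev_trans hU'.1.1 hcU' ((hc a).2 (.inl rfl))) e he
    have h2 := hZ.lev_trans hU'.1.1 hcU' ((hc U).2 (.inr rfl))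
    exact (hI.lsat_abs hU hU' (fun z => hZ.lev_trans hU'.1.1 h2) h hφ (heU hU)).2 h1
  · refine fun hsat => ⟨U, fun U' hU' hUU' e' he' => ?_⟩
    obtain rfl := hZ.zero_unique he he'
    exact (hI.lsat_abs hU hU' (fun z => hZ.lev_trans hU'.1.1 hUU') h hφ (heU hU)).1 hsat

theorem satClass_iff_of_forall {φ : M} {P : Prop}
    (h : ∀ U e, A.mem e U → IsZero A.mem e → (LSat A U φ e ↔ P)) : SatClass A I φ ↔ P := by
  have hZ := hI.zf
  obtain ⟨e, he⟩ := hZ.exists_zero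
  constructor
  · rintro ⟨a, ha⟩
    obtain ⟨c, hc⟩ := hZ.exists_upair a e
    obtain ⟨U, hU, hcU⟩ := hI.exists_indLim c
    exact (h U e (hZ.lev_trans hU.1.1 hcU ((hc e).2 (.inr rfl))) he).1
      (ha U hU (hZ.lev_trans hU.1.1 hcU ((hc a).2 (.inl rfl))) e he)
  · refine fun hP => ⟨e, fun U hU heU e' he' => ?_⟩
    obtain rfl := hZ.zero_unique he he'
    exact (h U e heU he).2 hP

theorem isSigmaSatClass (k : ℕ) {n : M} (hn : IsNum A.mem k n) :
    IsSigmaSatClass A n (SatClass A I) := by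
  have hZ := hI.zf
  have std : ∀ {φ}, IsSigmaSent A.mem w n φ → StdLevy A φ :=
    fun h => .inr ⟨k, n, hn, .inl h.2.2⟩
  obtain ⟨e, he⟩ := hZ.exists_zero
  have heU : ∀ {U}, IndLim A I U → A.mem e U := fun hU =>
    let ⟨x, hx⟩ := hU.1.2.1
    hZ.lev_super hU.1.1 hx fun z hz => (he z hz).elim
  constructor
  · intro x y c d φ hc hd hφ
    refine hI.satClass_iff_of_forall fun U e he _ => ?_
    simp [hZ.lsat_eq he hφ, hZ.val_const hc, hZ.val_const hd]
  · intro x y c d φ hc hd hφ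
    refine hI.satClass_iff_of_forall fun U e he _ => ?_
    simp [hZ.lsat_mem he hφ, hZ.val_const hc, hZ.val_const hd]
  · intro hw x y c d φ hc hd hφ
    refine hI.satClass_iff_of_forall fun U e he _ => ?_
    simp [hZ.lsat_lt he hφ, hZ.val_const hc, hZ.val_const hd, hw]
  · intro φ ψ hφ h
    obtain ⟨U, hU, hφU⟩ := hI.exists_indLim φ
    rw [hI.satClass_iff hU (std hφ) hφU he,
      hI.satClass_iff hU (hZ.stdLevy_isSub (std hφ) (.inl h))
        (hZ.transGen_mem hU.1.1 (hZ.neg_transGen h) hφU) he, hZ.lsat_neg (heU hU) h]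
  · intro φ ψ₁ ψ₂ hφ h
    obtain ⟨U, hU, hφU⟩ := hI.exists_indLim φ
    rw [hI.satClass_iff hU (std hφ) hφU he,
      hI.satClass_iff hU (hZ.stdLevy_isSub (std hφ) (.inr (.inl ⟨_, .inl h⟩)))
        (hZ.transGen_mem hU.1.1 (hZ.code_transGen h).1 hφU) he,
      hI.satClass_iff hU (hZ.stdLevy_isSub (std hφ) (.inr (.inl ⟨_, .inr h⟩)))
        (hZ.transGen_mem hU.1.1 (hZ.code_transGen h).2 hφU) he, hZ.lsat_or (heU hU) h]
  · intro φ v ψ hφ h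
    have hψ := hZ.stdLevy_isSub (std hφ) (.inr (.inr ⟨v, h⟩))
    have hT := hZ.code_transGen h.2
    constructor
    · intro hsat
      obtain ⟨U, hU, hφU⟩ := hI.exists_indLim φ
      obtain ⟨x, s, hx, hs, hsat⟩ := (hZ.lsat_ex (heU hU) h).1
        ((hI.satClass_iff hU (std hφ) hφU he).1 hsat)
      have hψU := hZ.transGen_mem hU.1.1 hT.2 hφU
      have hsU := hZ.lim_upd hU.1 (heU hU) (hZ.transGen_mem hU.1.1 hT.1 hφU) hx hs
      -- The formation derivation of the sentence `φ` contains one of `ψ`, which makes the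
      -- substitution possible.
      obtain ⟨W, e', hW, he', q, hq, hqW⟩ := hφ.2.1
      obtain ⟨χ, hχ⟩ : ∃ χ, IsSubst A.mem w ψ v x χ := by
        obtain ⟨φ', t, hφ', H⟩ := hW q hqW
        obtain ⟨rfl, rfl⟩ := hZ.opair_inj hq hφ'
        rcases H with ⟨k, t₁, t₂, hk, hc, -⟩ | ⟨ψ', h1, -⟩ | ⟨ψ₁, ψ₂, h1, -⟩ | ⟨m, ψ', r, h1, -, h2⟩
        · rcases hk with rfl | rfl | ⟨rfl, -⟩ <;> exact absurd (hZ.code_inj h.2 hc).1 (by decide)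
        · exact absurd (hZ.neg_code h1 h.2) (by decide)
        · exact absurd (hZ.code_inj h.2 h1).1 (by decide)
        · obtain ⟨-, -, rfl⟩ := hZ.code_inj h.2 h1.2
          exact hZ.exists_isSubst hW v x h2
      -- The threshold for `χ` is `U`: absoluteness is applied to `ψ` with the assignment `s`, so
      -- the Levy class of `χ` plays no role.
      refine ⟨x, χ, hχ, U, fun U' hU' hUU' e' he' => ?_⟩
      obtain rfl := hZ.zero_unique he he'
      have hsub : Sub A.mem U U' := fun z => hZ.lev_trans hU'.1.1 hUU'
      exact (hZ.lsat_subst hU'.1 hχ (hsub ψ hψU) (heU hU') (hsub s hsU) hs).2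
        ((hI.lsat_abs hU hU' hsub hψ hψU hsU).1 hsat)
    · rintro ⟨x, χ, hχ, a, ha⟩
      obtain ⟨c, hc⟩ := hZ.exists_upair a x
      obtain ⟨d, hd⟩ := hZ.exists_upair c φ
      obtain ⟨U, hU, hdU⟩ := hI.exists_indLim d
      have hcU := hZ.lev_trans hU.1.1 hdU ((hd c).2 (.inl rfl))
      have hφU := hZ.lev_trans hU.1.1 hdU ((hd φ).2 (.inr rfl))
      have haU := hZ.lev_trans hU.1.1 hcU ((hc a).2 (.inl rfl))
      have hxU := hZ.lev_trans hU.1.1 hcU ((hc x).2 (.inr rfl))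
      obtain ⟨s, hs⟩ := hZ.exists_upd e v x
      have hsU := hZ.lim_upd hU.1 (heU hU) (hZ.transGen_mem hU.1.1 hT.1 hφU) hxU hs
      rw [hI.satClass_iff hU (std hφ) hφU he, hZ.lsat_ex (heU hU) h]
      exact ⟨x, s, hxU, hs, (hZ.lsat_subst hU.1 hχ (hZ.transGen_mem hU.1.1 hT.2 hφU) (heU hU)
        hsU hs).1 (ha U hU haU e he)⟩

end ModelsIndisc

/-! ### Amenability -/

/-- Induction on formulae: the predicate symbol is replaced by the definition of `S`. The language
has no function symbols, so terms are variables, sent to variables or parameters by `f` and `g`. -/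
theorem pdef_realize {S : M → Prop} (hS : PDef A I (fun v : Fin 1 → M => S (v 0))) {α : Type*}
    {n : ℕ} (φ : (LSet w true).BoundedFormula α n) :
    ∀ {γ : Type} (f : α → γ ⊕ M) (g : Fin n → γ ⊕ M), PDef A I (fun v : γ → M =>
      @BoundedFormula.Realize (LSet w true) M (A.expand S) _ _ φ
        (fun a => Sum.elim v id (f a)) (fun i => Sum.elim v id (g i))) := by
  let _ := A.expand S
  have hterm : ∀ {γ : Type} {n : ℕ} (f : α → γ ⊕ M) (g : Fin n → γ ⊕ M)
      (t : (LSet w true).Term (α ⊕ Fin n)), Tm (fun v : γ → M =>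
        t.realize (Sum.elim (fun a => Sum.elim v id (f a)) (fun i => Sum.elim v id (g i)))) := by
    intro γ n f g t
    rcases t with (a | i) | ⟨f, -⟩
    · exact ⟨f a, fun v => rfl⟩
    · exact ⟨g i, fun v => rfl⟩
    · exact nomatch f
  induction φ with
  | falsum => intro γ f g; exact PDef.false
  | equal t₁ t₂ =>
    intro γ f g
    have := hterm f g t₁
    have := hterm f g t₂
    exact PDef.eq
  | rel r ts =>
    intro γ f g
    have := fun i => hterm f g (ts i)
    cases r with
    | mem => exact PDef.mem (s := fun v => (ts 0).realize _) (t := fun v => (ts 1).realize _)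
    | lt h =>
      have : PDef A I (fun v : γ → M => ∃ h : w = true,
        A.lt h ((ts 0).realize (Sum.elim (fun a => Sum.elim v id (f a))
          (fun i => Sum.elim v id (g i)))) ((ts 1).realize (Sum.elim (fun a => Sum.elim v id (f a))
          (fun i => Sum.elim v id (g i))))) := inferInstance
      exact this.congr fun v => ⟨fun h' => ⟨h, h'⟩, fun h' => h'.2⟩
    | pred h => exact hS.comp (t := fun _ v => (ts 0).realize _) (fun _ => this 0)
  | imp φ ψ ih₁ ih₂ =>
    intro γ f g
    have := ih₁ f g
    have := ih₂ f g
    exact PDef.imp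
  | @all n φ ih =>
    intro γ f g
    have lift : ∀ (v : γ → M) (x : M) (s : γ ⊕ M),
        Sum.elim (fun o : Option γ => o.elim x v) id (s.map some id) = Sum.elim v id s := by
      rintro v x (c | m) <;> rfl
    have h := ih (γ := Option γ) (fun a => (f a).map some id)
      (Fin.snoc (fun i => (g i).map some id) (Sum.inl none))
    refine PDef.all (P := fun v x => φ.Realize _ (Fin.snoc _ x)) (hP := h.congr fun v => ?_)
    refine iff_of_eq (congrArg₂ (BoundedFormula.Realize φ) ?_ ?_)
    · funext a
      rcases f a with c | m <;> rfl
    · funext i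
      refine Fin.lastCases ?_ (fun i => ?_) i
      · simp
      · simp only [Fin.snoc_castSucc]
        rcases g i with c | m <;> rfl

theorem pdef_satX {S : M → Prop} (hS : PDef A I (fun v : Fin 1 → M => S (v 0))) {n : ℕ}
    (φ : (LSet w true).Formula (Fin n)) {γ : Type} (f : Fin n → γ ⊕ M) :
    PDef A I (fun v : γ → M => A.SatX S φ (fun i => Sum.elim v id (f i))) := by
  refine (pdef_realize hS φ f Fin.elim0).congr fun v => ?_
  exact iff_of_eq (congrArg (@BoundedFormula.Realize _ _ (A.expand S) _ _ φ _)
    (Subsingleton.elim _ _))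

theorem ModelsZF.isAmenable (hZ : ModelsZF A I) {S : M → Prop}
    (hS : PDef A I (fun v : Fin 1 → M => S (v 0))) : IsAmenable A S where
  extensionality := hZ.extensionality
  foundation := hZ.foundation
  pairing := hZ.pairing
  union := hZ.union
  powerset := hZ.powerset
  infinity := hZ.infinity
  separation n φ a v := by
    have : PDef A I (fun v : Fin 1 → M => A.SatX S φ (Fin.cons (v 0) a)) :=
      (pdef_satX hS φ (Fin.cons (.inl 0) fun i => .inr (a i))).congr fun v =>
        iff_of_eq (congrArg _ (funext fun i => by refine Fin.cases ?_ (fun i => ?_) i <;> simp))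
    exact hZ.sep (fun x => A.SatX S φ (Fin.cons x a)) v
  collection n φ a v h := by
    have : PDef A I (fun v : Fin 2 → M => A.SatX S φ (Fin.cons (v 0) (Fin.cons (v 1) a))) :=
      (pdef_satX hS φ (Fin.cons (.inl 0) (Fin.cons (.inl 1) fun i => .inr (a i)))).congr fun v =>
        iff_of_eq (congrArg _ (funext fun i => by
          refine Fin.cases ?_ (fun i => ?_) i
          · simp
          · refine Fin.cases ?_ (fun i => ?_) i <;> simp))
    exact hZ.coll (fun x y => A.SatX S φ (Fin.cons x (Fin.cons y a))) v h

/-! ### Standard models of arithmetic -/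

/-- Elements of natural numbers are natural numbers, so the isomorphism determines each `f k` as the
set of its predecessors; induction on `k` makes it the `k`-th numeral. -/
theorem ModelsZF.isNum_of_isOmegaStandard (hZ : ModelsZF A I) (h : IsOmegaStandard A) {n : M}
    (hn : IsNat A.mem n) : ∃ k, IsNum A.mem k n := by
  obtain ⟨f⟩ := h
  have key : ∀ k, IsNum A.mem k (f k).1 := by
    intro k
    induction k with
    | zero =>
      intro z hz
      have hz' := f.symm.map_rel_iff.2
        (show A.mem (⟨z, hZ.mem_isNat (f 0).2 hz⟩ : {x // IsNat A.mem x}).1 (f 0).1 from hz)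
      simp at hz'
    | succ k ih =>
      refine ⟨_, ih, fun z => ⟨fun hz => ?_, ?_⟩⟩
      · have hz' := f.symm.map_rel_iff.2
          (show A.mem (⟨z, hZ.mem_isNat (f (k + 1)).2 hz⟩ : {x // IsNat A.mem x}).1
            (f (k + 1)).1 from hz)
        rw [f.symm_apply_apply, Nat.lt_succ_iff_lt_or_eq] at hz'
        rcases hz' with hz' | hz'
        · left
          have := f.map_rel_iff.2 hz'
          rwa [f.apply_symm_apply] at this
        · right
          rw [← hz', f.apply_symm_apply]
      · rintro (hz | rfl)
        · have hz' := f.symm.map_rel_iff.2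
            (show A.mem (⟨z, hZ.mem_isNat (f k).2 hz⟩ : {x // IsNat A.mem x}).1 (f k).1 from hz)
          rw [f.symm_apply_apply] at hz'
          have := f.map_rel_iff.2 (hz'.trans (Nat.lt_succ_self k))
          rwa [f.apply_symm_apply] at this
        · exact f.map_rel_iff.2 (Nat.lt_succ_self k)
  refine ⟨f.symm ⟨n, hn⟩, ?_⟩
  have := key (f.symm ⟨n, hn⟩)
  rwa [f.apply_symm_apply] at this

end

/-! ### The uniform defining formula and the conclusion -/

theorem exists_formula_satClass (w : Bool) : ∃ σ : (LSet w true).Formula (Fin 1),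
    ∀ (M : Type u) (A : SetStr w M) (I : M → Prop), A.definedSet I σ = SatClass A I := by
  obtain ⟨σ, hσ⟩ := (inferInstance : UDef.{u} (w := w) true
    (fun M A X (v : Fin 1 → M) => SatClass A X (v 0))).out
  refine ⟨σ, fun M A I => funext fun x => propext ?_⟩
  refine Iff.trans ?_ (hσ M A I ![x])
  rw [SetStr.definedSet, SetStr.SatX, ← A.str_true I]
  exact Iff.rfl

theorem ModelsIndisc.satClass {M : Type u} {A : SetStr w M} {I : M → Prop}
    (hI : ModelsIndisc A I) : IsSigmaOmegaSatClass A (SatClass A I) ∧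
      IsAmenable A (SatClass A I) ∧ (IsOmegaStandard A → IsFullSatClass A (SatClass A I)) := by
  refine ⟨fun k x hx => hI.isSigmaSatClass k hx, hI.zf.isAmenable inferInstance,
    fun h x hx => ?_⟩
  obtain ⟨k, hk⟩ := hI.zf.isNum_of_isOmegaStandard h hx
  exact hI.isSigmaSatClass k hk

end ZFIndisc

theorem theorem3p3 :
    (∃ σ : (LSet false true).Formula (Fin 1),
      ∀ (M : Type u) (A : SetStr false M) (I : M → Prop), ModelsZFI A I →
        IsSigmaOmegaSatClass A (A.definedSet I σ) ∧
        IsAmenable A (A.definedSet I σ) ∧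
        (IsOmegaStandard A → IsFullSatClass A (A.definedSet I σ))) ∧
    (∃ σ : (LSet true true).Formula (Fin 1),
      ∀ (M : Type u) (A : SetStr true M) (I : M → Prop), ModelsZFILt A I →
        IsSigmaOmegaSatClass A (A.definedSet I σ) ∧
        IsAmenable A (A.definedSet I σ) ∧
        (IsOmegaStandard A → IsFullSatClass A (A.definedSet I σ))) := by
  constructor
  · obtain ⟨σ, hσ⟩ := exists_formula_satClass.{u} false
    refine ⟨σ, fun M A I hI => ?_⟩
    rw [hσ M A I]
    exact ModelsIndisc.satClass hI
  · obtain ⟨σ, hσ⟩ := exists_formula_satClass.{u} true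
    refine ⟨σ, fun M A I hI => ?_⟩
    rw [hσ M A I]
    exact ModelsIndisc.satClass hI.indiscernibles
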